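/- Let $G$ be a compact semisimple Lie group with a bi-invariant Riemannian metric $\langle\,,\rangle_0$, let $K_1,K_2,H,L\subseteq G$ be closed subgroups with $H\subseteq L\subseteq K_2$, and suppose that $G/K_1=K_2/H$ as homogeneous spaces, that is, there is a $K_2$-equivariant bijection $F:K_2/H\to G/K_1$, where $K_2$ acts on both spaces by left translation. Let $\mathfrak h\subseteq\mathfrak l\subseteq\mathfrak k_2$ be the Lie algebras of $H\subseteq L\subseteq K_2$, let $\mathfrak m_1$ be an $\mathrm{Ad}(H)$-invariant subspace with $\mathfrak l=\mathfrak h\oplus\mathfrak m_1$ and $\mathfrak m_2$ an $\mathrm{Ad}(L)$-invariant subspace with $\mathfrak k_2=\mathfrak l\oplus\mathfrak m_2$, let $\mathfrak m_1=\mathfrak p_1\oplus\cdots\oplus\mathfrak p_r$ be a decomposition into irreducible $\mathrm{Ad}(H)$-invariant subspaces and $\mathfrak m_2=\mathfrak q_1\oplus\cdots\oplus\mathfrak q_s$ a decomposition into irreducible $\mathrm{Ad}(L)$-invariant subspaces. All these are real representations. An irreducible real representation $\psi$ is called orthogonal if $\psi\otimes\mathbf C$ is irreducible; otherwise $\psi\otimes\mathbf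 C=\varphi\oplus\bar\varphi$ with $\varphi$ irreducible, and $\psi$ is called unitary if $\varphi\not\cong\bar\varphi$ and symplectic if $\varphi\cong\bar\varphi$. Assume: (i) each $\mathfrak q_j$ is also $\mathrm{Ad}(H)$-irreducible, so that $\mathfrak q_1\oplus\cdots\oplus\mathfrak q_s$ is an irreducible decomposition of $\mathfrak m_2$ with respect to both $\mathrm{Ad}(H)$ and $\mathrm{Ad}(L)$; (ii) for all $i,j$ the $\mathrm{Ad}(H)$-representations $\mathfrak p_i$ and $\mathfrak q_j$ are inequivalent; (iii) whenever $i\neq j$ and $\mathfrak q_i,\mathfrak q_j$ are equivalent under $\mathrm{Ad}(H)$, they are also equivalent under $\mathrm{Ad}(L)$, and they are of the same type with respect to both groups, i.e. $\mathfrak q_i$ and $\mathfrak q_j$ are either both orthogonal, both unitary or both symplectic, as $H$-representations and as $L$-representations alike. Then there is a Riemannian submersion from $(G,\langle\,,\rangle_0)$ onto $K_2/L$. More precisely, for the standard smooth structure on $K_2/L$ (the one for which $K_2\to K_2/L$ is a smooth submersion, where $K_2$ is a Lie group embedded in $G$) there is a $K_2$-invariant Riemannian metric on $K_2/L$ for which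 the composite $\pi:G\to G/K_1\xrightarrow{F^{-1}}K_2/H\to K_2/L$ is a surjective Riemannian submersion; if moreover the fibres $K_1$ of $G\to G/K_1$ and $L/H$ of $K_2/H\to K_2/L$ are connected, then all fibres of $\pi$ are connected. -/

import Mathlib

open scoped Manifold ContDiff TensorProduct

/-! ## Real representations: restriction, complexification, type -/

section Reps

/-- A subrepresentation of the restriction of `ρ` to the subgroup `L`, regarded as a
subrepresentation of the restriction of `ρ` to a smaller subgroup `H`. -/
def Subrepresentation.restrictTo {k Γ V : Type*} [Semiring k] [Group Γ] [AddCommMonoid V]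
    [Module k V] {ρ : Representation k Γ V} {H L : Subgroup Γ} (hHL : H ≤ L)
    (q : Subrepresentation (ρ.comp L.subtype)) : Subrepresentation (ρ.comp H.subtype) where
  toSubmodule := q.toSubmodule
  apply_mem_toSubmodule h _ hv := q.apply_mem_toSubmodule ⟨h.1, hHL h.2⟩ hv

/-- `m = ⨁ q i` is a decomposition of `m` into irreducible subrepresentations. -/
structure IsIrreducibleDecomposition {k Γ V ι : Type*} [Field k] [Group Γ] [AddCommGroup V]
    [Module k V] {ρ : Representation k Γ V} (m : Submodule k V) (q : ι → Subrepresentation ρ) :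
    Prop where
  independent : iSupIndep fun i => (q i).toSubmodule
  iSup_eq : ⨆ i, (q i).toSubmodule = m
  irreducible : ∀ i, (q i).toRepresentation.IsIrreducible

variable {S V : Type*} [Group S] [AddCommGroup V] [Module ℝ V]

/-- The complexification `ψ ⊗ ℂ` of a real representation `ψ`. -/
noncomputable def Representation.complexify (ψ : Representation ℝ S V) :
    Representation ℂ S (ℂ ⊗[ℝ] V) :=
  (Module.End.baseChangeHom ℝ ℂ V : Module.End ℝ V →* Module.End ℂ (ℂ ⊗[ℝ] V)).comp ψ

/-- Complex conjugation `z ⊗ v ↦ conj z ⊗ v` on the complexification of `V`. -/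
noncomputable def complexConj (V : Type*) [AddCommGroup V] [Module ℝ V] :
    ℂ ⊗[ℝ] V →ₗ[ℝ] ℂ ⊗[ℝ] V :=
  LinearMap.rTensor V Complex.conjAe.toLinearMap

theorem complexConj_smul (c : ℂ) (x : ℂ ⊗[ℝ] V) :
    complexConj V (c • x) = (starRingEnd ℂ c) • complexConj V x := by
  induction x using TensorProduct.induction_on with
  | zero => simp
  | tmul z v => simp [complexConj, TensorProduct.smul_tmul']
  | add x y hx hy => simp [smul_add, hx, hy]

theorem complexConj_complexify (ψ : Representation ℝ S V) (s : S) (x : ℂ ⊗[ℝ] V) :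
    complexConj V (ψ.complexify s x) = ψ.complexify s (complexConj V x) := by
  induction x using TensorProduct.induction_on with
  | zero => simp
  | tmul z v => rfl
  | add x y hx hy => simp [hx, hy]

/-- The conjugate `conj φ` of a subrepresentation `φ` of `ψ ⊗ ℂ`: since conjugation is an
involution, it is the preimage (equivalently the image) of `φ` under conjugation. -/
noncomputable def Subrepresentation.conj {ψ : Representation ℝ S V}
    (φ : Subrepresentation ψ.complexify) : Subrepresentation ψ.complexify where
  toSubmodule :=
    { carrier := {x | complexConj V x ∈ φ.toSubmodule}
      add_mem' := fun {a b} ha hb => by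
        simp only [Set.mem_ofPred_eq, map_add] at *
        exact add_mem ha hb
      zero_mem' := by simp
      smul_mem' := fun c x hx => by
        simp only [Set.mem_ofPred_eq, complexConj_smul] at *
        exact Submodule.smul_mem _ _ hx }
  apply_mem_toSubmodule s x hx := by
    change complexConj V (ψ.complexify s x) ∈ φ.toSubmodule
    rw [complexConj_complexify]
    exact φ.apply_mem_toSubmodule s hx

/-- The three possible types of an irreducible real representation. -/
inductive RealRepType
  | orthogonal
  | unitary
  | symplectic

/-- `ψ` is orthogonal if `ψ ⊗ ℂ` is irreducible; otherwise `ψ ⊗ ℂ = φ ⊕ conj φ` with `φ`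
irreducible, and `ψ` is unitary if `φ` and `conj φ` are inequivalent, symplectic if they are
equivalent. -/
def Representation.HasRealType (ψ : Representation ℝ S V) : RealRepType → Prop
  | .orthogonal => ψ.complexify.IsIrreducible
  | .unitary => ¬ ψ.complexify.IsIrreducible ∧
      ∃ φ : Subrepresentation ψ.complexify, φ.toRepresentation.IsIrreducible ∧ IsCompl φ φ.conj ∧
        IsEmpty (φ.toRepresentation.Equiv φ.conj.toRepresentation)
  | .symplectic => ¬ ψ.complexify.IsIrreducible ∧
      ∃ φ : Subrepresentation ψ.complexify, φ.toRepresentation.IsIrreducible ∧ IsCompl φ φ.conj ∧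
        Nonempty (φ.toRepresentation.Equiv φ.conj.toRepresentation)

end Reps

/-! ## Lie groups, adjoint representation, closed subgroups -/

section Lie

variable {n : ℕ} {G : Type*} [TopologicalSpace G] [ChartedSpace (EuclideanSpace ℝ (Fin n)) G]
  [Group G]

/-- Conjugation by `g`, as a map of `G`. -/
def conjMap (g x : G) : G := g * x * g⁻¹

theorem contMDiff_conjMap [LieGroup (𝓡 n) ∞ G] (g : G) :
    ContMDiff (𝓡 n) (𝓡 n) ∞ (conjMap g : G → G) :=
  (contMDiff_const.mul contMDiff_id).mul contMDiff_const

theorem mfderiv_of_eq_id {n : ℕ} {G : Type*} [TopologicalSpace G]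
    [ChartedSpace (EuclideanSpace ℝ (Fin n)) G] {f : G → G} (hf : f = id) (x : G) :
    (mfderiv (𝓡 n) (𝓡 n) f x : EuclideanSpace ℝ (Fin n) →L[ℝ] EuclideanSpace ℝ (Fin n)) =
      ContinuousLinearMap.id ℝ _ := by
  subst hf
  exact mfderiv_id

/-- `Ad g`, the differential at the identity of conjugation by `g` (which fixes the identity). -/
noncomputable def adMap (g : G) : GroupLieAlgebra (𝓡 n) G →L[ℝ] GroupLieAlgebra (𝓡 n) G :=
  (mfderiv (𝓡 n) (𝓡 n) (conjMap g : G → G) 1 :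
    EuclideanSpace ℝ (Fin n) →L[ℝ] EuclideanSpace ℝ (Fin n))

theorem adMap_one : adMap (1 : G) = ContinuousLinearMap.id ℝ (GroupLieAlgebra (𝓡 n) G) :=
  mfderiv_of_eq_id (by ext x; simp [conjMap]) 1

theorem adMap_mul [LieGroup (𝓡 n) ∞ G] (a b : G) :
    (adMap (a * b) : GroupLieAlgebra (𝓡 n) G →L[ℝ] GroupLieAlgebra (𝓡 n) G) =
      (adMap a).comp (adMap b) := by
  have h : (conjMap (a * b) : G → G) = conjMap a ∘ conjMap b := by
    ext x; simp [conjMap, mul_assoc]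
  have hd (c x : G) : MDifferentiableAt (𝓡 n) (𝓡 n) (conjMap c : G → G) x :=
    (contMDiff_conjMap c).mdifferentiableAt (by simp)
  have h1 : (conjMap b (1 : G)) = 1 := by simp [conjMap]
  have key : ∀ (f : G → G) (y : G), f = conjMap a ∘ conjMap b → conjMap b 1 = y →
      (mfderiv (𝓡 n) (𝓡 n) f 1 : EuclideanSpace ℝ (Fin n) →L[ℝ] EuclideanSpace ℝ (Fin n)) =
      (mfderiv (𝓡 n) (𝓡 n) (conjMap a : G → G) y :
        EuclideanSpace ℝ (Fin n) →L[ℝ] EuclideanSpace ℝ (Fin n)).comp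
      (mfderiv (𝓡 n) (𝓡 n) (conjMap b : G → G) 1) := by
    rintro f y rfl rfl
    exact mfderiv_comp (I' := 𝓡 n) (1 : G) (hd a (conjMap b 1)) (hd b 1)
  exact key _ _ h h1

/-- The adjoint representation of `G` on its Lie algebra. -/
noncomputable def adRep (n : ℕ) (G : Type*) [TopologicalSpace G]
    [ChartedSpace (EuclideanSpace ℝ (Fin n)) G] [Group G] [LieGroup (𝓡 n) ∞ G] :
    Representation ℝ G (GroupLieAlgebra (𝓡 n) G) where
  toFun g := (adMap g).toLinearMap
  map_one' := by rw [adMap_one]; rfl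
  map_mul' a b := by rw [adMap_mul]; rfl

/-- The adjoint representation of a subgroup of `G` on the Lie algebra of `G`. -/
noncomputable abbrev adRepOn (n : ℕ) {G : Type*} [TopologicalSpace G]
    [ChartedSpace (EuclideanSpace ℝ (Fin n)) G] [Group G] [LieGroup (𝓡 n) ∞ G] (S : Subgroup G) :
    Representation ℝ S (GroupLieAlgebra (𝓡 n) G) :=
  (adRep n G).comp S.subtype

/-- `G` is semisimple: its Lie algebra is. -/
def IsSemisimpleLieGroup (n : ℕ) (G : Type*) [TopologicalSpace G]
    [ChartedSpace (EuclideanSpace ℝ (Fin n)) G] [Group G] [LieGroup (𝓡 n) ∞ G] : Prop :=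
  haveI : LieGroup (𝓡 n) (minSmoothness ℝ 3) G := 
    LieGroup.of_le (n := ∞) (by simpa using ENat.LEInfty.out)
  LieAlgebra.IsSemisimple ℝ (GroupLieAlgebra (𝓡 n) G)

/-- The velocity at time `0` of a curve `γ` with `γ 0 = 1`, as an element of the Lie algebra. -/
noncomputable def velocity (n : ℕ) {G : Type*} [TopologicalSpace G]
    [ChartedSpace (EuclideanSpace ℝ (Fin n)) G] [Group G] (γ : ℝ → G) :
    GroupLieAlgebra (𝓡 n) G :=
  (mfderiv 𝓘(ℝ, ℝ) (𝓡 n) γ 0 (1 : ℝ) : EuclideanSpace ℝ (Fin n))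

theorem velocity_mul [LieGroup (𝓡 n) ∞ G] {γ₁ γ₂ : ℝ → G}
    (h₁ : ContMDiff 𝓘(ℝ, ℝ) (𝓡 n) ∞ γ₁) (h₂ : ContMDiff 𝓘(ℝ, ℝ) (𝓡 n) ∞ γ₂)
    (e₁ : γ₁ 0 = 1) (e₂ : γ₂ 0 = 1) :
    velocity n (fun t => γ₁ t * γ₂ t) = velocity n γ₁ + velocity n γ₂ := by
  have d₁ : MDifferentiableAt 𝓘(ℝ, ℝ) (𝓡 n) γ₁ 0 := h₁.mdifferentiableAt (by simp)
  have d₂ : MDifferentiableAt 𝓘(ℝ, ℝ) (𝓡 n) γ₂ 0 := h₂.mdifferentiableAt (by simp)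
  have dm : MDifferentiableAt ((𝓡 n).prod (𝓡 n)) (𝓡 n) (fun p : G × G => p.1 * p.2)
      (γ₁ 0, γ₂ 0) := (contMDiff_mul (𝓡 n) ∞).mdifferentiableAt (by simp)
  have k1 := mfderiv_comp_apply (I := 𝓘(ℝ, ℝ)) (I' := (𝓡 n).prod (𝓡 n)) (I'' := 𝓡 n)
    (f := fun t => (γ₁ t, γ₂ t)) (g := fun p : G × G => p.1 * p.2) (0 : ℝ) dm
    (d₁.prodMk d₂) (1 : ℝ)
  have k2 := mfderiv_prod_eq_add_apply (v := mfderiv 𝓘(ℝ, ℝ) ((𝓡 n).prod (𝓡 n))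
    (fun t => (γ₁ t, γ₂ t)) 0 (1 : ℝ)) dm
  have k3 := mfderiv_prodMk d₁ d₂
  have i1 := mfderiv_of_eq_id (n := n) (f := fun z : G => z * γ₂ 0) (by ext; simp [e₂]) (γ₁ 0)
  have i2 := mfderiv_of_eq_id (n := n) (f := fun z : G => γ₁ 0 * z) (by ext; simp [e₁]) (γ₂ 0)
  rw [k3] at k2
  refine (k1.trans ((congrArg _ (DFunLike.congr_fun k3 _)).trans k2)).trans ?_
  exact congrArg₂ (fun a b : EuclideanSpace ℝ (Fin n) => a + b)
    (DFunLike.congr_fun i1 _) (DFunLike.congr_fun i2 _)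

theorem velocity_const : velocity n (fun _ => (1 : G)) = 0 := by
  have := mfderiv_const (I := 𝓘(ℝ, ℝ)) (I' := 𝓡 n) (x := (0 : ℝ)) (c := (1 : G))
  exact DFunLike.congr_fun this (1 : ℝ)

theorem velocity_rescale {γ : ℝ → G} (hγ : ContMDiff 𝓘(ℝ, ℝ) (𝓡 n) ∞ γ) (c : ℝ) :
    velocity n (fun t => γ (c * t)) = c • velocity n γ := by
  have hm : HasMFDerivAt 𝓘(ℝ, ℝ) 𝓘(ℝ, ℝ) (fun t : ℝ => c * t) 0
      (ContinuousLinearMap.toSpanSingleton ℝ c) := by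
    have h : HasFDerivAt (fun t : ℝ => c * t) (ContinuousLinearMap.toSpanSingleton ℝ c) (0 : ℝ) := by
      simpa using ((hasDerivAt_id (0 : ℝ)).const_mul c).hasFDerivAt
    exact h.hasMFDerivAt
  have key : ∀ y : ℝ, y = c * 0 → MDifferentiableAt 𝓘(ℝ, ℝ) (𝓡 n) γ (c * 0) →
      (mfderiv 𝓘(ℝ, ℝ) (𝓡 n) (fun t => γ (c * t)) 0 (1 : ℝ) : EuclideanSpace ℝ (Fin n)) =
        (mfderiv 𝓘(ℝ, ℝ) (𝓡 n) γ y : ℝ →L[ℝ] EuclideanSpace ℝ (Fin n)) c := by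
    rintro y rfl hd
    have := (hd.hasMFDerivAt.comp (0 : ℝ) hm).mfderiv
    have := DFunLike.congr_fun this (1 : ℝ)
    refine this.trans ?_
    refine congrArg (mfderiv 𝓘(ℝ, ℝ) (𝓡 n) γ (c * 0) : ℝ →L[ℝ] EuclideanSpace ℝ (Fin n)) ?_
    exact one_mul c
  refine (key 0 (by simp) (hγ.mdifferentiableAt (by simp))).trans ?_
  have lin : ∀ A : ℝ →L[ℝ] EuclideanSpace ℝ (Fin n), A c = c • A 1 := fun A => by
    rw [← A.map_smul, smul_eq_mul, mul_one]
  exact lin _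

/-- The Lie algebra of a closed subgroup `S` of `G`, inside the Lie algebra of `G`: the velocities
at the identity of the smooth curves of `G` that run in `S`. -/
noncomputable def lieAlgebraOf (n : ℕ) {G : Type*} [TopologicalSpace G]
    [ChartedSpace (EuclideanSpace ℝ (Fin n)) G] [Group G] [LieGroup (𝓡 n) ∞ G] (S : Subgroup G) :
    Submodule ℝ (GroupLieAlgebra (𝓡 n) G) where
  carrier := {X | ∃ γ : ℝ → G, ContMDiff 𝓘(ℝ, ℝ) (𝓡 n) ∞ γ ∧ (∀ t, γ t ∈ S) ∧ γ 0 = 1 ∧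
    velocity n γ = X}
  zero_mem' := ⟨fun _ => 1, contMDiff_const, fun _ => S.one_mem, rfl, velocity_const⟩
  add_mem' := by
    rintro _ _ ⟨γ₁, h₁, m₁, e₁, rfl⟩ ⟨γ₂, h₂, m₂, e₂, rfl⟩
    exact ⟨fun t => γ₁ t * γ₂ t, h₁.mul h₂, fun t => S.mul_mem (m₁ t) (m₂ t), by simp [e₁, e₂],
      velocity_mul h₁ h₂ e₁ e₂⟩
  smul_mem' := by
    rintro c _ ⟨γ, h, m, e, rfl⟩
    refine ⟨fun t => γ (c * t), h.comp ?_, fun t => m _, by simp [e], velocity_rescale h c⟩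
    exact (contDiff_const.mul contDiff_id).contMDiff

end Lie

/-! ## Riemannian metrics and Riemannian submersions -/

section Riemannian

/-- Smooth Riemannian metrics on a manifold modelled on `ℝ^d`. -/
abbrev RiemMetric (d : ℕ) (M : Type*) [TopologicalSpace M]
    [ChartedSpace (EuclideanSpace ℝ (Fin d)) M] [IsManifold (𝓡 d) ∞ M] :=
  Bundle.ContMDiffRiemannianMetric (𝓡 d) ∞ (EuclideanSpace ℝ (Fin d))
    (fun x : M => TangentSpace (𝓡 d) x)

variable {d e : ℕ} {M B : Type*}
  [TopologicalSpace M] [ChartedSpace (EuclideanSpace ℝ (Fin d)) M] [IsManifold (𝓡 d) ∞ M]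
  [TopologicalSpace B] [ChartedSpace (EuclideanSpace ℝ (Fin e)) B] [IsManifold (𝓡 e) ∞ B]

/-- The (differentiable) map `f` preserves the Riemannian metric `g`. -/
def PreservesMetric (g : RiemMetric d M) (f : M → M) : Prop :=
  ∀ (x : M) (v w : TangentSpace (𝓡 d) x),
    g.inner (f x) (mfderiv (𝓡 d) (𝓡 d) f x v) (mfderiv (𝓡 d) (𝓡 d) f x w) = g.inner x v w

/-- A tangent vector is horizontal if it is orthogonal to the kernel of the differential. -/
def IsHorizontal (g : RiemMetric d M) (e : ℕ) {B : Type*} [TopologicalSpace B]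
    [ChartedSpace (EuclideanSpace ℝ (Fin e)) B] (π : M → B) (x : M)
    (v : TangentSpace (𝓡 d) x) : Prop :=
  ∀ u : TangentSpace (𝓡 d) x, mfderiv (𝓡 d) (𝓡 e) π x u = 0 → g.inner x v u = 0

/-- `π : (M, gM) → (B, gB)` is a Riemannian submersion of `M` onto `B`. -/
structure IsRiemannianSubmersion (gM : RiemMetric d M) (gB : RiemMetric e B) (π : M → B) :
    Prop where
  smooth : ContMDiff (𝓡 d) (𝓡 e) ∞ π
  surjective : Function.Surjective π
  surjective_mfderiv : ∀ x, Function.Surjective (mfderiv (𝓡 d) (𝓡 e) π x)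
  isometry_horizontal : ∀ (x : M) (v w : TangentSpace (𝓡 d) x),
    IsHorizontal gM e π x v → IsHorizontal gM e π x w →
      gB.inner (π x) (mfderiv (𝓡 d) (𝓡 e) π x v) (mfderiv (𝓡 d) (𝓡 e) π x w) = gM.inner x v w

/-- A metric on a Lie group is bi-invariant if left and right translations preserve it. -/
def IsBiInvariant [Group M] (g : RiemMetric d M) : Prop :=
  (∀ a : M, PreservesMetric g fun x => a * x) ∧ ∀ a : M, PreservesMetric g fun x => x * a

end Riemannian

/-! ## Homogeneous spaces -/

section Homogeneous

/-- The coset space `K/L`, for subgroups `L ⊆ K` of a group `G`. -/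
abbrev CosetSpace {G : Type*} [Group G] (K L : Subgroup G) : Type _ := K ⧸ L.subgroupOf K

/-- The projection `K/H → K/L`, for `H ⊆ L ⊆ K`. -/
def cosetProj {G : Type*} [Group G] (K : Subgroup G) {H L : Subgroup G} (hHL : H ≤ L) :
    CosetSpace K H → CosetSpace K L :=
  Subgroup.quotientMapOfLE (Subgroup.comap_mono hHL)

/-- `G/K₁ = K₂/H` as homogeneous spaces of `K₂`: a `K₂`-equivariant bijection `K₂/H → G/K₁`. -/
structure HomogeneousIdentification {G : Type*} [Group G] (K₁ K₂ H : Subgroup G) where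
  toEquiv : CosetSpace K₂ H ≃ G ⧸ K₁
  map_smul : ∀ (k : K₂) (x : CosetSpace K₂ H), toEquiv (k • x) = (k : G) • toEquiv x

/-- The charts on the subgroup `K` and on `K/L` are the standard ones: `K` is a Lie group embedded
in `G`, and `K/L` is a smooth manifold such that `K → K/L` is a smooth submersion. -/
structure IsStandardSmoothStructure {n k d : ℕ} {G : Type*} [TopologicalSpace G]
    [ChartedSpace (EuclideanSpace ℝ (Fin n)) G] [Group G] (K L : Subgroup G)
    [ChartedSpace (EuclideanSpace ℝ (Fin k)) K]
    [ChartedSpace (EuclideanSpace ℝ (Fin d)) (CosetSpace K L)] : Prop where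
  lieGroup : LieGroup (𝓡 k) ∞ K
  embedded : Manifold.IsSmoothEmbedding (𝓡 k) (𝓡 n) ∞ (Subtype.val : K → G)
  isManifold : IsManifold (𝓡 d) ∞ (CosetSpace K L)
  isSubmersion : Manifold.IsSubmersion (𝓡 k) (𝓡 d) ∞ (QuotientGroup.mk : K → CosetSpace K L)

end Homogeneous

/-! Write F(eH) = aK₁ and K' = aK₁a⁻¹. Then K₂ ∩ K' = H, every element of G is k k' a with k in K₂
and k' in K', and π(k k' a) = kL. So ψ(x) = π(xa) is equivariant for left multiplication by K₂ and
invariant under right multiplication by K'. Let P be its differential at 1. The requirement that P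
be isometric on the orthogonal complement of its kernel determines one inner product Q on the
tangent space of K₂/L at the base point. If Q is invariant under the isotropy group L, it extends to
a K₂-invariant metric, and because ⟨,⟩₀ is bi-invariant the translations z ↦ k z k'a carry the
isometry property from 1 to every point of G (`isRiemannianSubmersion_of_equivariant`).

The heart is the L-invariance of Q. Invariance under H is automatic: for h in H = K₂ ∩ K',
conjugation by h is an isometry of G and ψ(h x h⁻¹) = hψ(x). Pulled back to 𝔪₂ by P, Q becomes an
Ad(H)-invariant form on ⨁ 𝔮ⱼ, to be compared with the Ad(L)-invariant form ⟨,⟩₀. On each 𝔮ⱼ it is a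
multiple of ⟨,⟩₀ by Schur's lemma. A mixed block 𝔮ᵢ × 𝔮ⱼ is given by an H-map T : 𝔮ᵢ → 𝔮ⱼ, which is
zero or an isomorphism; in the second case an L-equivalence e exists and T e⁻¹ is an H-endomorphism
of 𝔮ⱼ. The endomorphism algebra of a real representation has dimension 1, 2 or 4 according to its
type, so equality of types makes the H- and L-endomorphisms of 𝔮ⱼ coincide, and T is an L-map
(`invariant_of_invariant_subgroup`).

The analytic foundation is Cartan's closed subgroup theorem. In a chart at 1, multiplication is
addition up to O(‖x‖‖y‖), so limits of powers of elements of a closed subgroup are smooth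
one-parameter subgroups. This gives charts on K₂ and K₂/L adapted to 𝔨₂ = 𝔪₂ ⊕ 𝔩. Smoothness of ψ at
1 follows from 𝔤 = 𝔪₂ ⊕ 𝔪₁ ⊕ Lie(K'), a consequence of G = K₂K' (`isCompl_lieSubspace`): in product
coordinates for this splitting, ψ depends only on the 𝔪₂ coordinate. The maps `logChart` and
`expChart` are a chart and its inverse, not the Lie exponential. -/

set_option linter.unusedSectionVars false

/-! ## Endomorphisms of real representations and their types -/

section EndomorphismType

open Representation

variable {S V : Type*} [Group S] [AddCommGroup V] [Module ℝ V]

/-- The real part `z ⊗ v ↦ (re z) v` of an element of the complexification. -/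
noncomputable def complexRe (V : Type*) [AddCommGroup V] [Module ℝ V] : ℂ ⊗[ℝ] V →ₗ[ℝ] V :=
  (TensorProduct.lid ℝ V).toLinearMap ∘ₗ LinearMap.rTensor V Complex.reLm

@[simp] theorem complexRe_tmul (z : ℂ) (v : V) : complexRe V (z ⊗ₜ v) = z.re • v := by
  simp [complexRe]

@[simp] theorem complexConj_tmul (z : ℂ) (v : V) :
    complexConj V (z ⊗ₜ v) = (starRingEnd ℂ z) ⊗ₜ v := rfl

@[simp] theorem complexConj_complexConj (x : ℂ ⊗[ℝ] V) : complexConj V (complexConj V x) = x := by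
  induction x using TensorProduct.induction_on with
  | zero => simp
  | tmul z v => simp
  | add x y hx hy => simp [hx, hy]

theorem ofReal_smul_complexify (c : ℝ) (x : ℂ ⊗[ℝ] V) : (c : ℂ) • x = c • x := by
  induction x using TensorProduct.induction_on with
  | zero => simp
  | tmul z v => rw [TensorProduct.smul_tmul', TensorProduct.smul_tmul']; simp
  | add x y hx hy => rw [smul_add, smul_add, hx, hy]

theorem add_complexConj (x : ℂ ⊗[ℝ] V) :
    x + complexConj V x = (1 : ℂ) ⊗ₜ[ℝ] ((2 : ℝ) • complexRe V x) := by
  induction x using TensorProduct.induction_on with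
  | zero => simp
  | tmul z v =>
    rw [complexConj_tmul, ← TensorProduct.add_tmul, Complex.add_conj, complexRe_tmul, smul_smul,
      ← TensorProduct.smul_tmul]
    congr 1
    simp [Complex.real_smul]
  | add x y hx hy =>
    rw [map_add, add_add_add_comm, hx, hy, map_add, smul_add, TensorProduct.tmul_add]

@[simp] theorem complexify_tmul (ψ : Representation ℝ S V) (s : S) (z : ℂ) (v : V) :
    ψ.complexify s (z ⊗ₜ v) = z ⊗ₜ ψ s v := rfl

theorem complexRe_complexify (ψ : Representation ℝ S V) (s : S) (x : ℂ ⊗[ℝ] V) :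
    complexRe V (ψ.complexify s x) = ψ s (complexRe V x) := by
  induction x using TensorProduct.induction_on with
  | zero => simp
  | tmul z v => simp
  | add x y hx hy => simp [hx, hy]

/-- The complexification of an intertwining endomorphism. -/
noncomputable def Representation.IntertwiningMap.complexify {ψ : Representation ℝ S V}
    (T : IntertwiningMap ψ ψ) : IntertwiningMap ψ.complexify ψ.complexify where
  toLinearMap := T.toLinearMap.baseChange ℂ
  isIntertwining' g := by
    ext v
    have := IntertwiningMap.isIntertwining ψ ψ T g v
    simp [this]

@[simp] theorem intertwiningMap_complexify_tmul {ψ : Representation ℝ S V}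
    (T : IntertwiningMap ψ ψ) (z : ℂ) (v : V) : T.complexify (z ⊗ₜ v) = z ⊗ₜ T v := rfl

theorem intertwiningMap_complexify_conj {ψ : Representation ℝ S V}
    (T : IntertwiningMap ψ ψ) (x : ℂ ⊗[ℝ] V) :
    T.complexify (complexConj V x) = complexConj V (T.complexify x) := by
  induction x using TensorProduct.induction_on with
  | zero => simp
  | tmul z v => simp
  | add x y hx hy => simp [hx, hy]

theorem Subrepresentation.isCompl_toSubmodule {k S V : Type*} [Field k] [Group S] [AddCommGroup V]
    [Module k V] {ρ : Representation k S V} {φ χ : Subrepresentation ρ} (h : IsCompl φ χ) :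
    IsCompl φ.toSubmodule χ.toSubmodule := by
  refine ⟨?_, ?_⟩
  · rw [disjoint_iff, ← toSubmodule_inf, h.inf_eq_bot]; rfl
  · rw [codisjoint_iff, ← toSubmodule_sup, h.sup_eq_top]; rfl

/-- The equivariant projection onto a subrepresentation along a complementary one. -/
noncomputable def Subrepresentation.projection {k S V : Type*} [Field k] [Group S]
    [AddCommGroup V] [Module k V] {ρ : Representation k S V} {φ χ : Subrepresentation ρ}
    (h : IsCompl φ χ) : IntertwiningMap ρ φ.toRepresentation :=
  have h' := Subrepresentation.isCompl_toSubmodule h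
  { toLinearMap := Submodule.projectionOnto φ.toSubmodule χ.toSubmodule h'
    isIntertwining' := fun g => by
      ext v
      obtain ⟨⟨x, y⟩, rfl⟩ := (Submodule.prodEquivOfIsCompl _ _ h').surjective v
      simp only [Submodule.coe_prodEquivOfIsCompl', LinearMap.comp_apply, map_add]
      rw [Submodule.projectionOnto_apply_of_mem_left h' (φ.apply_mem_toSubmodule g x.2),
        Submodule.projectionOnto_apply_of_mem_right h' (χ.apply_mem_toSubmodule g y.2),
        Submodule.projectionOnto_apply_left, Submodule.projectionOnto_apply_right, map_zero]
      rfl }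

theorem Subrepresentation.projection_apply_left {k S V : Type*} [Field k] [Group S]
    [AddCommGroup V] [Module k V] {ρ : Representation k S V} {φ χ : Subrepresentation ρ}
    (h : IsCompl φ χ) (x : φ.toSubmodule) : Subrepresentation.projection h (x : V) = x :=
  Submodule.projectionOnto_apply_left (Subrepresentation.isCompl_toSubmodule h) x

theorem Subrepresentation.projection_apply_right {k S V : Type*} [Field k] [Group S]
    [AddCommGroup V] [Module k V] {ρ : Representation k S V} {φ χ : Subrepresentation ρ}
    (h : IsCompl φ χ) {x : V} (hx : x ∈ χ.toSubmodule) : Subrepresentation.projection h x = 0 :=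
  Submodule.projectionOnto_apply_of_mem_right (Subrepresentation.isCompl_toSubmodule h) hx

theorem Subrepresentation.projection_add {k S V : Type*} [Field k] [Group S]
    [AddCommGroup V] [Module k V] {ρ : Representation k S V} {φ χ : Subrepresentation ρ}
    (h : IsCompl φ χ) (x : V) :
    (Subrepresentation.projection h x : V) + Subrepresentation.projection h.symm x = x := by
  obtain ⟨⟨a, b⟩, rfl⟩ :=
    (Submodule.prodEquivOfIsCompl _ _ (Subrepresentation.isCompl_toSubmodule h)).surjective x
  simp only [Submodule.coe_prodEquivOfIsCompl', map_add]
  rw [projection_apply_left h, projection_apply_right h b.2, projection_apply_right h.symm a.2,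
    projection_apply_left h.symm]
  simp

/-- The inclusion of a subrepresentation. -/
def Subrepresentation.incl {k S V : Type*} [Field k] [Group S]
    [AddCommGroup V] [Module k V] {ρ : Representation k S V} (φ : Subrepresentation ρ) :
    IntertwiningMap φ.toRepresentation ρ where
  toLinearMap := φ.toSubmodule.subtype
  isIntertwining' _ := rfl

/-- Maps into a representation that splits in two. -/
noncomputable def Subrepresentation.homSplit {k S V W : Type*} [Field k] [Group S]
    [AddCommGroup V] [Module k V] [AddCommGroup W] [Module k W]
    {ρ : Representation k S V} {φ χ : Subrepresentation ρ} (h : IsCompl φ χ)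
    (σ : Representation k S W) : IntertwiningMap σ ρ ≃ₗ[k]
      IntertwiningMap σ φ.toRepresentation × IntertwiningMap σ χ.toRepresentation where
  toFun f := ((Subrepresentation.projection h).comp f, (Subrepresentation.projection h.symm).comp f)
  map_add' f g := Prod.ext
    (IntertwiningMap.ext (LinearMap.ext fun w => map_add (Subrepresentation.projection h) _ _))
    (IntertwiningMap.ext (LinearMap.ext fun w => map_add (Subrepresentation.projection h.symm) _ _))
  map_smul' c f := Prod.ext
    (IntertwiningMap.ext (LinearMap.ext fun w => map_smul (Subrepresentation.projection h) _ _))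
    (IntertwiningMap.ext (LinearMap.ext fun w => map_smul (Subrepresentation.projection h.symm) _ _))
  invFun p := φ.incl.comp p.1 + χ.incl.comp p.2
  left_inv f := by
    ext w
    exact Subrepresentation.projection_add h (f w)
  right_inv p := by
    have h1 (w : W) : Subrepresentation.projection h ((p.1 w : V) + (p.2 w : V)) = p.1 w := by
      rw [map_add, projection_apply_left h, projection_apply_right h (p.2 w).2, add_zero]
    have h2 (w : W) : Subrepresentation.projection h.symm ((p.1 w : V) + (p.2 w : V)) = p.2 w := by
      rw [map_add, projection_apply_left h.symm, projection_apply_right h.symm (p.1 w).2, zero_add]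
    ext w
    · exact congrArg Subtype.val (h1 w)
    · exact congrArg Subtype.val (h2 w)

theorem IntertwiningMap.free {k S V W : Type*} [Field k] [Group S] [AddCommGroup V] [Module k V]
    [AddCommGroup W] [Module k W] (ρ : Representation k S V)
    (σ : Representation k S W) : Module.Free k (IntertwiningMap ρ σ) :=
  @Module.Free.of_divisionRing k (IntertwiningMap ρ σ) _ inferInstance
    (IntertwiningMap.instModule ρ σ)

/-- By Schur's lemma over ℂ the complexification of an endomorphism is a scalar, and a scalar that
comes from a real map is real. -/
theorem finrank_end_of_isIrreducible_complexify [FiniteDimensional ℝ V] {ψ : Representation ℝ S V}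
    (h : ψ.complexify.IsIrreducible) : Module.finrank ℝ (IntertwiningMap ψ ψ) = 1 := by
  have key (T : IntertwiningMap ψ ψ) : ∃ c : ℝ, c • (1 : IntertwiningMap ψ ψ) = T := by
    obtain ⟨c, hc⟩ := (Representation.IsIrreducible.algebraMap_intertwiningMap_bijective_of_isAlgClosed
      (ρ := ψ.complexify)).2 T.complexify
    -- From 1 ⊗ T v = c ⊗ v, taking real parts gives T v = (re c) v.
    refine ⟨c.re, ?_⟩
    ext v
    have := congrArg (fun f : IntertwiningMap ψ.complexify ψ.complexify =>
      complexRe V (f ((1 : ℂ) ⊗ₜ v))) hc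
    simpa [TensorProduct.smul_tmul'] using this
  have hne : (1 : IntertwiningMap ψ ψ) ≠ 0 := by
    intro h0
    have hV (v : V) : v = 0 := congrArg (fun f : IntertwiningMap ψ ψ => f v) h0
    have : Subsingleton V := ⟨fun a b => by rw [hV a, hV b]⟩
    obtain ⟨a, b, hab⟩ := h.toNontrivial
    refine hab (Subrepresentation.toSubmodule_injective ?_)
    have h0 (x : ℂ ⊗[ℝ] V) : x = 0 := by
      induction x using TensorProduct.induction_on with
      | zero => rfl
      | tmul z v => rw [hV v, TensorProduct.tmul_zero]
      | add x y hx hy => rw [hx, hy, add_zero]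
    have : Subsingleton (ℂ ⊗[ℝ] V) := ⟨fun a b => by rw [h0 a, h0 b]⟩
    exact Subsingleton.elim _ _
  exact (finrank_eq_one_iff_of_nonzero' _ hne).2 key

variable {ψ : Representation ℝ S V} {φ : Subrepresentation ψ.complexify}

theorem mem_conj_iff {x : ℂ ⊗[ℝ] V} : x ∈ φ.conj.toSubmodule ↔ complexConj V x ∈ φ.toSubmodule :=
  Iff.rfl

/-- If `ψ ⊗ ℂ = φ ⊕ conj φ`, an endomorphism of `ψ` is the same as a map `φ → ψ ⊗ ℂ`. -/
theorem finrank_end_eq [FiniteDimensional ℝ V] (h : IsCompl φ φ.conj) :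
    Module.finrank ℝ (IntertwiningMap ψ ψ) =
      2 * Module.finrank ℂ (IntertwiningMap φ.toRepresentation ψ.complexify) := by
  rw [← finrank_real_of_complex]
  -- The isomorphism restricts the complexification of T to φ. Since that map commutes with
  -- conjugation, its values on φ determine it on conj φ; conversely any f on φ extends by x ↦ f(p
  -- x) + conj f(p conj x).
  let A : IntertwiningMap ψ ψ →ₗ[ℝ] IntertwiningMap φ.toRepresentation ψ.complexify :=
    { toFun := fun T => T.complexify.comp φ.incl
      map_add' := fun T U => by
        ext x
        simp [IntertwiningMap.complexify, Subrepresentation.incl, LinearMap.baseChange_add]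
      map_smul' := fun c T => by
        ext x
        change (LinearMap.baseChange ℂ (c • T.toLinearMap)) (x : ℂ ⊗[ℝ] V) =
          (c : ℂ) • T.toLinearMap.baseChange ℂ (x : ℂ ⊗[ℝ] V)
        rw [ofReal_smul_complexify, LinearMap.baseChange_smul]; rfl }
  have hA (T : IntertwiningMap ψ ψ) (x : φ.toSubmodule) :
    A T x = T.complexify (x : ℂ ⊗[ℝ] V) := rfl
  let p := Subrepresentation.projection h
  let p' := Subrepresentation.projection h.symm
  -- Conjugation fixes 1 ⊗ v and exchanges φ with conj φ, so it exchanges the two components of 1 ⊗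
  -- v.
  have hpp (v : V) : (p' ((1 : ℂ) ⊗ₜ[ℝ] v) : ℂ ⊗[ℝ] V) = complexConj V (p ((1 : ℂ) ⊗ₜ v)) := by
    have e : (p ((1 : ℂ) ⊗ₜ[ℝ] v) : ℂ ⊗[ℝ] V) + (p' ((1 : ℂ) ⊗ₜ v) : ℂ ⊗[ℝ] V) = (1 : ℂ) ⊗ₜ v :=
      Subrepresentation.projection_add h _
    have e' := congrArg (complexConj V) e
    rw [map_add] at e'
    simp only [complexConj_tmul, map_one] at e'
    have e2 := congrArg p' e'
    rw [map_add] at e2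
    have h1 : p' (complexConj V (p ((1 : ℂ) ⊗ₜ[ℝ] v))) =
        ⟨complexConj V (p ((1 : ℂ) ⊗ₜ[ℝ] v)), by
          rw [mem_conj_iff, complexConj_complexConj]; exact Subtype.mem _⟩ :=
      Subrepresentation.projection_apply_left h.symm ⟨_, _⟩
    have h2 : p' (complexConj V (p' ((1 : ℂ) ⊗ₜ[ℝ] v))) = 0 :=
      Subrepresentation.projection_apply_right h.symm (mem_conj_iff.1 (Subtype.mem _))
    rw [h1, h2, add_zero] at e2
    exact (congrArg Subtype.val e2).symm
  have split (v : V) : (1 : ℂ) ⊗ₜ[ℝ] v =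
      (p ((1 : ℂ) ⊗ₜ v) : ℂ ⊗[ℝ] V) + complexConj V (p ((1 : ℂ) ⊗ₜ v)) := by
    rw [← hpp]; exact (Subrepresentation.projection_add h _).symm
  refine LinearEquiv.finrank_eq (LinearEquiv.ofBijective A ⟨?_, ?_⟩)
  · rw [injective_iff_map_eq_zero]
    intro T hT
    have h0 (x : φ.toSubmodule) : T.complexify (x : ℂ ⊗[ℝ] V) = 0 := by
      rw [← hA, hT]; rfl
    ext v
    have : T.complexify ((1 : ℂ) ⊗ₜ v) = 0 := by
      rw [split v, map_add, intertwiningMap_complexify_conj, h0]; simp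
    simpa using congrArg (complexRe V) this
  · intro f
    -- The factor 2 comes from w + conj w = 1 ⊗ 2 Re w: with it the complexification of T sends 1 ⊗
    -- v to f(p(1 ⊗ v)) plus its conjugate.
    let T : IntertwiningMap ψ ψ :=
      { toFun := fun v => (2 : ℝ) • complexRe V (f (p ((1 : ℂ) ⊗ₜ v)))
        map_add' := fun v w => by simp [TensorProduct.tmul_add]
        map_smul' := fun c v => by
          have : (1 : ℂ) ⊗ₜ[ℝ] (c • v) = (c : ℂ) • ((1 : ℂ) ⊗ₜ[ℝ] v) := by
            rw [TensorProduct.tmul_smul, TensorProduct.smul_tmul', TensorProduct.smul_tmul']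
            simp
          rw [this, map_smul, map_smul]
          rw [ofReal_smul_complexify, map_smul, smul_comm]
          rfl
        isIntertwining' := fun g => by
          ext v
          have h1 : (1 : ℂ) ⊗ₜ[ℝ] (ψ g v) = ψ.complexify g ((1 : ℂ) ⊗ₜ v) := rfl
          simp only [LinearMap.comp_apply, LinearMap.coe_mk, AddHom.coe_mk]
          rw [h1, IntertwiningMap.isIntertwining _ _ p, IntertwiningMap.isIntertwining _ _ f,
            complexRe_complexify, map_smul] }
    refine ⟨T, ?_⟩
    have hT (v : V) : T v = (2 : ℝ) • complexRe V (f (p ((1 : ℂ) ⊗ₜ v))) := rfl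
    -- The closed form of the complexification of T. The two conjugations in the second term make it
    -- complex linear, so agreement on the vectors 1 ⊗ v suffices.
    let R : ℂ ⊗[ℝ] V →ₗ[ℂ] ℂ ⊗[ℝ] V :=
      { toFun := fun x => f (p x) + complexConj V (f (p (complexConj V x)))
        map_add' := fun x y => by simp only [map_add]; abel
        map_smul' := fun c x => by
          simp only [map_smul, complexConj_smul, RingHom.id_apply, smul_add, starRingEnd_self_apply] }
    have hR : T.complexify.toLinearMap = R := by
      ext v
      change T.complexify ((1 : ℂ) ⊗ₜ[ℝ] v) = f (p ((1 : ℂ) ⊗ₜ[ℝ] v)) +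
        complexConj V (f (p (complexConj V ((1 : ℂ) ⊗ₜ[ℝ] v))))
      rw [complexConj_tmul, map_one, intertwiningMap_complexify_tmul, hT, add_complexConj]
    ext x
    rw [IntertwiningMap.toLinearMap_apply, hA]
    have : T.complexify (x : ℂ ⊗[ℝ] V) = R x := congrArg (fun F => F (x : ℂ ⊗[ℝ] V)) hR
    rw [this]
    change f (p x) + complexConj V (f (p (complexConj V x))) = _
    have hx0 : p (complexConj V x) = 0 :=
      Subrepresentation.projection_apply_right h (by
        rw [mem_conj_iff, complexConj_complexConj]; exact x.2)
    rw [hx0, Subrepresentation.projection_apply_left h]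
    simp

/-- Composing with e⁻¹ identifies these maps with the endomorphisms of ρ, which are the scalars by
Schur's lemma. -/
theorem finrank_hom_of_equiv {S V W : Type*} [Group S] [AddCommGroup V] [Module ℂ V]
    [AddCommGroup W] [Module ℂ W] [FiniteDimensional ℂ V] {ρ : Representation ℂ S V}
    {σ : Representation ℂ S W} (hρ : ρ.IsIrreducible) (e : ρ.Equiv σ) :
    Module.finrank ℂ (IntertwiningMap ρ σ) = 1 := by
  rw [← IsIrreducible.finrank_intertwiningMap_self ρ]
  refine LinearEquiv.finrank_eq
    { toFun := fun f => e.symm.toIntertwiningMap.comp f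
      map_add' := fun f g => IntertwiningMap.ext (LinearMap.ext fun w => map_add e.symm _ _)
      map_smul' := fun c f => IntertwiningMap.ext (LinearMap.ext fun w => map_smul e.symm _ _)
      invFun := fun f => e.toIntertwiningMap.comp f
      left_inv := fun f => by ext v; simp
      right_inv := fun f => by ext v; simp }

/-- The real dimension of the endomorphism algebra of a real representation of given type. -/
def RealRepType.dimEnd : RealRepType → ℕ
  | .orthogonal => 1
  | .unitary => 2
  | .symplectic => 4

/-- Conjugation is only real linear, so real dimensions are compared and then halved. -/
theorem Subrepresentation.finrank_conj [FiniteDimensional ℝ V] (φ : Subrepresentation ψ.complexify) :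
    Module.finrank ℂ φ.conj.toSubmodule = Module.finrank ℂ φ.toSubmodule := by
  have : Module.finrank ℝ φ.conj.toSubmodule = Module.finrank ℝ φ.toSubmodule :=
    LinearEquiv.finrank_eq
      { toFun := fun x => ⟨complexConj V x, x.2⟩
        map_add' := fun x y => by ext; simp
        map_smul' := fun c x => by
          ext
          change complexConj V (c • (x : ℂ ⊗[ℝ] V)) = c • complexConj V x
          rw [map_smul]
        invFun := fun x => ⟨complexConj V x, by
          rw [mem_conj_iff, complexConj_complexConj]; exact x.2⟩
        left_inv := fun x => by ext; simp
        right_inv := fun x => by ext; simp }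
  have h2 (W : Submodule ℂ (ℂ ⊗[ℝ] V)) : Module.finrank ℝ W = 2 * Module.finrank ℂ W := by
    rw [← Module.finrank_mul_finrank ℝ ℂ W, Complex.finrank_real_complex]
  rw [h2, h2] at this
  omega

/-- When ψ ⊗ ℂ = φ ⊕ conj φ the dimension is 2(1 + dim Hom(φ, conj φ)), and the last term is 0 or 1
according to whether φ and conj φ are equivalent. -/
theorem Representation.HasRealType.finrank_end [FiniteDimensional ℝ V] {t : RealRepType}
    (h : ψ.HasRealType t) : Module.finrank ℝ (IntertwiningMap ψ ψ) = t.dimEnd := by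
  have split {φ : Subrepresentation ψ.complexify} (hφ : φ.toRepresentation.IsIrreducible)
      (hc : IsCompl φ φ.conj) : Module.finrank ℝ (IntertwiningMap ψ ψ) =
        2 * (1 + Module.finrank ℂ (IntertwiningMap φ.toRepresentation φ.conj.toRepresentation)) := by
    have := IntertwiningMap.free φ.toRepresentation φ.toRepresentation
    have := IntertwiningMap.free φ.toRepresentation φ.conj.toRepresentation
    rw [finrank_end_eq hc, (Subrepresentation.homSplit hc _).finrank_eq, Module.finrank_prod,
      IsIrreducible.finrank_intertwiningMap_self]
  cases t with
  | orthogonal => exact finrank_end_of_isIrreducible_complexify h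
  | unitary =>
    obtain ⟨-, φ, hφ, hc, he⟩ := h
    have : Subsingleton (IntertwiningMap φ.toRepresentation φ.conj.toRepresentation) := by
      refine subsingleton_of_forall_eq 0 fun f => ?_
      refine (IsIrreducible.injective_or_eq_zero f).resolve_left fun hf => he.false ?_
      refine f.ofBijective ⟨hf, ?_⟩
      exact (LinearMap.injective_iff_surjective_of_finrank_eq_finrank (f := f.toLinearMap)
        (Subrepresentation.finrank_conj φ).symm).1 hf
    rw [split hφ hc, Module.finrank_zero_of_subsingleton]; rfl
  | symplectic =>
    obtain ⟨-, φ, hφ, hc, ⟨e⟩⟩ := h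
    rw [split hφ hc, finrank_hom_of_equiv hφ e]; rfl

/-- A representation that keeps its type under restriction keeps its endomorphisms. -/
theorem IntertwiningMap.exists_of_hasRealType {S' : Type*} [Group S'] [FiniteDimensional ℝ V]
    (ψ : Representation ℝ S V) (i : S' →* S) {t : RealRepType} (h : ψ.HasRealType t)
    (h' : Representation.HasRealType (ψ.comp i) t) (T : IntertwiningMap (ψ.comp i) (ψ.comp i)) :
    ∃ U : IntertwiningMap ψ ψ, U.toLinearMap = T.toLinearMap := by
  let A : IntertwiningMap ψ ψ →ₗ[ℝ] IntertwiningMap (ψ.comp i) (ψ.comp i) :=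
    { toFun := fun U => ⟨U.toLinearMap, fun g => U.isIntertwining' (i g)⟩
      map_add' := fun _ _ => rfl
      map_smul' := fun _ _ => rfl }
  have hA : Function.Injective A := fun U U' hU => by
    ext v; exact congrArg (fun f : IntertwiningMap (ψ.comp i) (ψ.comp i) => f v) hU
  -- Both endomorphism spaces have dimension `t.dimEnd`, so the inclusion of one in the other is
  -- onto.
  have := (LinearMap.injective_iff_surjective_of_finrank_eq_finrank
    (h.finrank_end.trans h'.finrank_end.symm)).1 hA
  obtain ⟨U, hU⟩ := this T
  exact ⟨U, congrArg IntertwiningMap.toLinearMap hU⟩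

end EndomorphismType

/-! ## Invariant bilinear forms -/

section InvariantForms

open Representation

/-- With B as inner product, T is a symmetric operator and the spectral theorem supplies a real
eigenvalue. -/
theorem exists_eigenvalue_of_symmetric {W : Type*} [AddCommGroup W] [Module ℝ W]
    [FiniteDimensional ℝ W] [Nontrivial W] (B : LinearMap.BilinForm ℝ W)
    (hs : ∀ x y, B x y = B y x) (hpos : ∀ x, x ≠ 0 → 0 < B x x) (T : Module.End ℝ W)
    (hT : ∀ x y, B (T x) y = B x (T y)) : ∃ c : ℝ, T.HasEigenvalue c := by
  let core : InnerProductSpace.Core ℝ W :=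
    { inner := fun x y => B x y
      conj_inner_symm := fun x y => hs y x
      re_inner_nonneg := fun x => by
        by_cases hx : x = 0
        · simp [hx]
        · exact (hpos x hx).le
      add_left := fun x y z => by simp
      smul_left := fun x y r => by simp
      definite := fun x hx => by
        by_contra h
        exact (hpos x h).ne' hx }
  let _ : NormedAddCommGroup W := core.toNormedAddCommGroup
  let _ : InnerProductSpace ℝ W := InnerProductSpace.ofCore core.toCore
  have hsym : T.IsSymmetric := fun x y => hT x y
  have h0 : 0 < Module.finrank ℝ W := Module.finrank_pos
  exact ⟨_, hsym.hasEigenvalue_eigenvalues rfl ⟨0, h0⟩⟩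

theorem nondegenerate_of_pos {W : Type*} [AddCommGroup W] [Module ℝ W]
    {B : LinearMap.BilinForm ℝ W} (hpos : ∀ x, x ≠ 0 → 0 < B x x) : B.Nondegenerate := by
  constructor
  · intro x hx
    by_contra h
    exact (hpos x h).ne' (hx x)
  · intro x hx
    by_contra h
    exact (hpos x h).ne' (hx x)

/-- A bilinear pairing with an inner product space is given by a linear map. -/
theorem exists_linearMap_of_bilin {W₁ W₂ : Type*} [AddCommGroup W₁] [Module ℝ W₁] [AddCommGroup W₂]
    [Module ℝ W₂] [FiniteDimensional ℝ W₂] (B : LinearMap.BilinForm ℝ W₂)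
    (hpos : ∀ x, x ≠ 0 → 0 < B x x) (b : W₁ →ₗ[ℝ] W₂ →ₗ[ℝ] ℝ) :
    ∃ T : W₁ →ₗ[ℝ] W₂, ∀ x y, B (T x) y = b x y := by
  refine ⟨(B.toDual (nondegenerate_of_pos hpos)).symm.toLinearMap ∘ₗ b, fun x y => ?_⟩
  rw [← LinearMap.BilinForm.toDual_def (nondegenerate_of_pos hpos)]
  simp

/-- The operator that represents an invariant pairing through an invariant inner product is
equivariant: both sides have the same B-product with every vector. -/
theorem isIntertwining_of_invariant {S W₁ W₂ : Type*} [Group S] [AddCommGroup W₁] [Module ℝ W₁]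
    [AddCommGroup W₂] [Module ℝ W₂] {χ₁ : Representation ℝ S W₁} {χ₂ : Representation ℝ S W₂}
    {B : LinearMap.BilinForm ℝ W₂} (hpos : ∀ x, x ≠ 0 → 0 < B x x)
    (hB : ∀ s x y, B (χ₂ s x) (χ₂ s y) = B x y) {b : W₁ →ₗ[ℝ] W₂ →ₗ[ℝ] ℝ}
    (hb : ∀ s x y, b (χ₁ s x) (χ₂ s y) = b x y) {T : W₁ →ₗ[ℝ] W₂} (hT : ∀ x y, B (T x) y = b x y)
    (s : S) (x : W₁) : T (χ₁ s x) = χ₂ s (T x) := by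
  have key : ∀ z, B (T (χ₁ s x) - χ₂ s (T x)) z = 0 := fun z => by
    have hz : z = χ₂ s (χ₂ s⁻¹ z) := by simp
    rw [map_sub, LinearMap.sub_apply, hT]
    conv_lhs => rw [hz]
    rw [hb, hB, hT, sub_self]
  exact sub_eq_zero.1 (by_contra fun h => (hpos _ h).ne' (key _))

/-- Invariant symmetric forms on an irreducible real representation are proportional. -/
theorem exists_eq_smul_of_isIrreducible {S W : Type*} [Group S] [AddCommGroup W] [Module ℝ W]
    [FiniteDimensional ℝ W] {χ : Representation ℝ S W} (hχ : χ.IsIrreducible)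
    {B b : LinearMap.BilinForm ℝ W} (hs : ∀ x y, B x y = B y x) (hpos : ∀ x, x ≠ 0 → 0 < B x x)
    (hB : ∀ s x y, B (χ s x) (χ s y) = B x y) (hbs : ∀ x y, b x y = b y x)
    (hb : ∀ s x y, b (χ s x) (χ s y) = b x y) : ∃ c : ℝ, ∀ x y, b x y = c * B x y := by
  obtain ⟨T, hT⟩ := exists_linearMap_of_bilin B hpos b
  have hequi := isIntertwining_of_invariant hpos hB hb hT
  have hW : Nontrivial W := by
    by_contra h
    rw [not_nontrivial_iff_subsingleton] at h
    obtain ⟨p, q, hpq⟩ := hχ.toNontrivial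
    exact hpq (Subrepresentation.toSubmodule_injective (Subsingleton.elim _ _))
  obtain ⟨c, hc⟩ := exists_eigenvalue_of_symmetric B hs hpos T fun x y => by
    rw [hT, hs x, hT, hbs]
  refine ⟨c, ?_⟩
  -- The eigenspace of the equivariant operator T is a nonzero subrepresentation, hence everything.
  let K : Subrepresentation χ :=
    { toSubmodule := Module.End.eigenspace T c
      apply_mem_toSubmodule := fun s x hx => by
        rw [Module.End.mem_eigenspace_iff] at hx ⊢
        rw [hequi, hx, map_smul] }
  have hK : K = ⊤ := (hχ.eq_bot_or_eq_top K).resolve_left fun h =>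
    hc (congrArg Subrepresentation.toSubmodule h)
  intro x y
  have hx : x ∈ K.toSubmodule := by rw [hK]; exact Submodule.mem_top
  rw [← hT, Module.End.mem_eigenspace_iff.1 hx, map_smul, LinearMap.smul_apply, smul_eq_mul]

/-- An inner product on a sum of irreducible representations of `L` that is invariant under the
subgroup `H` is invariant under `L`, if the summands stay irreducible for `H` and equivalent
summands stay of the same type. -/
theorem invariant_of_invariant_subgroup {Γ V : Type*} [Group Γ] [AddCommGroup V] [Module ℝ V]
    [FiniteDimensional ℝ V] {ρ : Representation ℝ Γ V} {H L : Subgroup Γ} (hHL : H ≤ L)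
    {ι : Type*} (q : ι → Subrepresentation (ρ.comp L.subtype))
    (hq : ∀ i, ((q i).restrictTo hHL).toRepresentation.IsIrreducible)
    (hqq : ∀ i j, i ≠ j →
      Nonempty (((q i).restrictTo hHL).toRepresentation.Equiv
        ((q j).restrictTo hHL).toRepresentation) →
      Nonempty ((q i).toRepresentation.Equiv (q j).toRepresentation) ∧
      ∃ t : RealRepType,
        ((q j).restrictTo hHL).toRepresentation.HasRealType t ∧
        (q j).toRepresentation.HasRealType t)
    {B b : LinearMap.BilinForm ℝ V} (hs : ∀ x y, B x y = B y x) (hpos : ∀ x, x ≠ 0 → 0 < B x x)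
    (hB : ∀ l ∈ L, ∀ x y, B (ρ l x) (ρ l y) = B x y) (hbs : ∀ x y, b x y = b y x)
    (hb : ∀ h ∈ H, ∀ i j, ∀ x ∈ (q i).toSubmodule, ∀ y ∈ (q j).toSubmodule,
      b (ρ h x) (ρ h y) = b x y) {l : Γ} (hl : l ∈ L) {x y : V}
    (hx : x ∈ ⨆ i, (q i).toSubmodule) (hy : y ∈ ⨆ i, (q i).toSubmodule) :
    b (ρ l x) (ρ l y) = b x y := by
  have hmem : ∀ i, ∀ x ∈ (q i).toSubmodule, ρ l x ∈ (q i).toSubmodule := fun i x hx =>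
    (q i).apply_mem_toSubmodule ⟨l, hl⟩ hx
  have key : ∀ i j, ∀ x ∈ (q i).toSubmodule, ∀ y ∈ (q j).toSubmodule,
      b (ρ l x) (ρ l y) = b x y := by
    intro i j
    have hposj : ∀ z : (q j).toSubmodule, z ≠ 0 → 0 < B.restrict (q j).toSubmodule z z :=
      fun z hz => hpos z (by simpa using hz)
    by_cases hij : i = j
    -- Diagonal block: irreducibility under H alone makes b a multiple of B, and B is invariant
    -- under all of L.
    · subst hij
      obtain ⟨c, hc⟩ := exists_eq_smul_of_isIrreducible (hq i)
        (B := B.restrict (q i).toSubmodule) (b := b.restrict (q i).toSubmodule)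
        (fun x y => hs x y) hposj (fun s x y => hB s (hHL s.2) x y) (fun x y => hbs x y)
        (fun s x y => hb s s.2 i i x x.2 y y.2)
      intro x hx y hy
      have h1 := hc ⟨ρ l x, hmem i x hx⟩ ⟨ρ l y, hmem i y hy⟩
      have h2 := hc ⟨x, hx⟩ ⟨y, hy⟩
      exact h1.trans ((congrArg (c * ·) (hB l hl x y)).trans h2.symm)
    -- Mixed block: b is represented through B by an H-map T, and the block is L-invariant once T is
    -- an L-map.
    · let b' : (q i).toSubmodule →ₗ[ℝ] (q j).toSubmodule →ₗ[ℝ] ℝ :=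
        b.compl₁₂ (q i).toSubmodule.subtype (q j).toSubmodule.subtype
      obtain ⟨T, hT⟩ := exists_linearMap_of_bilin (B.restrict (q j).toSubmodule) hposj b'
      have hequi := isIntertwining_of_invariant (χ₁ := ((q i).restrictTo hHL).toRepresentation)
        (χ₂ := ((q j).restrictTo hHL).toRepresentation) hposj
        (fun s x y => hB s (hHL s.2) x y)
        (fun s x y => hb s s.2 i j x x.2 y y.2) hT
      let T' : IntertwiningMap ((q i).restrictTo hHL).toRepresentation
          ((q j).restrictTo hHL).toRepresentation :=
        ⟨T, fun s => LinearMap.ext fun x => hequi s x⟩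
      have hTL : ∀ (s : L) (x : (q i).toSubmodule),
          T ((q i).toRepresentation s x) = (q j).toRepresentation s (T x) := by
        have := hq i
        have := hq j
        rcases IsIrreducible.bijective_or_eq_zero T' with hbij | h0
        · obtain ⟨⟨e⟩, t, ht, ht'⟩ := hqq i j hij ⟨T'.ofBijective hbij⟩
          -- Here R = T e⁻¹ is an H-endomorphism of the single representation `q j`; by equality of
          -- types it is an L-endomorphism U, so T = U e is an L-map.
          let R : IntertwiningMap ((q j).toRepresentation.comp (Subgroup.inclusion hHL))
              ((q j).toRepresentation.comp (Subgroup.inclusion hHL)) :=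
            ⟨T ∘ₗ e.symm.toLinearMap, fun s => LinearMap.ext fun x =>
              (congrArg T (IntertwiningMap.isIntertwining _ _ e.symm.toIntertwiningMap
                (Subgroup.inclusion hHL s) x)).trans (hequi s _)⟩
          obtain ⟨U, hU⟩ := IntertwiningMap.exists_of_hasRealType (q j).toRepresentation
            (Subgroup.inclusion hHL) ht' ht R
          have hU' (x : (q i).toSubmodule) : T x = U (e x) := by
            have := congrArg (fun f => f (e x)) hU
            refine Eq.trans ?_ this.symm
            exact congrArg T (e.symm_apply_apply x).symm
          intro s x
          rw [hU', hU', ← IntertwiningMap.isIntertwining _ _ U]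
          exact congrArg U (IntertwiningMap.isIntertwining _ _ e.toIntertwiningMap s x)
        · have hT0 (x : (q i).toSubmodule) : T x = 0 :=
            congrArg (fun f : IntertwiningMap ((q i).restrictTo hHL).toRepresentation
              ((q j).restrictTo hHL).toRepresentation => f x) h0
          intro s x
          rw [hT0, hT0, map_zero]
      intro x hx y hy
      have h1 := hT ⟨ρ l x, hmem i x hx⟩ ⟨ρ l y, hmem j y hy⟩
      have h2 := hT ⟨x, hx⟩ ⟨y, hy⟩
      have h3 := hTL ⟨l, hl⟩ ⟨x, hx⟩
      refine h1.symm.trans (Eq.trans ?_ h2)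
      refine (congrArg (fun z => B.restrict (q j).toSubmodule z ⟨ρ l y, hmem j y hy⟩) h3).trans ?_
      exact hB l hl _ _
  refine Submodule.iSup_induction _ (motive := fun x => b (ρ l x) (ρ l y) = b x y) hx
    (fun i x hx => ?_) (by simp) (fun x x' h h' => by simp [h, h'])
  exact Submodule.iSup_induction _ (motive := fun y => b (ρ l x) (ρ l y) = b x y) hy
    (fun j y hy => key i j x hx y hy) (by simp) (fun y y' h h' => by simp [h, h'])

end InvariantForms

/-! ## A chart of a Lie group at the identity -/

section LogChart

open Filter Topology Set

variable (n : ℕ) {G : Type*} [TopologicalSpace G] [ChartedSpace (EuclideanSpace ℝ (Fin n)) G]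
  [Group G]

/-- The chart at the identity, centred at the origin. -/
noncomputable def logChart (g : G) : EuclideanSpace ℝ (Fin n) :=
  extChartAt (𝓡 n) (1 : G) g - extChartAt (𝓡 n) (1 : G) 1

/-- The inverse of the centred chart at the identity. -/
noncomputable def expChart (G : Type*) [TopologicalSpace G]
    [ChartedSpace (EuclideanSpace ℝ (Fin n)) G] [Group G] (x : EuclideanSpace ℝ (Fin n)) : G :=
  (extChartAt (𝓡 n) (1 : G)).symm (x + extChartAt (𝓡 n) (1 : G) 1)

@[simp] theorem logChart_one : logChart n (1 : G) = 0 := by simp [logChart]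

@[simp] theorem expChart_zero : expChart n G 0 = 1 := by simp [expChart]

theorem eventually_mem_target : ∀ᶠ x in 𝓝 (0 : EuclideanSpace ℝ (Fin n)),
    x + extChartAt (𝓡 n) (1 : G) 1 ∈ (extChartAt (𝓡 n) (1 : G)).target := by
  have h : ContinuousAt (fun x : EuclideanSpace ℝ (Fin n) => x + extChartAt (𝓡 n) (1 : G) 1) 0 := by
    fun_prop
  refine h.eventually_mem ?_
  rw [zero_add]
  exact extChartAt_target_mem_nhds (1 : G)

theorem eventually_logChart_expChart :
    ∀ᶠ x in 𝓝 (0 : EuclideanSpace ℝ (Fin n)), logChart n (expChart n G x) = x := by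
  filter_upwards [eventually_mem_target n (G := G)] with x hx
  rw [logChart, expChart, (extChartAt (𝓡 n) (1 : G)).right_inv hx, add_sub_cancel_right]

theorem eventually_expChart_logChart :
    ∀ᶠ g in 𝓝 (1 : G), expChart n G (logChart n g) = g := by
  filter_upwards [extChartAt_source_mem_nhds (I := 𝓡 n) (1 : G)] with g hg
  rw [logChart, expChart, sub_add_cancel, (extChartAt (𝓡 n) (1 : G)).left_inv hg]

section
variable [IsManifold (𝓡 n) ∞ G]

theorem eventually_contMDiffAt_expChart : ∀ᶠ x in 𝓝 (0 : EuclideanSpace ℝ (Fin n)),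
    ContMDiffAt 𝓘(ℝ, EuclideanSpace ℝ (Fin n)) (𝓡 n) ∞ (expChart n G) x := by
  filter_upwards [eventually_mem_target n (G := G)] with x hx
  have h1 := (contMDiffOn_extChartAt_symm (I := 𝓡 n) (n := ∞) (1 : G)).contMDiffAt
    ((isOpen_extChartAt_target (1 : G)).mem_nhds hx)
  have h2 : ContMDiffAt 𝓘(ℝ, EuclideanSpace ℝ (Fin n)) 𝓘(ℝ, EuclideanSpace ℝ (Fin n)) ∞
    (fun x : EuclideanSpace ℝ (Fin n) => x + extChartAt (𝓡 n) (1 : G) 1) x :=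
      (contDiffAt_id.add contDiffAt_const).contMDiffAt
  exact h1.comp x h2

theorem eventually_contMDiffAt_logChart : ∀ᶠ g in 𝓝 (1 : G),
    ContMDiffAt (𝓡 n) 𝓘(ℝ, EuclideanSpace ℝ (Fin n)) ∞ (logChart n : G → _) g := by
  filter_upwards [(chartAt (EuclideanSpace ℝ (Fin n)) (1 : G)).open_source.mem_nhds
    (mem_chart_source _ (1 : G))] with g hg
  exact (contMDiffAt_extChartAt' hg).sub contMDiffAt_const

theorem continuousAt_expChart : ContinuousAt (expChart n G) 0 :=
  (eventually_contMDiffAt_expChart n).self_of_nhds.continuousAt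

theorem continuousAt_logChart : ContinuousAt (logChart n : G → _) 1 :=
  (eventually_contMDiffAt_logChart n).self_of_nhds.continuousAt

theorem tendsto_expChart : Tendsto (expChart n G) (𝓝 0) (𝓝 1) := by
  simpa using (continuousAt_expChart n (G := G)).tendsto

theorem tendsto_logChart : Tendsto (logChart n : G → _) (𝓝 1) (𝓝 0) := by
  simpa using (continuousAt_logChart n (G := G)).tendsto

end

/-- The preferred chart at a point where f takes the value 1 is the chart at 1, so the manifold
derivative is literally the derivative in the centred chart. -/
theorem HasMFDerivAt.hasFDerivAt_logChart {V : Type*} [NormedAddCommGroup V] [NormedSpace ℝ V]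
    {f : V → G} {v : V} {f' : V →L[ℝ] EuclideanSpace ℝ (Fin n)} (hv : f v = 1)
    (h : HasMFDerivAt 𝓘(ℝ, V) (𝓡 n) f v f') : HasFDerivAt (fun x => logChart n (f x)) f' v := by
  have h2 := h.2
  simp only [writtenInExtChartAt, chartAt_self_eq, Function.comp_def, mfld_simps] at h2
  rw [hv] at h2
  exact (hasFDerivWithinAt_univ.1 h2).sub_const _

theorem hasMFDerivAt_of_logChart {V : Type*} [NormedAddCommGroup V] [NormedSpace ℝ V]
    {f : V → G} {v : V} {f' : V →L[ℝ] EuclideanSpace ℝ (Fin n)} (hv : f v = 1)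
    (hc : ContinuousAt f v) (h : HasFDerivAt (fun x => logChart n (f x)) f' v) :
    HasMFDerivAt 𝓘(ℝ, V) (𝓡 n) f v f' := by
  refine ⟨hc, ?_⟩
  simp only [writtenInExtChartAt, chartAt_self_eq, Function.comp_def, mfld_simps]
  rw [hv]
  have h2 : HasFDerivAt (fun x => chartAt (EuclideanSpace ℝ (Fin n)) (1 : G) (f x)) f' v := by
    simpa [logChart] using h.add_const (extChartAt (𝓡 n) (1 : G) 1)
  exact hasFDerivWithinAt_univ.2 h2

/-- Multiplication in the centred chart at the identity. -/
noncomputable def mulChart (G : Type*) [TopologicalSpace G]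
    [ChartedSpace (EuclideanSpace ℝ (Fin n)) G] [Group G]
    (p : EuclideanSpace ℝ (Fin n) × EuclideanSpace ℝ (Fin n)) : EuclideanSpace ℝ (Fin n) :=
  logChart n (expChart n G p.1 * expChart n G p.2)

theorem eventually_mulChart_zero_right :
    ∀ᶠ x in 𝓝 (0 : EuclideanSpace ℝ (Fin n)), mulChart n G (x, 0) = x := by
  filter_upwards [eventually_logChart_expChart n (G := G)] with x hx
  simpa [mulChart] using hx

theorem eventually_mulChart_zero_left :
    ∀ᶠ x in 𝓝 (0 : EuclideanSpace ℝ (Fin n)), mulChart n G (0, x) = x := by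
  filter_upwards [eventually_logChart_expChart n (G := G)] with x hx
  simpa [mulChart] using hx

variable [LieGroup (𝓡 n) ∞ G]

theorem continuousMul_of_lieGroup (n : ℕ) {G : Type*} [TopologicalSpace G]
    [ChartedSpace (EuclideanSpace ℝ (Fin n)) G] [Group G] [LieGroup (𝓡 n) ∞ G] :
    ContinuousMul G := by
  have := topologicalGroup_of_lieGroup (𝓡 n) ∞ (G := G)
  infer_instance

theorem tendsto_expChart_mul_expChart : Tendsto (fun p : EuclideanSpace ℝ (Fin n) ×
    EuclideanSpace ℝ (Fin n) => expChart n G p.1 * expChart n G p.2) (𝓝 0) (𝓝 1) := by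
  have := continuousMul_of_lieGroup n (G := G)
  have h1 : Tendsto (fun p : EuclideanSpace ℝ (Fin n) × EuclideanSpace ℝ (Fin n) =>
      expChart n G p.1) (𝓝 0) (𝓝 1) := (tendsto_expChart n).comp (Continuous.tendsto' (by fun_prop) _ _ rfl)
  have h2 : Tendsto (fun p : EuclideanSpace ℝ (Fin n) × EuclideanSpace ℝ (Fin n) =>
      expChart n G p.2) (𝓝 0) (𝓝 1) := (tendsto_expChart n).comp (Continuous.tendsto' (by fun_prop) _ _ rfl)
  simpa using h1.mul h2

theorem eventually_contDiffAt_mulChart :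
    ∀ᶠ p in 𝓝 (0 : EuclideanSpace ℝ (Fin n) × EuclideanSpace ℝ (Fin n)),
      ContDiffAt ℝ ∞ (mulChart n G) p := by
  have t1 : Tendsto (Prod.fst : EuclideanSpace ℝ (Fin n) × EuclideanSpace ℝ (Fin n) → _) (𝓝 0) (𝓝 0) :=
    Continuous.tendsto' (by fun_prop) _ _ rfl
  have t2 : Tendsto (Prod.snd : EuclideanSpace ℝ (Fin n) × EuclideanSpace ℝ (Fin n) → _) (𝓝 0) (𝓝 0) :=
    Continuous.tendsto' (by fun_prop) _ _ rfl
  filter_upwards [t1.eventually (eventually_contMDiffAt_expChart n (G := G)),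
    t2.eventually (eventually_contMDiffAt_expChart n (G := G)),
    (tendsto_expChart_mul_expChart n (G := G)).eventually (eventually_contMDiffAt_logChart n)]
    with p h1 h2 h3
  rw [← contMDiffAt_iff_contDiffAt]
  have e1 : ContMDiffAt 𝓘(ℝ, EuclideanSpace ℝ (Fin n) × EuclideanSpace ℝ (Fin n)) (𝓡 n) ∞
      (fun p : EuclideanSpace ℝ (Fin n) × EuclideanSpace ℝ (Fin n) => expChart n G p.1) p :=
    h1.comp p contDiffAt_fst.contMDiffAt
  have e2 : ContMDiffAt 𝓘(ℝ, EuclideanSpace ℝ (Fin n) × EuclideanSpace ℝ (Fin n)) (𝓡 n) ∞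
      (fun p : EuclideanSpace ℝ (Fin n) × EuclideanSpace ℝ (Fin n) => expChart n G p.2) p :=
    h2.comp p contDiffAt_snd.contMDiffAt
  exact h3.comp p (e1.mul e2)

theorem eventually_expChart_mulChart :
    ∀ᶠ p in 𝓝 (0 : EuclideanSpace ℝ (Fin n) × EuclideanSpace ℝ (Fin n)),
      expChart n G (mulChart n G p) = expChart n G p.1 * expChart n G p.2 :=
  (tendsto_expChart_mul_expChart n).eventually (eventually_expChart_logChart n)

end LogChart

/-! ### A quadratic estimate for functions vanishing on both axes -/

section BilinearEstimate

open Filter Topology Set Metric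

variable {E F : Type*} [NormedAddCommGroup E] [NormedSpace ℝ E] [NormedAddCommGroup F]
  [NormedSpace ℝ F]

/-- A `C²` function of two variables that vanishes on both axes is `O(‖x‖ ‖y‖)`. -/
theorem ContDiffAt.exists_norm_le_mul_of_zero_axes {r : E × E → F} (hr : ContDiffAt ℝ 2 r 0)
    (h1 : ∀ᶠ x in 𝓝 (0 : E), r (x, 0) = 0) (h2 : ∀ᶠ y in 𝓝 (0 : E), r (0, y) = 0) :
    ∃ C > 0, ∃ δ > 0, ∀ x y : E, ‖x‖ < δ → ‖y‖ < δ → ‖r (x, y)‖ ≤ C * ‖x‖ * ‖y‖ := by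
  have hd : ContDiffAt ℝ 1 (fderiv ℝ r) 0 := hr.fderiv_right (by norm_num)
  obtain ⟨K, s, hs, hK⟩ := hd.exists_lipschitzOnWith
  have hdiff : ∀ᶠ p in 𝓝 (0 : E × E), DifferentiableAt ℝ r p := by
    filter_upwards [hr.eventually (by norm_num)] with p hp
    exact hp.differentiableAt (by norm_num)
  obtain ⟨δ, hδ, hball⟩ := Metric.eventually_nhds_iff_ball.1
    ((eventually_mem_set.2 hs).and hdiff)
  obtain ⟨δ₁, hδ₁, hb1⟩ := Metric.eventually_nhds_iff_ball.1 h1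
  obtain ⟨δ₂, hδ₂, hb2⟩ := Metric.eventually_nhds_iff_ball.1 h2
  -- The Lipschitz constant K of the derivative may be zero; adding 1 makes the bound positive.
  refine ⟨K + 1, by positivity, min δ (min δ₁ δ₂), by positivity, fun x y hx hy => ?_⟩
  simp only [lt_min_iff] at hx hy
  have hmem {x y : E} (hx : ‖x‖ < δ) (hy : ‖y‖ < δ) : (x, y) ∈ ball (0 : E × E) δ := by
    rw [mem_ball_zero_iff, Prod.norm_def]; exact max_lt hx hy
  have hder (x y : E) (hx : ‖x‖ < δ) (hy : ‖y‖ < δ) : HasFDerivAt (fun y => r (x, y))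
      ((fderiv ℝ r (x, y)).comp (ContinuousLinearMap.inr ℝ E E)) y :=
    (hball _ (hmem hx hy)).2.hasFDerivAt.comp y (hasFDerivAt_prodMk_right x y)
  have hzero (y : E) (hy : ‖y‖ < min δ δ₂) :
      (fderiv ℝ r (0, y)).comp (ContinuousLinearMap.inr ℝ E E) = 0 := by
    have hy' := lt_min_iff.1 hy
    refine (hder 0 y (by simpa using hδ) hy'.1).unique ?_
    refine (hasFDerivAt_const (0 : F) y).congr_of_eventuallyEq ?_
    filter_upwards [isOpen_ball.mem_nhds (show y ∈ ball (0 : E) δ₂ by simpa using hy'.2)] with z hz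
    exact hb2 z hz
  -- The y-derivative vanishes at (0, z), so at (x, z) it is at most K‖x‖ by the Lipschitz property.
  -- The mean value inequality in y then yields the extra factor ‖y‖.
  have hbound : ∀ z ∈ ball (0 : E) (min δ δ₂),
      ‖(fderiv ℝ r (x, z)).comp (ContinuousLinearMap.inr ℝ E E)‖ ≤ (K + 1) * ‖x‖ := by
    intro z hz
    rw [mem_ball_zero_iff] at hz
    have hz' := lt_min_iff.1 hz
    rw [← sub_zero ((fderiv ℝ r (x, z)).comp (ContinuousLinearMap.inr ℝ E E)), ← hzero z hz,
      ← ContinuousLinearMap.sub_comp]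
    have hlip := hK.norm_sub_le (hball _ (hmem hx.1 hz'.1)).1
      (hball _ (hmem (x := 0) (by simpa using hδ) hz'.1)).1
    have hn : ‖((x, z) : E × E) - (0, z)‖ = ‖x‖ := by simp [Prod.norm_def]
    rw [hn] at hlip
    calc _ ≤ ‖fderiv ℝ r (x, z) - fderiv ℝ r (0, z)‖ * ‖ContinuousLinearMap.inr ℝ E E‖ :=
          ContinuousLinearMap.opNorm_comp_le _ _
      _ ≤ (K * ‖x‖) * 1 := by
          gcongr
          exact ContinuousLinearMap.norm_inr_le_one ℝ E E
      _ ≤ _ := by nlinarith [norm_nonneg x]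
  have := (convex_ball (0 : E) (min δ δ₂)).norm_image_sub_le_of_norm_hasFDerivWithin_le
    (f := fun y => r (x, y)) (x := 0) (y := y)
    (fun z hz => (hder x z hx.1 (by rw [mem_ball_zero_iff] at hz; exact (lt_min_iff.1 hz).1)).hasFDerivWithinAt)
    hbound (by simp [hδ, hδ₂]) (by rw [mem_ball_zero_iff]; exact lt_min hy.1 hy.2.2)
  rwa [hb1 x (by simpa using hx.2.1), sub_zero, sub_zero] at this

end BilinearEstimate

/-! ## One-parameter subgroups -/

section OneParameter

open Filter Topology Set Metric

variable (n : ℕ) {G : Type*} [TopologicalSpace G] [ChartedSpace (EuclideanSpace ℝ (Fin n)) G]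
  [Group G] [LieGroup (𝓡 n) ∞ G]

/-- Since 1 is neutral, multiplication minus addition vanishes on both axes, and the quadratic
estimate applies. -/
theorem exists_norm_mulChart_sub_le (G : Type*) [TopologicalSpace G]
    [ChartedSpace (EuclideanSpace ℝ (Fin n)) G] [Group G] [LieGroup (𝓡 n) ∞ G] :
    ∃ C > 0, ∃ δ > 0, ∀ x y : EuclideanSpace ℝ (Fin n), ‖x‖ < δ → ‖y‖ < δ →
      ‖mulChart n G (x, y) - (x + y)‖ ≤ C * ‖x‖ * ‖y‖ ∧
      expChart n G (mulChart n G (x, y)) = expChart n G x * expChart n G y := by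
  obtain ⟨C, hC, δ, hδ, h⟩ := ContDiffAt.exists_norm_le_mul_of_zero_axes
    (r := fun p => mulChart n G p - (p.1 + p.2))
    (((eventually_contDiffAt_mulChart n (G := G)).self_of_nhds.sub
      (contDiffAt_fst.add contDiffAt_snd)).of_le ENat.LEInfty.out)
    (by filter_upwards [eventually_mulChart_zero_right n (G := G)] with x hx; simp [hx])
    (by filter_upwards [eventually_mulChart_zero_left n (G := G)] with x hx; simp [hx])
  obtain ⟨δ', hδ', h'⟩ := Metric.eventually_nhds_iff_ball.1
    (eventually_expChart_mulChart n (G := G))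
  refine ⟨C, hC, min δ δ', by positivity, fun x y hx hy => ?_⟩
  rw [lt_min_iff] at hx hy
  refine ⟨h x y hx.1 hy.1, h' (x, y) ?_⟩
  rw [mem_ball_zero_iff, Prod.norm_def]
  exact max_lt hx.2 hy.2

/-- A k-th power is k-fold addition up to second order. Each further factor adds an error C‖z‖‖x‖
with ‖z‖ ≤ 2k‖x‖, and these errors add up to at most C(k‖x‖)². -/
theorem exists_norm_log_pow_sub_le (G : Type*) [TopologicalSpace G]
    [ChartedSpace (EuclideanSpace ℝ (Fin n)) G] [Group G] [LieGroup (𝓡 n) ∞ G] {ρ : ℝ}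
    (hρ : 0 < ρ) :
    ∃ C > 0, ∃ r > 0, ∀ (x : EuclideanSpace ℝ (Fin n)) (k : ℕ), k * ‖x‖ ≤ r →
      ∃ z, expChart n G x ^ k = expChart n G z ∧ ‖z - (k : ℝ) • x‖ ≤ C * (k * ‖x‖) ^ 2 ∧
        ‖z‖ ≤ ρ := by
  obtain ⟨C, hC, δ, hδ, h⟩ := exists_norm_mulChart_sub_le n G
  -- The bound C⁻¹ makes the error at most k‖x‖, so that ‖z‖ ≤ 2r. Then δ/3 keeps z and x within the
  -- domain of the product estimate, and ρ/2 gives ‖z‖ ≤ ρ.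
  set r : ℝ := min (min (δ / 3) (ρ / 2)) C⁻¹ with hr
  have hr0 : 0 < r := by positivity
  have hrδ : r ≤ δ / 3 := (min_le_left _ _).trans (min_le_left _ _)
  have hrρ : r ≤ ρ / 2 := (min_le_left _ _).trans (min_le_right _ _)
  have hrC : C * r ≤ 1 := by
    calc C * r ≤ C * C⁻¹ := by gcongr; exact min_le_right _ _
      _ = 1 := mul_inv_cancel₀ hC.ne'
  have hz2 {x z : EuclideanSpace ℝ (Fin n)} {k : ℕ} (hk : k * ‖x‖ ≤ r)
      (hz : ‖z - (k : ℝ) • x‖ ≤ C * (k * ‖x‖) ^ 2) : ‖z‖ ≤ 2 * (k * ‖x‖) := by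
    have h1 : ‖z‖ ≤ ‖z - (k : ℝ) • x‖ + ‖(k : ℝ) • x‖ := by
      simpa using norm_add_le (z - (k : ℝ) • x) ((k : ℝ) • x)
    have h2 : ‖(k : ℝ) • x‖ = k * ‖x‖ := by rw [norm_smul]; simp
    have h3 : 0 ≤ k * ‖x‖ := by positivity
    have h4 : C * (k * ‖x‖) ^ 2 ≤ k * ‖x‖ := by
      calc C * (k * ‖x‖) ^ 2 = (C * (k * ‖x‖)) * (k * ‖x‖) := by ring
        _ ≤ 1 * (k * ‖x‖) := by
          gcongr
          exact (mul_le_mul_of_nonneg_left hk hC.le).trans hrC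
        _ = _ := one_mul _
    linarith
  have key (x : EuclideanSpace ℝ (Fin n)) (k : ℕ) : k * ‖x‖ ≤ r →
      ∃ z, expChart n G x ^ k = expChart n G z ∧ ‖z - (k : ℝ) • x‖ ≤ C * (k * ‖x‖) ^ 2 := by
    induction k with
    | zero => intro _; exact ⟨0, by simp, by simp⟩
    | succ k ih =>
      intro hk
      push_cast at hk
      have hx0 := norm_nonneg x
      have hkx : 0 ≤ k * ‖x‖ := by positivity
      have hk' : k * ‖x‖ ≤ r := by linarith
      obtain ⟨z, hz, hz'⟩ := ih hk'
      have hzz := hz2 hk' hz'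
      obtain ⟨h1, h2⟩ := h z x (by linarith) (by linarith)
      refine ⟨mulChart n G (z, x), ?_, ?_⟩
      · rw [pow_succ, hz, h2]
      · have e : mulChart n G (z, x) - ((k + 1 : ℕ) : ℝ) • x =
            (mulChart n G (z, x) - (z + x)) + (z - (k : ℝ) • x) := by
          push_cast; module
        rw [e]
        refine (norm_add_le _ _).trans ((add_le_add h1 hz').trans ?_)
        push_cast
        -- The induction closes because k² + 2k ≤ (k + 1)².
        have : C * ‖z‖ * ‖x‖ ≤ C * (2 * (k * ‖x‖)) * ‖x‖ := by gcongr
        nlinarith [mul_nonneg hC.le (sq_nonneg ‖x‖)]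
  refine ⟨C, hC, r, hr0, fun x k hk => ?_⟩
  obtain ⟨z, hz, hz'⟩ := key x k hk
  exact ⟨z, hz, hz', by linarith [hz2 hk hz']⟩

/-- Limits of powers of elements of a closed subgroup that approach the identity along a
direction. -/
theorem exists_hom_of_tendsto [CompactSpace G] [T2Space G] {S : Subgroup G}
    (hS : IsClosed (S : Set G)) {α : Type*} {l : Filter α} [l.NeBot] {s : α → G}
    (hs : ∀ᶠ a in l, s a ∈ S) {τ : α → ℝ} (hτ : ∀ᶠ a in l, 0 < τ a) (hτ0 : Tendsto τ l (𝓝 0))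
    (hs1 : Tendsto s l (𝓝 1)) {Y : EuclideanSpace ℝ (Fin n)}
    (hY : Tendsto (fun a => (τ a)⁻¹ • logChart n (s a)) l (𝓝 Y)) :
    ∃ γ : ℝ → G, (∀ t u, γ (t + u) = γ t * γ u) ∧ (∀ t, γ t ∈ S) ∧
      ∃ C > 0, ∃ ε > 0, ∀ t, 0 ≤ t → t < ε → ∃ z, γ t = expChart n G z ∧
        ‖z - t • Y‖ ≤ C * t ^ 2 := by
  have := continuousMul_of_lieGroup n (G := G)
  -- Along an ultrafilter all the families s^⌊t/τ⌋ converge at once in the compact group, so the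
  -- limits γ t are available for every t simultaneously.
  set U : Ultrafilter α := Ultrafilter.of l with hU
  have hUl : (U : Filter α) ≤ l := Ultrafilter.of_le l
  have hlim (t : ℝ) : ∃ g : G, Tendsto (fun a => s a ^ ⌊t / τ a⌋) U (𝓝 g) := by
    obtain ⟨g, -, hg⟩ := isCompact_univ.ultrafilter_le_nhds
      (U.map fun a => s a ^ ⌊t / τ a⌋) (by simp)
    exact ⟨g, hg⟩
  choose γ hγ using hlim
  refine ⟨γ, fun t u => ?_, fun t => ?_, ?_⟩
  -- The floor is additive up to 0 or 1, and a surplus factor s tends to 1; hence the limit is a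
  -- homomorphism.
  · have he : Tendsto (fun a => s a ^ (⌊(t + u) / τ a⌋ - ⌊t / τ a⌋ - ⌊u / τ a⌋)) U (𝓝 1) := by
      rw [tendsto_def]
      intro V hV
      filter_upwards [(hs1.mono_left hUl) hV] with a ha
      have h1 := Int.le_floor_add (t / τ a) (u / τ a)
      have h2 := Int.le_floor_add_floor (t / τ a) (u / τ a)
      rw [← add_div] at h1 h2
      have h3 : ⌊(t + u) / τ a⌋ - ⌊t / τ a⌋ - ⌊u / τ a⌋ = 0 ∨
        ⌊(t + u) / τ a⌋ - ⌊t / τ a⌋ - ⌊u / τ a⌋ = 1 := by omega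
      rcases h3 with h3 | h3
      · simpa [h3] using mem_of_mem_nhds hV
      · simpa [h3] using ha
    have h2 := ((hγ t).mul (hγ u)).mul he
    rw [mul_one] at h2
    refine tendsto_nhds_unique (hγ (t + u)) (h2.congr fun a => ?_)
    rw [← zpow_add, ← zpow_add]
    congr 1
    ring
  · exact hS.mem_of_tendsto (hγ t) ((hs.filter_mono hUl).mono fun a ha => S.zpow_mem ha _)
  · obtain ⟨ρ, hρ, hexp⟩ := Metric.eventually_nhds_iff_ball.1
      (eventually_contMDiffAt_expChart n (G := G))
    obtain ⟨C, hC, r, hr, hpow⟩ := exists_norm_log_pow_sub_le n G (half_pos hρ)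
    -- Using ‖Y‖ + 1 instead of ‖Y‖ keeps the constants positive when Y = 0.
    refine ⟨C * (‖Y‖ + 1) ^ 2, by positivity, r / (‖Y‖ + 1), by positivity, fun t ht ht' => ?_⟩
    have htY : t * ‖Y‖ < r := by
      have := (lt_div_iff₀ (by positivity)).1 ht'
      nlinarith
    have hk : Tendsto (fun a => ((⌊t / τ a⌋.toNat : ℕ) : ℝ) * τ a) U (𝓝 t) := by
      have hτ0' : Tendsto (fun a => t - τ a) U (𝓝 t) := by
        simpa using (tendsto_const_nhds (x := t)).sub (hτ0.mono_left hUl)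
      refine tendsto_of_tendsto_of_tendsto_of_le_of_le' hτ0' tendsto_const_nhds ?_ ?_
      · filter_upwards [hUl hτ] with a ha
        have h1 := Nat.lt_floor_add_one (t / τ a)
        rw [div_lt_iff₀ ha] at h1
        rw [Int.floor_toNat]
        linarith
      · filter_upwards [hUl hτ] with a ha
        have h1 := Nat.floor_le (div_nonneg ht ha.le)
        rw [le_div_iff₀ ha] at h1
        rw [Int.floor_toNat]
        exact h1
    have hkY : Tendsto (fun a => ((⌊t / τ a⌋.toNat : ℕ) : ℝ) • logChart n (s a)) U
        (𝓝 (t • Y)) := by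
      refine (hk.smul (hY.mono_left hUl)).congr' ?_
      filter_upwards [hUl hτ] with a ha
      rw [smul_smul, mul_assoc, mul_inv_cancel₀ ha.ne', mul_one]
    have hnorm : Tendsto (fun a => ((⌊t / τ a⌋.toNat : ℕ) : ℝ) * ‖logChart n (s a)‖) U
        (𝓝 (t * ‖Y‖)) := by
      have := hkY.norm
      simpa [norm_smul, abs_of_nonneg ht] using this
    have hex : ∀ᶠ a in (U : Filter α), ∃ z, s a ^ ⌊t / τ a⌋ = expChart n G z ∧
        ‖z - ((⌊t / τ a⌋.toNat : ℕ) : ℝ) • logChart n (s a)‖ ≤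
          C * ((⌊t / τ a⌋.toNat : ℕ) * ‖logChart n (s a)‖) ^ 2 ∧ ‖z‖ ≤ ρ / 2 := by
      filter_upwards [hnorm.eventually (gt_mem_nhds htY), hUl hτ,
        hUl (hs1.eventually (eventually_expChart_logChart n))] with a h1 h2 h3
      obtain ⟨z, hz⟩ := hpow _ _ h1.le
      refine ⟨z, ?_, hz.2⟩
      rw [← hz.1, h3, ← zpow_natCast, Int.toNat_of_nonneg (Int.floor_nonneg.2 (div_nonneg ht h2.le))]
    obtain ⟨z, hz⟩ : ∃ z : α → EuclideanSpace ℝ (Fin n), ∀ᶠ a in (U : Filter α),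
        s a ^ ⌊t / τ a⌋ = expChart n G (z a) ∧
        ‖z a - ((⌊t / τ a⌋.toNat : ℕ) : ℝ) • logChart n (s a)‖ ≤
          C * ((⌊t / τ a⌋.toNat : ℕ) * ‖logChart n (s a)‖) ^ 2 ∧ ‖z a‖ ≤ ρ / 2 := hex.choice
    -- The coordinates of the powers stay in a compact ball, so they too converge along U, and the
    -- quadratic estimate passes to the limit w.
    obtain ⟨w, hw, hw'⟩ := (isCompact_closedBall (0 : EuclideanSpace ℝ (Fin n))
      (ρ / 2)).ultrafilter_le_nhds (U.map z) (by
        rw [Filter.le_principal_iff, Ultrafilter.coe_map, mem_map]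
        filter_upwards [hz] with a ha
        simpa using ha.2.2)
    have hzw : Tendsto z U (𝓝 w) := hw'
    rw [mem_closedBall_zero_iff] at hw
    refine ⟨w, ?_, ?_⟩
    · have hc : ContinuousAt (expChart n G) w :=
        (hexp w (by rw [mem_ball_zero_iff]; linarith)).continuousAt
      refine tendsto_nhds_unique (hγ t) ((hc.tendsto.comp hzw).congr' ?_)
      filter_upwards [hz] with a ha using ha.1.symm
    · have hle : ‖w - t • Y‖ ≤ C * (t * ‖Y‖) ^ 2 :=
        le_of_tendsto_of_tendsto (hzw.sub hkY).norm ((hnorm.pow 2).const_mul C)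
          (hz.mono fun a ha => ha.2.1)
      refine hle.trans ?_
      have : (t * ‖Y‖) ^ 2 ≤ (t * (‖Y‖ + 1)) ^ 2 := by gcongr; linarith
      nlinarith

/-- A one-parameter subgroup with a one-sided velocity has that velocity. -/
theorem hasDerivAt_of_hom {γ : ℝ → G} (hγ : ∀ t u, γ (t + u) = γ t * γ u)
    {Y : EuclideanSpace ℝ (Fin n)} {C ε : ℝ} (hC : 0 < C) (hε : 0 < ε)
    (h : ∀ t, 0 ≤ t → t < ε → ∃ z, γ t = expChart n G z ∧ ‖z - t • Y‖ ≤ C * t ^ 2) :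
    γ 0 = 1 ∧ ContinuousAt γ 0 ∧ HasDerivAt (fun t => logChart n (γ t)) Y 0 := by
  have := topologicalGroup_of_lieGroup (𝓡 n) ∞ (G := G)
  have h0 : γ 0 = 1 := by
    have := hγ 0 0
    rwa [add_zero, left_eq_mul] at this
  have hinv (t : ℝ) : γ (-t) = (γ t)⁻¹ := by
    rw [eq_inv_iff_mul_eq_one, ← hγ, neg_add_cancel, h0]
  obtain ⟨z, hz⟩ : ∃ z : ℝ → EuclideanSpace ℝ (Fin n), ∀ t, 0 ≤ t → t < ε →
      γ t = expChart n G (z t) ∧ ‖z t - t • Y‖ ≤ C * t ^ 2 := by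
    choose! z hz using h
    exact ⟨z, hz⟩
  have hev : ∀ᶠ t in 𝓝[≥] (0 : ℝ), 0 ≤ t ∧ t < ε := by
    filter_upwards [self_mem_nhdsWithin, mem_nhdsWithin_of_mem_nhds (gt_mem_nhds hε)] with t h1 h2
    exact ⟨h1, h2⟩
  have hzlim : Tendsto z (𝓝[≥] 0) (𝓝 0) := by
    rw [tendsto_zero_iff_norm_tendsto_zero]
    have hlim : Tendsto (fun t : ℝ => C * t ^ 2 + |t| * ‖Y‖) (𝓝[≥] 0) (𝓝 0) := by
      refine Tendsto.mono_left (Continuous.tendsto' (by fun_prop) _ _ (by simp)) nhdsWithin_le_nhds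
    refine squeeze_zero' (Eventually.of_forall fun _ => norm_nonneg _) ?_ hlim
    filter_upwards [hev] with t ht
    have h1 := (hz t ht.1 ht.2).2
    have h2 : ‖z t‖ ≤ ‖z t - t • Y‖ + ‖t • Y‖ := by
      simpa using norm_add_le (z t - t • Y) (t • Y)
    rw [norm_smul, Real.norm_eq_abs] at h2
    linarith
  have hright : Tendsto γ (𝓝[≥] 0) (𝓝 1) := by
    refine ((tendsto_expChart n (G := G)).comp hzlim).congr' ?_
    filter_upwards [hev] with t ht using (hz t ht.1 ht.2).1.symm
  have hneg : Tendsto (fun t : ℝ => -t) (𝓝[≤] 0) (𝓝[≥] 0) := by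
    refine tendsto_nhdsWithin_iff.2 ⟨(Continuous.tendsto' (by fun_prop) _ _ (by simp)).mono_left
      nhdsWithin_le_nhds, ?_⟩
    filter_upwards [self_mem_nhdsWithin] with t ht
    simpa using ht
  have hleft : Tendsto γ (𝓝[≤] 0) (𝓝 1) := by
    have := (hright.comp hneg).inv
    rw [inv_one] at this
    refine this.congr fun t => ?_
    rw [Function.comp_apply, hinv, inv_inv]
  have hlim : Tendsto γ (𝓝 0) (𝓝 1) := by
    rw [← nhdsLE_sup_nhdsGE]
    exact hleft.sup hright
  refine ⟨h0, by rw [ContinuousAt, h0]; exact hlim, ?_⟩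
  set f : ℝ → EuclideanSpace ℝ (Fin n) := fun t => logChart n (γ t) with hf
  have hflim : Tendsto f (𝓝 0) (𝓝 0) := (tendsto_logChart n).comp hlim
  obtain ⟨δ, hδ, hlog⟩ := Metric.eventually_nhds_iff_ball.1
    (hlim.eventually (eventually_expChart_logChart n))
  obtain ⟨A, hA, η, hη, hmul⟩ := exists_norm_mulChart_sub_le n G
  have hpos : ∀ᶠ t in 𝓝[≥] (0 : ℝ), ‖f t - t • Y‖ ≤ C * t ^ 2 := by
    filter_upwards [hev, hzlim.eventually (eventually_logChart_expChart n (G := G))] with t ht h2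
    have h3 := hz t ht.1 ht.2
    have : f t = z t := by rw [hf]; simp only; rw [h3.1, h2]
    rw [this]
    exact h3.2
  -- The bound 1/(2A) makes A‖f t‖ ≤ 1/2, which lets ‖f(-t)‖ be absorbed and bounded by 2‖f t‖.
  have hsmall : ∀ᶠ t in 𝓝 (0 : ℝ), ‖f t‖ < min η (1 / (2 * A)) := by
    have := hflim.norm
    rw [norm_zero] at this
    exact this.eventually (gt_mem_nhds (by positivity))
  have hball : ∀ᶠ t in 𝓝 (0 : ℝ), t ∈ ball (0 : ℝ) δ := ball_mem_nhds _ hδ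
  have hle1 : ∀ᶠ t in 𝓝 (0 : ℝ), |t| < 1 := by
    have : Tendsto (fun t : ℝ => |t|) (𝓝 0) (𝓝 0) := Continuous.tendsto' (by fun_prop) _ _ (by simp)
    exact this.eventually (gt_mem_nhds one_pos)
  -- C comes from the estimate for t ≥ 0; the other term is the product error A‖f t‖‖f(-t)‖ with ‖f
  -- t‖ ≤ (C + ‖Y‖)t and ‖f(-t)‖ ≤ 2(C + ‖Y‖)t.
  set D : ℝ := C + 2 * A * (C + ‖Y‖) ^ 2 with hD
  -- Negative times: γ(t)γ(-t) = 1 gives f(-t) = -f(t) up to the quadratic product error.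
  have hpos' : ∀ᶠ t in 𝓝[≥] (0 : ℝ), ‖f (-t) + t • Y‖ ≤ D * t ^ 2 := by
    have hnegall : Tendsto (fun t : ℝ => -t) (𝓝[≥] 0) (𝓝 0) :=
      (Continuous.tendsto' (by fun_prop) _ _ (by simp)).mono_left nhdsWithin_le_nhds
    filter_upwards [hpos, nhdsWithin_le_nhds hsmall, hnegall.eventually hsmall,
      nhdsWithin_le_nhds hball, hnegall.eventually hball, nhdsWithin_le_nhds hle1,
      self_mem_nhdsWithin] with t h1 h2 h3 h4 h5 h6 h7
    rw [lt_min_iff] at h2 h3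
    have ht0 : (0 : ℝ) ≤ t := h7
    have e1 : mulChart n G (f t, f (-t)) = 0 := by
      rw [mulChart, hf]
      simp only
      rw [hlog t h4, hlog (-t) h5, ← hγ, add_neg_cancel, h0, logChart_one]
    have h8 := (hmul (f t) (f (-t)) h2.1 h3.1).1
    rw [e1, zero_sub, norm_neg] at h8
    have hft : ‖f t‖ ≤ (C + ‖Y‖) * t := by
      have h9 : ‖f t‖ ≤ ‖f t - t • Y‖ + ‖t • Y‖ := by
        simpa using norm_add_le (f t - t • Y) (t • Y)
      rw [norm_smul, Real.norm_of_nonneg ht0] at h9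
      have : t ^ 2 ≤ t := by
        rw [abs_of_nonneg ht0] at h6
        nlinarith
      nlinarith
    have hfn : ‖f (-t)‖ ≤ 2 * ((C + ‖Y‖) * t) := by
      have h9 : ‖f (-t)‖ ≤ ‖f t + f (-t)‖ + ‖f t‖ := by
        have := norm_sub_le (f t + f (-t)) (f t)
        simpa using this
      have h10 : A * ‖f t‖ ≤ 1 / 2 := by
        calc A * ‖f t‖ ≤ A * (1 / (2 * A)) := by gcongr; exact h2.2.le
          _ = 1 / 2 := by field_simp
      nlinarith [norm_nonneg (f (-t))]
    have e2 : f (-t) + t • Y = (f t + f (-t)) - (f t - t • Y) := by abel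
    rw [e2]
    refine (norm_sub_le _ _).trans ((add_le_add h8 h1).trans ?_)
    have : A * ‖f t‖ * ‖f (-t)‖ ≤ A * ((C + ‖Y‖) * t) * (2 * ((C + ‖Y‖) * t)) := by
      gcongr
    rw [hD]
    nlinarith
  have hall : ∀ᶠ t in 𝓝 (0 : ℝ), ‖f t - t • Y‖ ≤ D * t ^ 2 := by
    rw [← nhdsLE_sup_nhdsGE, eventually_sup]
    constructor
    · filter_upwards [hneg.eventually hpos'] with t ht
      rw [neg_neg, neg_smul, neg_sq, ← sub_eq_add_neg] at ht
      exact ht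
    · filter_upwards [hpos] with t ht
      refine ht.trans ?_
      rw [hD]
      have : 0 ≤ 2 * A * (C + ‖Y‖) ^ 2 * t ^ 2 := by positivity
      nlinarith
  have hf0 : f 0 = 0 := by rw [hf]; simp only; rw [h0, logChart_one]
  rw [hasDerivAt_iff_isLittleO_nhds_zero]
  simp only [zero_add, hf0, sub_zero]
  refine Asymptotics.IsBigO.trans_isLittleO (g := fun t : ℝ => t ^ 2) ?_ ?_
  · refine Asymptotics.IsBigO.of_bound D ?_
    filter_upwards [hall] with t ht
    rwa [Real.norm_of_nonneg (sq_nonneg t)]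
  · exact Asymptotics.isLittleO_pow_id one_lt_two

/-- A differentiable one-parameter subgroup is smooth. -/
theorem contMDiff_of_hom {γ : ℝ → G} (hγ : ∀ t u, γ (t + u) = γ t * γ u) (h0 : γ 0 = 1)
    (hc : ContinuousAt γ 0) {Y : EuclideanSpace ℝ (Fin n)}
    (hY : HasDerivAt (fun t => logChart n (γ t)) Y 0) : ContMDiff 𝓘(ℝ, ℝ) (𝓡 n) ∞ γ := by
  have hlim : Tendsto γ (𝓝 0) (𝓝 1) := by rw [← h0]; exact hc
  set f : ℝ → EuclideanSpace ℝ (Fin n) := fun t => logChart n (γ t) with hf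
  have hf0 : f 0 = 0 := by rw [hf]; simp only; rw [h0, logChart_one]
  have hflim : Tendsto f (𝓝 0) (𝓝 0) := (tendsto_logChart n).comp hlim
  -- In coordinates V is the left-invariant vector field with value Y at 1. Differentiating γ(t + h)
  -- = γ(t)γ(h) at h = 0 shows that f solves f' = V(f).
  let V : EuclideanSpace ℝ (Fin n) → EuclideanSpace ℝ (Fin n) := fun x =>
    fderiv ℝ (mulChart n G) (x, 0) (0, Y)
  have hV : ∀ᶠ x in 𝓝 (0 : EuclideanSpace ℝ (Fin n)), ContDiffAt ℝ ∞ V x ∧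
      DifferentiableAt ℝ (mulChart n G) (x, 0) := by
    have ht : Tendsto (fun x : EuclideanSpace ℝ (Fin n) => (x, (0 : EuclideanSpace ℝ (Fin n))))
      (𝓝 0) (𝓝 0) := Continuous.tendsto' (by fun_prop) _ _ rfl
    filter_upwards [ht.eventually (eventually_contDiffAt_mulChart n (G := G))] with x hx
    refine ⟨?_, hx.differentiableAt (by simp)⟩
    have h1 : ContDiffAt ℝ ∞ (fun x : EuclideanSpace ℝ (Fin n) => fderiv ℝ (mulChart n G) (x, 0)) x :=
      (hx.fderiv_right (m := ∞) (by simp)).comp x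
        ((contDiff_prodMk_left (0 : EuclideanSpace ℝ (Fin n))).contDiffAt)
    exact h1.clm_apply contDiffAt_const
  have hlog := hlim.eventually (eventually_expChart_logChart n)
  have hder : ∀ᶠ t in 𝓝 (0 : ℝ), HasDerivAt f (V (f t)) t := by
    filter_upwards [hlog, hflim.eventually hV] with t ht hVt
    have hadd : HasDerivAt (fun h => f (t + h)) (V (f t)) 0 := by
      have hcomp : HasDerivAt (fun h => mulChart n G (f t, f h)) (V (f t)) 0 := by
        have h1 : HasFDerivAt (mulChart n G) (fderiv ℝ (mulChart n G) (f t, 0)) (f t, f 0) := by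
          rw [hf0]; exact hVt.2.hasFDerivAt
        exact h1.comp_hasDerivAt (0 : ℝ) ((hasDerivAt_const (0 : ℝ) (f t)).prodMk hY)
      refine hcomp.congr_of_eventuallyEq ?_
      filter_upwards [hlog] with h hh
      rw [hf]
      simp only [mulChart]
      rw [ht, hh, hγ]
    have h2 := HasDerivAt.comp_sub_const (f := fun h => f (t + h)) (x := t) (a := t)
      (f' := V (f t)) (by rwa [sub_self])
    simpa using h2
  obtain ⟨δ, hδ, hball⟩ := Metric.eventually_nhds_iff_ball.1 (hder.and (hflim.eventually hV))
  -- Bootstrapping in the differential equation: f of class Cᵏ makes f' = V(f) of class Cᵏ.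
  have hsmooth : ∀ k : ℕ, ContDiffOn ℝ k f (ball 0 δ) := by
    intro k
    induction k with
    | zero =>
      exact contDiffOn_zero.2 fun t ht => (hball t ht).1.continuousAt.continuousWithinAt
    | succ k ih =>
      rw [Nat.cast_succ, contDiffOn_succ_iff_deriv_of_isOpen isOpen_ball]
      refine ⟨fun t ht => (hball t ht).1.differentiableAt.differentiableWithinAt, by simp, ?_⟩
      have : ContDiffOn ℝ k (fun t => V (f t)) (ball 0 δ) := fun t ht =>
        ((hball t ht).2.1.of_le (by exact_mod_cast le_top)).comp_contDiffWithinAt t (ih t ht)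
      exact this.congr fun t ht => (hball t ht).1.deriv
  have hfs : ContDiffAt ℝ ∞ f 0 :=
    (contDiffOn_infty.2 hsmooth).contDiffAt (ball_mem_nhds 0 hδ)
  have hγ0 : ContMDiffAt 𝓘(ℝ, ℝ) (𝓡 n) ∞ γ 0 := by
    have h1 : ContMDiffAt 𝓘(ℝ, EuclideanSpace ℝ (Fin n)) (𝓡 n) ∞ (expChart n G) (f 0) := by
      rw [hf0]; exact (eventually_contMDiffAt_expChart n).self_of_nhds
    exact (h1.comp 0 hfs.contMDiffAt).congr_of_eventuallyEq (by
      filter_upwards [hlog] with t ht using ht.symm)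
  -- Smoothness at 0 is carried to t by γ(u) = γ(t)γ(u - t).
  intro t
  have h2 : ContMDiffAt 𝓘(ℝ, ℝ) 𝓘(ℝ, ℝ) ∞ (fun u : ℝ => u - t) t :=
    (contDiffAt_id.sub contDiffAt_const).contMDiffAt
  have h3 : ContMDiffAt 𝓘(ℝ, ℝ) (𝓡 n) ∞ (fun u => γ (u - t)) t :=
    ContMDiffAt.comp t (by rw [sub_self]; exact hγ0) h2
  refine ((contMDiffAt_const (c := γ t)).mul h3).congr_of_eventuallyEq ?_
  filter_upwards with u
  rw [Pi.mul_apply, ← hγ, add_sub_cancel]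

end OneParameter

/-! ## Closed subgroups -/

section ClosedSubgroup

open Filter Topology Set Metric

variable {n : ℕ} {G : Type*} [TopologicalSpace G] [ChartedSpace (EuclideanSpace ℝ (Fin n)) G]
  [Group G]

/-- A chain rule on the model spaces with the intermediate point y free, so that an equality of base
points never requires a transport between tangent spaces. -/
theorem HasMFDerivAt.comp_of_apply_eq {E₁ E₂ E₃ M₁ M₂ M₃ : Type*} [NormedAddCommGroup E₁]
    [NormedSpace ℝ E₁] [NormedAddCommGroup E₂] [NormedSpace ℝ E₂] [NormedAddCommGroup E₃]
    [NormedSpace ℝ E₃] [TopologicalSpace M₁] [ChartedSpace E₁ M₁] [TopologicalSpace M₂]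
    [ChartedSpace E₂ M₂] [TopologicalSpace M₃] [ChartedSpace E₃ M₃] {f : M₁ → M₂} {g : M₂ → M₃}
    {x : M₁} {y : M₂} {f' : E₁ →L[ℝ] E₂} {g' : E₂ →L[ℝ] E₃}
    (hg : HasMFDerivAt 𝓘(ℝ, E₂) 𝓘(ℝ, E₃) g y g') (hf : HasMFDerivAt 𝓘(ℝ, E₁) 𝓘(ℝ, E₂) f x f')
    (h : f x = y) : HasMFDerivAt 𝓘(ℝ, E₁) 𝓘(ℝ, E₃) (fun z => g (f z)) x (g'.comp f') := by
  subst h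
  exact hg.comp x hf

theorem velocity_eq_iff {γ : ℝ → G} (h0 : γ 0 = 1) (hγ : ContMDiff 𝓘(ℝ, ℝ) (𝓡 n) ∞ γ)
    {X : EuclideanSpace ℝ (Fin n)} :
    velocity n γ = X ↔ HasDerivAt (fun t => logChart n (γ t)) X 0 := by
  have h1 : HasMFDerivAt 𝓘(ℝ, ℝ) (𝓡 n) γ 0 (mfderiv 𝓘(ℝ, ℝ) (𝓡 n) γ 0) :=
    (hγ.mdifferentiableAt (by simp)).hasMFDerivAt
  have h2 := (HasMFDerivAt.hasFDerivAt_logChart n h0 h1).hasDerivAt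
  constructor
  · intro h
    rw [← h]
    exact h2
  · intro h
    exact h2.unique h

/-- The Lie algebra of a subgroup, as a subspace of the model space. -/
noncomputable def lieSubspace (n : ℕ) {G : Type*} [TopologicalSpace G]
    [ChartedSpace (EuclideanSpace ℝ (Fin n)) G] [Group G] [LieGroup (𝓡 n) ∞ G] (S : Subgroup G) :
    Submodule ℝ (EuclideanSpace ℝ (Fin n)) :=
  lieAlgebraOf n S

theorem mem_lieSubspace [LieGroup (𝓡 n) ∞ G] {S : Subgroup G} {X : EuclideanSpace ℝ (Fin n)} :
    X ∈ lieSubspace n S ↔ ∃ γ : ℝ → G, ContMDiff 𝓘(ℝ, ℝ) (𝓡 n) ∞ γ ∧ (∀ t, γ t ∈ S) ∧ γ 0 = 1 ∧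
      HasDerivAt (fun t => logChart n (γ t)) X 0 := by
  constructor
  · rintro ⟨γ, h1, h2, h3, h4⟩
    exact ⟨γ, h1, h2, h3, (velocity_eq_iff h3 h1).1 h4⟩
  · rintro ⟨γ, h1, h2, h3, h4⟩
    exact ⟨γ, h1, h2, h3, (velocity_eq_iff h3 h1).2 h4⟩

variable [T2Space G] [LieGroup (𝓡 n) ∞ G]

/-- Each one-parameter subgroup is an integral curve of the left-invariant field determined by its
velocity, and integral curves through 1 are unique. -/
theorem oneParameter_unique {γ₁ γ₂ : ℝ → G} (h₁ : ∀ t u, γ₁ (t + u) = γ₁ t * γ₁ u)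
    (h₂ : ∀ t u, γ₂ (t + u) = γ₂ t * γ₂ u) (e₁ : γ₁ 0 = 1) (e₂ : γ₂ 0 = 1)
    (s₁ : ContMDiff 𝓘(ℝ, ℝ) (𝓡 n) ∞ γ₁) (s₂ : ContMDiff 𝓘(ℝ, ℝ) (𝓡 n) ∞ γ₂)
    (hv : velocity n γ₁ = velocity n γ₂) : γ₁ = γ₂ := by
  have : LieGroup (𝓡 n) (minSmoothness ℝ 3) G :=
    LieGroup.of_le (n := ∞) (by simpa using ENat.LEInfty.out)
  have key {γ : ℝ → G} (h : ∀ t u, γ (t + u) = γ t * γ u) (e : γ 0 = 1)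
      (s : ContMDiff 𝓘(ℝ, ℝ) (𝓡 n) ∞ γ) :
      IsMIntegralCurve γ (mulInvariantVectorField (I := 𝓡 n) (velocity n γ)) := by
    intro t
    have d1 : HasMFDerivAt 𝓘(ℝ, ℝ) 𝓘(ℝ, ℝ) (fun u : ℝ => u - t) t
        (ContinuousLinearMap.id ℝ ℝ) := ((hasFDerivAt_id t).sub_const t).hasMFDerivAt
    have d2 : HasMFDerivAt 𝓘(ℝ, ℝ) (𝓡 n) γ 0 (mfderiv 𝓘(ℝ, ℝ) (𝓡 n) γ 0) :=
      (s.mdifferentiableAt (by simp)).hasMFDerivAt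
    have d3 : HasMFDerivAt (𝓡 n) (𝓡 n) (fun g : G => γ t * g) 1
        (mfderiv (𝓡 n) (𝓡 n) (fun g : G => γ t * g) 1) :=
      (contMDiff_mul_left.mdifferentiableAt (n := ∞) (by simp)).hasMFDerivAt
    have d4 := HasMFDerivAt.comp_of_apply_eq d3 (HasMFDerivAt.comp_of_apply_eq d2 d1 (sub_self t))
      (by rw [sub_self, e])
    have hfun : (fun u => γ t * γ (u - t)) = γ := by
      ext u; rw [← h, add_sub_cancel]
    rw [hfun] at d4
    refine d4.congr_mfderiv ?_
    refine ContinuousLinearMap.ext_ring ?_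
    exact (one_smul ℝ (mfderiv (𝓡 n) (𝓡 n) (fun g : G => γ t * g) 1 (velocity n γ))).symm
  exact isMIntegralCurve_Ioo_eq_of_contMDiff_boundaryless (t₀ := (0 : ℝ))
    ((contMDiff_mulInvariantVectorField (velocity n γ₁)).of_le (by simp)) (key h₁ e₁ s₁)
    (by rw [hv]; exact key h₂ e₂ s₂) (by rw [e₁, e₂])

variable [CompactSpace G]

/-- A direction along which elements of a closed subgroup accumulate at the identity is the
velocity of a one-parameter subgroup. -/
theorem exists_oneParameter_of_tendsto {S : Subgroup G}
    (hS : IsClosed (S : Set G)) {α : Type*} {l : Filter α} [l.NeBot] {s : α → G}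
    (hs : ∀ᶠ a in l, s a ∈ S) {τ : α → ℝ} (hτ : ∀ᶠ a in l, 0 < τ a) (hτ0 : Tendsto τ l (𝓝 0))
    (hs1 : Tendsto s l (𝓝 1)) {Y : EuclideanSpace ℝ (Fin n)}
    (hY : Tendsto (fun a => (τ a)⁻¹ • logChart n (s a)) l (𝓝 Y)) :
    ∃ γ : ℝ → G, (∀ t u, γ (t + u) = γ t * γ u) ∧ ContMDiff 𝓘(ℝ, ℝ) (𝓡 n) ∞ γ ∧
      (∀ t, γ t ∈ S) ∧ γ 0 = 1 ∧ HasDerivAt (fun t => logChart n (γ t)) Y 0 := by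
  obtain ⟨γ, h1, h2, C, hC, ε, hε, h3⟩ := exists_hom_of_tendsto n hS hs hτ hτ0 hs1 hY
  obtain ⟨h4, h5, h6⟩ := hasDerivAt_of_hom n h1 hC hε h3
  exact ⟨γ, h1, contMDiff_of_hom n h1 h4 h5 h6, h2, h4, h6⟩

/-- The points c(t) at scale t approach 1 in the direction of the velocity, so a curve in a closed
subgroup may be replaced by a one-parameter subgroup with the same velocity. -/
theorem exists_oneParameter_of_curve {S : Subgroup G} (hS : IsClosed (S : Set G))
    {c : ℝ → G} (hc : ∀ᶠ t in 𝓝[>] 0, c t ∈ S) (hc0 : c 0 = 1) (hcc : ContinuousAt c 0)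
    {Y : EuclideanSpace ℝ (Fin n)} (hY : HasDerivAt (fun t => logChart n (c t)) Y 0) :
    ∃ γ : ℝ → G, (∀ t u, γ (t + u) = γ t * γ u) ∧ ContMDiff 𝓘(ℝ, ℝ) (𝓡 n) ∞ γ ∧
      (∀ t, γ t ∈ S) ∧ γ 0 = 1 ∧ HasDerivAt (fun t => logChart n (γ t)) Y 0 := by
  refine exists_oneParameter_of_tendsto (l := 𝓝[>] (0 : ℝ)) (s := c) (τ := fun t => t) hS hc
    self_mem_nhdsWithin nhdsWithin_le_nhds ?_ ?_
  · rw [← hc0]; exact hcc.tendsto.mono_left nhdsWithin_le_nhds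
  · have := (hasDerivAt_iff_tendsto_slope_zero.1 hY).mono_left
      (nhdsGT_le_nhdsNE (0 : ℝ))
    simpa [hc0] using this

theorem lieSubspace_top : lieSubspace n (⊤ : Subgroup G) = ⊤ := by
  rw [Submodule.eq_top_iff']
  intro X
  have ht : Tendsto (fun t : ℝ => t • X) (𝓝 0) (𝓝 0) :=
    Continuous.tendsto' (by fun_prop) _ _ (by simp)
  obtain ⟨γ, -, h⟩ := exists_oneParameter_of_curve (S := (⊤ : Subgroup G)) (by simp)
    (c := fun t => expChart n G (t • X)) (Y := X) (by simp) (by simp)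
    (by
      have := (tendsto_expChart n (G := G)).comp ht
      simpa [ContinuousAt, Function.comp_def] using this)
    (by
      have h1 : HasDerivAt (fun t : ℝ => t • X) X 0 := by
        simpa using (hasDerivAt_id (0 : ℝ)).smul_const X
      exact h1.congr_of_eventuallyEq (ht.eventually (eventually_logChart_expChart n)))
  exact mem_lieSubspace.2 ⟨γ, h⟩

/-- A common tangent vector is the velocity of a one-parameter subgroup in S₁ and of one in S₂;
uniqueness makes them equal, hence contained in the intersection. -/
theorem lieSubspace_inf_le {S₁ S₂ : Subgroup G} (h₁ : IsClosed (S₁ : Set G))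
    (h₂ : IsClosed (S₂ : Set G)) :
    lieSubspace n S₁ ⊓ lieSubspace n S₂ ≤ lieSubspace n (S₁ ⊓ S₂) := by
  rintro X ⟨hX₁, hX₂⟩
  have key {S : Subgroup G} (hS : IsClosed (S : Set G)) (hX : X ∈ lieSubspace n S) :
      ∃ γ : ℝ → G, (∀ t u, γ (t + u) = γ t * γ u) ∧ ContMDiff 𝓘(ℝ, ℝ) (𝓡 n) ∞ γ ∧
      (∀ t, γ t ∈ S) ∧ γ 0 = 1 ∧ HasDerivAt (fun t => logChart n (γ t)) X 0 := by
    obtain ⟨c, h1, h2, h3, h4⟩ := mem_lieSubspace.1 hX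
    exact exists_oneParameter_of_curve hS (.of_forall h2) h3 h1.continuous.continuousAt h4
  obtain ⟨γ₁, a₁, b₁, c₁, d₁, e₁⟩ := key h₁ hX₁
  obtain ⟨γ₂, a₂, b₂, c₂, d₂, e₂⟩ := key h₂ hX₂
  have := oneParameter_unique a₁ a₂ d₁ d₂ b₁ b₂
    (((velocity_eq_iff d₁ b₁).2 e₁).trans ((velocity_eq_iff d₂ b₂).2 e₂).symm)
  subst this
  exact mem_lieSubspace.2 ⟨γ₁, b₁, fun t => ⟨c₁ t, c₂ t⟩, d₁, e₁⟩

end ClosedSubgroup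

/-! ### Product coordinates on a Lie group and Cartan's theorem -/

section Parametrization

open Filter Topology Set Metric

variable {n : ℕ} {G : Type*} [TopologicalSpace G] [ChartedSpace (EuclideanSpace ℝ (Fin n)) G]
  [Group G] [LieGroup (𝓡 n) ∞ G]

/-- Multiplication in the chart is the identity on each axis near 0, so both partial derivatives are
the identity. -/
theorem hasFDerivAt_mulChart_zero : HasFDerivAt (mulChart n G)
    (ContinuousLinearMap.fst ℝ (EuclideanSpace ℝ (Fin n)) (EuclideanSpace ℝ (Fin n)) +
      ContinuousLinearMap.snd ℝ _ _) 0 := by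
  have h := ((eventually_contDiffAt_mulChart n (G := G)).self_of_nhds.differentiableAt
    (by simp)).hasFDerivAt
  have h1 : (fderiv ℝ (mulChart n G) 0).comp (ContinuousLinearMap.inl ℝ _ _) =
      ContinuousLinearMap.id ℝ _ := by
    have := h.comp (0 : EuclideanSpace ℝ (Fin n)) (f := fun x => (x, 0)) (hasFDerivAt_prodMk_left 0 0)
    exact this.unique ((hasFDerivAt_id _).congr_of_eventuallyEq
      (eventually_mulChart_zero_right n (G := G)))
  have h2 : (fderiv ℝ (mulChart n G) 0).comp (ContinuousLinearMap.inr ℝ _ _) =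
      ContinuousLinearMap.id ℝ _ := by
    have := h.comp (0 : EuclideanSpace ℝ (Fin n)) (f := fun x => (0, x)) (hasFDerivAt_prodMk_right 0 0)
    exact this.unique ((hasFDerivAt_id _).congr_of_eventuallyEq
      (eventually_mulChart_zero_left n (G := G)))
  refine h.congr_fderiv (ContinuousLinearMap.ext fun p => ?_)
  have e1 := DFunLike.congr_fun h1 p.1
  have e2 := DFunLike.congr_fun h2 p.2
  simp only [ContinuousLinearMap.comp_apply, ContinuousLinearMap.inl_apply,
    ContinuousLinearMap.inr_apply, ContinuousLinearMap.id_apply] at e1 e2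
  have : p = (p.1, 0) + (0, p.2) := by simp
  conv_lhs => rw [this, map_add, e1, e2]
  rfl

/-- A product of maps into a Lie group has the sum of their derivatives, at the identity. -/
theorem HasFDerivAt.logChart_mul {V : Type*} [NormedAddCommGroup V] [NormedSpace ℝ V]
    {f g : V → G} {v : V} {f' g' : V →L[ℝ] EuclideanSpace ℝ (Fin n)} (hf1 : f v = 1) (hg1 : g v = 1)
    (hfc : ContinuousAt f v) (hgc : ContinuousAt g v)
    (hf : HasFDerivAt (fun x => logChart n (f x)) f' v)
    (hg : HasFDerivAt (fun x => logChart n (g x)) g' v) :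
    HasFDerivAt (fun x => logChart n (f x * g x)) (f' + g') v := by
  have h0 : HasFDerivAt (mulChart n G)
      (ContinuousLinearMap.fst ℝ (EuclideanSpace ℝ (Fin n)) (EuclideanSpace ℝ (Fin n)) +
      ContinuousLinearMap.snd ℝ _ _) (logChart n (f v), logChart n (g v)) := by
    rw [hf1, hg1, logChart_one]; exact hasFDerivAt_mulChart_zero
  have h := h0.comp v (hf.prodMk hg)
  refine HasFDerivAt.congr_of_eventuallyEq (h.congr_fderiv ?_) ?_
  · ext1 x; simp
  · have hfl : Tendsto f (𝓝 v) (𝓝 1) := by rw [← hf1]; exact hfc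
    have hgl : Tendsto g (𝓝 v) (𝓝 1) := by rw [← hg1]; exact hgc
    filter_upwards [hfl.eventually (eventually_expChart_logChart n),
      hgl.eventually (eventually_expChart_logChart n)] with x h1 h2
    simp [mulChart, h1, h2]

theorem HasFDerivAt.logChart_mul_prod {V W : Type*} [NormedAddCommGroup V] [NormedSpace ℝ V]
    [NormedAddCommGroup W] [NormedSpace ℝ W] {f : V → G} {g : W → G}
    {f' : V →L[ℝ] EuclideanSpace ℝ (Fin n)} {g' : W →L[ℝ] EuclideanSpace ℝ (Fin n)}
    (hf1 : f 0 = 1) (hg1 : g 0 = 1) (hfc : ContinuousAt f 0) (hgc : ContinuousAt g 0)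
    (hf : HasFDerivAt (fun x => logChart n (f x)) f' 0)
    (hg : HasFDerivAt (fun x => logChart n (g x)) g' 0) :
    HasFDerivAt (fun x : V × W => logChart n (f x.1 * g x.2)) (f'.coprod g') 0 :=
  HasFDerivAt.logChart_mul (f := fun x : V × W => f x.1) (g := fun x : V × W => g x.2)
    (v := (0 : V × W)) hf1 hg1 (hfc.comp (f := Prod.fst) (x := (0 : V × W)) continuousAt_fst)
    (hgc.comp (f := Prod.snd) (x := (0 : V × W)) continuousAt_snd)
    (HasFDerivAt.comp (f := Prod.fst) (0 : V × W) hf hasFDerivAt_fst)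
    (HasFDerivAt.comp (f := Prod.snd) (0 : V × W) hg hasFDerivAt_snd)

/-- A subspace of the Lie algebra is the derivative of a smooth map into the subgroup. -/
theorem exists_contMDiff_of_range_le {V : Type*} [NormedAddCommGroup V] [NormedSpace ℝ V]
    [FiniteDimensional ℝ V] {S : Subgroup G} (T : V →L[ℝ] EuclideanSpace ℝ (Fin n))
    (hT : ∀ v, T v ∈ lieSubspace n S) :
    ∃ f : V → G, ContMDiff 𝓘(ℝ, V) (𝓡 n) ∞ f ∧ (∀ v, f v ∈ S) ∧ f 0 = 1 ∧
      HasFDerivAt (fun v => logChart n (f v)) T 0 := by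
  let b := Module.finBasis ℝ V
  choose γ h1 h2 h3 h4 using fun i => mem_lieSubspace.1 (hT (b i))
  let c (i) : V →L[ℝ] ℝ := LinearMap.toContinuousLinearMap (b.coord i)
  -- Coordinates of the second kind: one factor γᵢ(cᵢ(v)) for each basis vector, whose derivatives
  -- at 0 add up.
  have key (t : Finset (Fin (Module.finrank ℝ V))) : ∃ f : V → G, ContMDiff 𝓘(ℝ, V) (𝓡 n) ∞ f ∧
      (∀ v, f v ∈ S) ∧ f 0 = 1 ∧
      HasFDerivAt (fun v => logChart n (f v)) (∑ i ∈ t, (c i).smulRight (T (b i))) 0 := by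
    induction t using Finset.induction_on with
    | empty =>
      refine ⟨fun _ => 1, contMDiff_const, fun _ => S.one_mem, rfl, ?_⟩
      simpa using hasFDerivAt_const (0 : EuclideanSpace ℝ (Fin n)) (0 : V)
    | insert i t hi ih =>
      obtain ⟨f, f1, f2, f3, f4⟩ := ih
      have hs : ContMDiff 𝓘(ℝ, V) (𝓡 n) ∞ (fun v => γ i (c i v)) :=
        (h1 i).comp (c i).contDiff.contMDiff
      have e1 : γ i (c i 0) = 1 := by rw [map_zero, h3]
      refine ⟨fun v => γ i (c i v) * f v, hs.mul f1, fun v => S.mul_mem (h2 i _) (f2 v),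
        by simp only [e1, f3, one_mul], ?_⟩
      rw [Finset.sum_insert hi]
      refine HasFDerivAt.logChart_mul e1 f3 hs.continuous.continuousAt f1.continuous.continuousAt
        ?_ f4
      have hd : HasDerivAt (fun t => logChart n (γ i t)) (T (b i)) (c i 0) := by
        rw [map_zero]; exact h4 i
      refine (hd.hasFDerivAt.comp (0 : V) (c i).hasFDerivAt).congr_fderiv ?_
      ext1 v
      simp
  obtain ⟨f, f1, f2, f3, f4⟩ := key Finset.univ
  refine ⟨f, f1, f2, f3, f4.congr_fderiv ?_⟩
  ext1 v
  conv_rhs => rw [← b.sum_repr v, map_sum]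
  simp [c, sum_apply]

/-- The inverse function theorem for maps into a Lie group. -/
theorem exists_openPartialHomeomorph_of_hasFDerivAt {V : Type*} [NormedAddCommGroup V]
    [NormedSpace ℝ V] [FiniteDimensional ℝ V] {f : V → G} (hf : ContMDiff 𝓘(ℝ, V) (𝓡 n) ∞ f)
    (h1 : f 0 = 1) (T : V ≃L[ℝ] EuclideanSpace ℝ (Fin n))
    (hT : HasFDerivAt (fun v => logChart n (f v)) (T : V →L[ℝ] EuclideanSpace ℝ (Fin n)) 0) :
    ∃ Θ : OpenPartialHomeomorph V G, (∀ v ∈ Θ.source, Θ v = f v) ∧ 0 ∈ Θ.source ∧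
      ContMDiffOn (𝓡 n) 𝓘(ℝ, V) ∞ Θ.symm Θ.target := by
  have : CompleteSpace V := FiniteDimensional.complete ℝ V
  set φ := chartAt (EuclideanSpace ℝ (Fin n)) (1 : G) with hφ
  let g : V → EuclideanSpace ℝ (Fin n) := fun v => φ (f v)
  have hg : ∀ v, f v ∈ φ.source → ContDiffAt ℝ ∞ g v := by
    intro v hv
    have := (contMDiffAt_of_mem_maximalAtlas (n := ∞)
      (IsManifold.chart_mem_maximalAtlas (I := 𝓡 n) (1 : G)) hv).comp v hf.contMDiffAt
    exact this.contDiffAt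
  have hgl : (fun v => logChart n (f v)) = fun v => g v - φ 1 := by
    ext v; simp [logChart, g, hφ, extChartAt]
  have hgT : HasFDerivAt g (T : V →L[ℝ] EuclideanSpace ℝ (Fin n)) 0 := by
    rw [hgl] at hT
    simpa using hT.add_const (φ 1)
  have h0 : f 0 ∈ φ.source := by rw [h1]; exact mem_chart_source _ _
  let h := (hg 0 h0).toOpenPartialHomeomorph g hgT (by simp)
  have hh : ∀ v, h v = g v := fun v => rfl
  have hh0 : 0 ∈ h.source := (hg 0 h0).mem_toOpenPartialHomeomorph_source hgT (by simp)
  -- Smoothness of the inverse on the whole target needs an invertible derivative at every point of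
  -- the source; invertibility is an open condition, so shrinking suffices.
  have hev : ∀ᶠ v in 𝓝 (0 : V), f v ∈ φ.source ∧
      fderiv ℝ g v ∈ range ((↑) : (V ≃L[ℝ] EuclideanSpace ℝ (Fin n)) → _) := by
    refine Filter.Eventually.and (hf.continuous.continuousAt.eventually_mem
      (φ.open_source.mem_nhds h0)) ?_
    refine ((hg 0 h0).fderiv_right (m := 0) (by simp)).continuousAt.eventually_mem ?_
    rw [hgT.fderiv]
    exact ContinuousLinearEquiv.nhds T
  obtain ⟨U, hU, hUo, hU0⟩ := _root_.eventually_nhds_iff.1 hev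
  let Θ := (h.restrOpen U hUo).trans φ.symm
  have hs : ∀ v, v ∈ Θ.source → v ∈ h.source ∧ v ∈ U := by
    intro v hv
    simp only [Θ, OpenPartialHomeomorph.trans_source, OpenPartialHomeomorph.restrOpen_source] at hv
    exact hv.1
  have hΘ : ∀ v ∈ Θ.source, Θ v = f v := fun v hv => φ.left_inv (hU v (hs v hv).2).1
  refine ⟨Θ, hΘ, ?_, ?_⟩
  · simp only [Θ, OpenPartialHomeomorph.trans_source, OpenPartialHomeomorph.restrOpen_source]
    exact ⟨⟨hh0, hU0⟩, φ.map_source h0⟩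
  · intro y hy
    have hv := Θ.map_target hy
    set v := Θ.symm y with hvdef
    have hyv : y = f v := by rw [← hΘ v hv, hvdef, Θ.right_inv hy]
    obtain ⟨hv1, hv2⟩ := hs v hv
    obtain ⟨T', hT'⟩ := (hU v hv2).2
    have hys : y ∈ φ.source := hyv ▸ (hU v hv2).1
    have c1 : ContDiffAt ℝ ∞ h.symm (φ y) := by
      have e : h.symm (φ y) = v := by
        rw [hyv]; exact h.left_inv hv1
      refine h.contDiffAt_symm (f₀' := T') ?_ ?_ ?_
      · rw [hyv]; exact h.map_source hv1
      · rw [e, hT']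
        exact ((hg v (hU v hv2).1).differentiableAt (by simp)).hasFDerivAt
      · rw [e]; exact hg v (hU v hv2).1
    have c2 := c1.contMDiffAt.comp y (contMDiffAt_of_mem_maximalAtlas (n := ∞)
      (IsManifold.chart_mem_maximalAtlas (I := 𝓡 n) (1 : G)) hys)
    exact c2.contMDiffWithinAt

variable [CompactSpace G] [T2Space G]

/-- Cartan's theorem: a map into a closed subgroup whose derivative is onto the Lie algebra
covers a neighbourhood of the identity in the subgroup. -/
theorem eventually_mem_image_of_isClosed {P : Type*} [NormedAddCommGroup P] [NormedSpace ℝ P]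
    [FiniteDimensional ℝ P] {S : Subgroup G} (hS : IsClosed (S : Set G)) {Ψ : P → G}
    (hΨ : ContMDiff 𝓘(ℝ, P) (𝓡 n) ∞ Ψ) (hΨS : ∀ p, Ψ p ∈ S) (h1 : Ψ 0 = 1)
    {T : P →L[ℝ] EuclideanSpace ℝ (Fin n)} (hT : HasFDerivAt (fun p => logChart n (Ψ p)) T 0)
    (hinj : Function.Injective T) (hrange : T.range = lieSubspace n S) {N : Set P}
    (hN : N ∈ 𝓝 0) : ∀ᶠ g in 𝓝 (1 : G), g ∈ S → g ∈ Ψ '' N := by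
  obtain ⟨C, hC⟩ := Submodule.exists_isCompl (lieSubspace n S)
  obtain ⟨e, e1, -, e3, e4⟩ := exists_contMDiff_of_range_le (S := (⊤ : Subgroup G)) C.subtypeL
    (by simp [lieSubspace_top])
  let f : P × C → G := fun p => Ψ p.1 * e p.2
  have hf : ContMDiff 𝓘(ℝ, P × C) (𝓡 n) ∞ f :=
    (hΨ.comp contDiff_fst.contMDiff).mul (e1.comp contDiff_snd.contMDiff)
  have hf1 : f 0 = 1 := by simp [f, h1, e3]
  have hfT : HasFDerivAt (fun p => logChart n (f p)) (T.coprod C.subtypeL) 0 :=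
    HasFDerivAt.logChart_mul_prod h1 e3 hΨ.continuous.continuousAt e1.continuous.continuousAt hT e4

  have hbij : Function.Bijective (T.coprod C.subtypeL) := by
    rw [← ContinuousLinearMap.coe_coe, ContinuousLinearMap.coe_coprod]
    constructor
    · refine LinearMap.ker_eq_bot.1 ?_
      rw [LinearMap.ker_coprod_of_disjoint_range]
      · simp [LinearMap.ker_eq_bot.2 hinj]
      · have := hC.disjoint; rw [← hrange] at this; simpa using this
    · refine LinearMap.range_eq_top.1 ?_
      rw [LinearMap.range_coprod]
      have := hC.sup_eq_top; rw [← hrange] at this; simpa using this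
  let T' : (P × C) ≃L[ℝ] EuclideanSpace ℝ (Fin n) :=
    (LinearEquiv.ofBijective (T.coprod C.subtypeL).toLinearMap hbij).toContinuousLinearEquiv
  obtain ⟨Θ, hΘ, hΘ0, -⟩ := exists_openPartialHomeomorph_of_hasFDerivAt hf hf1 T' hfT
  have hΘ1 : Θ 0 = 1 := by rw [hΘ 0 hΘ0, hf1]
  have ht1 : (1 : G) ∈ Θ.target := by rw [← hΘ1]; exact Θ.map_source hΘ0
  have hsymm : Tendsto Θ.symm (𝓝 1) (𝓝 0) := by
    have := (Θ.continuousAt_symm ht1).tendsto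
    have h0 : Θ.symm 1 = 0 := by rw [← hΘ1, Θ.left_inv hΘ0]
    rwa [h0] at this
  -- Otherwise elements g of S accumulate at 1 outside Ψ(N). Their transverse coordinates c(g) in C
  -- are nonzero with e(c(g)) in S, and a limit direction of c(g) would be a unit vector of C lying
  -- in the Lie algebra of S.
  by_contra hcon
  have hfr : ∃ᶠ g in 𝓝 (1 : G), g ∈ S ∧ g ∉ Ψ '' N := by
    refine (Filter.not_eventually.1 hcon).mono fun g hg => ?_
    exact Classical.not_imp.1 hg
  have hmem : ∀ᶠ g in 𝓝 (1 : G), g ∈ Θ.target ∧ (Θ.symm g).1 ∈ N :=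
    (Θ.open_target.mem_nhds ht1 |> fun h => Filter.Eventually.and h
      (hsymm.eventually ((continuous_fst.tendsto' _ _ rfl).eventually hN)))
  let l := 𝓝 (1 : G) ⊓ 𝓟 {g | g ∈ S ∧ g ∉ Ψ '' N}
  have hl : l.NeBot := Filter.frequently_mem_iff_neBot.1 hfr
  let U := Ultrafilter.of l
  have hUl : (U : Filter G) ≤ l := Ultrafilter.of_le l
  have hU1 : (U : Filter G) ≤ 𝓝 1 := hUl.trans inf_le_left
  have hUS : ∀ᶠ g in (U : Filter G), g ∈ S ∧ g ∉ Ψ '' N :=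
    hUl (inf_le_right (a := 𝓝 (1 : G)) (mem_principal_self _))
  let c : G → C := fun g => (Θ.symm g).2
  have hfg : ∀ g ∈ Θ.target, Ψ (Θ.symm g).1 * e (c g) = g := fun g hg => by
    have := hΘ _ (Θ.map_target hg)
    rw [Θ.right_inv hg] at this
    exact this.symm
  have hc0 : Tendsto c U (𝓝 0) :=
    (continuous_snd.tendsto' (0 : P × C) _ rfl).comp (hsymm.mono_left hU1)
  have hcne : ∀ᶠ g in (U : Filter G), c g ≠ 0 ∧ e (c g) ∈ S := by
    filter_upwards [hUS, hU1 hmem] with g ⟨hg1, hg2⟩ ⟨hg3, hg4⟩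
    have := hfg g hg3
    constructor
    · intro hc
      rw [hc, e3, mul_one] at this
      exact hg2 ⟨_, hg4, this⟩
    · rw [← this] at hg1
      exact (S.mul_mem_cancel_left (hΨS _)).1 hg1
  let u : G → C := fun g => ‖c g‖⁻¹ • c g
  have hu : ∀ᶠ g in (U : Filter G), u g ∈ sphere (0 : C) 1 := by
    filter_upwards [hcne] with g hg
    simp [u, norm_smul, hg.1]
  obtain ⟨Y, hY1, hY⟩ := (isCompact_sphere (0 : C) 1).ultrafilter_le_nhds (U.map u)
    (Filter.le_principal_iff.2 hu)
  -- In the chart e is the inclusion of C up to o(‖c‖), so rescaling by ‖c‖⁻¹ retains only the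
  -- direction.
  have hYl : Tendsto (fun g => (‖c g‖)⁻¹ • logChart n (e (c g))) U (𝓝 (Y : EuclideanSpace ℝ (Fin n))) := by
    have h2 : (fun x : C => logChart n (e x) - (x : EuclideanSpace ℝ (Fin n))) =o[𝓝 0]
        fun x => x := by
      simpa [e3] using e4.isLittleO
    have h3 : Tendsto (fun g => ‖c g‖⁻¹ • (logChart n (e (c g)) -
        (c g : EuclideanSpace ℝ (Fin n)))) U (𝓝 0) :=
      (h2.comp_tendsto hc0).norm_right.tendsto_inv_smul_nhds_zero
    have h5 : Tendsto (fun g => (u g : EuclideanSpace ℝ (Fin n))) U (𝓝 Y) :=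
      (continuous_subtype_val.tendsto Y).comp hY
    refine (zero_add (Y : EuclideanSpace ℝ (Fin n)) ▸ h3.add h5).congr fun g => ?_
    simp [u, smul_sub]
  obtain ⟨γ, -, γ1, γ2, γ3, γ4⟩ := exists_oneParameter_of_tendsto hS (l := (U : Filter G))
    (s := fun g => e (c g)) (τ := fun g => ‖c g‖) (hcne.mono fun g hg => hg.2)
    (hcne.mono fun g hg => norm_pos_iff.2 hg.1) (by simpa using hc0.norm)
    (by have := e1.continuous.continuousAt.tendsto.comp hc0; rwa [e3] at this) hYl
  have hYS : (Y : EuclideanSpace ℝ (Fin n)) ∈ lieSubspace n S :=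
    mem_lieSubspace.2 ⟨γ, γ1, γ2, γ3, γ4⟩
  have := Submodule.disjoint_def.1 hC.disjoint _ hYS Y.2
  have hY0 : Y = 0 := Subtype.ext this
  simp [hY0] at hY1

end Parametrization

/-! ## Manifolds with a transitive group of chart translations -/

section TranslateChart

open Topology Set

variable {Γ M E : Type*} [Group Γ] [TopologicalSpace M] [MulAction Γ M] [ContinuousConstSMul Γ M]
  [NormedAddCommGroup E] [NormedSpace ℝ E]

/-- The translate of a chart by a group element. -/
noncomputable def translateChart (ξ : OpenPartialHomeomorph M E) (k : Γ) :
    OpenPartialHomeomorph M E :=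
  (Homeomorph.smul k⁻¹).toOpenPartialHomeomorph.trans ξ

@[simp] theorem translateChart_apply (ξ : OpenPartialHomeomorph M E) (k : Γ) (y : M) :
    translateChart ξ k y = ξ (k⁻¹ • y) := rfl

@[simp] theorem translateChart_symm_apply (ξ : OpenPartialHomeomorph M E) (k : Γ) (a : E) :
    (translateChart ξ k).symm a = k • ξ.symm a := by
  have : (translateChart ξ k).symm a = (k⁻¹)⁻¹ • ξ.symm a := rfl
  rw [this, inv_inv]

@[simp] theorem mem_translateChart_source (ξ : OpenPartialHomeomorph M E) (k : Γ) (y : M) :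
    y ∈ (translateChart ξ k).source ↔ k⁻¹ • y ∈ ξ.source := by
  simp [translateChart]

@[simp] theorem translateChart_target (ξ : OpenPartialHomeomorph M E) (k : Γ) :
    (translateChart ξ k).target = ξ.target := by
  simp [translateChart]

/-- The charted space structure given by the translates of one chart. -/
@[reducible] noncomputable def translateChartedSpace (ξ : OpenPartialHomeomorph M E) (rep : M → Γ)
    (hrep : ∀ y, (rep y)⁻¹ • y ∈ ξ.source) : ChartedSpace E M where
  atlas := range (translateChart ξ : Γ → OpenPartialHomeomorph M E)
  chartAt y := translateChart ξ (rep y)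
  mem_chart_source y := by simpa using hrep y
  chart_mem_atlas y := mem_range_self _

variable {ξ : OpenPartialHomeomorph M E} {rep : M → Γ} {hrep : ∀ y, (rep y)⁻¹ • y ∈ ξ.source}

/-- The transition between the translates by k and k' is ξ ∘ (k'⁻¹k) ∘ ξ⁻¹, so the hypothesis covers
all of them. -/
theorem isManifold_translateChartedSpace
    (h : ∀ k : Γ, ContDiffOn ℝ ∞ (fun a => ξ (k • ξ.symm a))
      {a | a ∈ ξ.target ∧ k • ξ.symm a ∈ ξ.source}) :
    let _ := translateChartedSpace ξ rep hrep
    IsManifold 𝓘(ℝ, E) ∞ M := by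
  intro _
  refine isManifold_of_contDiffOn _ _ _ ?_
  rintro _ _ ⟨k, rfl⟩ ⟨k', rfl⟩
  refine ((h (k'⁻¹ * k)).mono ?_).congr ?_
  · rintro a ⟨⟨h1, h2⟩, -⟩
    refine ⟨by simpa using h1, ?_⟩
    simpa [mul_smul] using h2
  · rintro a -
    simp [mul_smul]

theorem translateChart_mem_maximalAtlas
    (h : ∀ k : Γ, ContDiffOn ℝ ∞ (fun a => ξ (k • ξ.symm a))
      {a | a ∈ ξ.target ∧ k • ξ.symm a ∈ ξ.source}) (k : Γ) :
    let _ := translateChartedSpace ξ rep hrep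
    translateChart ξ k ∈ IsManifold.maximalAtlas 𝓘(ℝ, E) ∞ M := by
  intro _
  have := isManifold_translateChartedSpace (rep := rep) (hrep := hrep) h
  exact IsManifold.subset_maximalAtlas (mem_range_self k)

/-- Read in the chart at y and its translate by k, the action of k is the identity. -/
theorem contMDiff_smul_translateChartedSpace
    (h : ∀ k : Γ, ContDiffOn ℝ ∞ (fun a => ξ (k • ξ.symm a))
      {a | a ∈ ξ.target ∧ k • ξ.symm a ∈ ξ.source}) (k : Γ) :
    let _ := translateChartedSpace ξ rep hrep
    ContMDiff 𝓘(ℝ, E) 𝓘(ℝ, E) ∞ (fun y : M => k • y) := by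
  intro _ y
  have := isManifold_translateChartedSpace (rep := rep) (hrep := hrep) h
  have h1 : ContMDiffAt 𝓘(ℝ, E) 𝓘(ℝ, E) ∞ (translateChart ξ (rep y)) y :=
    contMDiffAt_of_mem_maximalAtlas
      (translateChart_mem_maximalAtlas (rep := rep) (hrep := hrep) h _) (by simpa using hrep y)
  have h2 : ContMDiffAt 𝓘(ℝ, E) 𝓘(ℝ, E) ∞ (translateChart ξ (k * rep y)).symm
      (translateChart ξ (rep y) y) :=
    contMDiffAt_symm_of_mem_maximalAtlas
      (translateChart_mem_maximalAtlas (rep := rep) (hrep := hrep) h _)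
      (by simpa using ξ.map_source (hrep y))
  refine (h2.comp y h1).congr_of_eventuallyEq ?_
  filter_upwards [(translateChart ξ (rep y)).open_source.mem_nhds
    ((mem_translateChart_source _ _ _).2 (hrep y))] with z hz
  rw [mem_translateChart_source] at hz
  simp [mul_smul, ξ.left_inv hz]

end TranslateChart

/-! ## Closed subgroups and their coset spaces as manifolds -/

section AdaptedChart

open Topology Set Manifold

/-- A parametrization of a Lie group near the identity adapted to subgroups `L ⊆ K`: the first two
factors parametrize `K`, and the first factor parametrizes `K/L`. -/
structure AdaptedChart (n : ℕ) {G : Type*} [TopologicalSpace G]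
    [ChartedSpace (EuclideanSpace ℝ (Fin n)) G] [Group G] (K L : Subgroup G) (A B C : Type*)
    [NormedAddCommGroup A] [NormedSpace ℝ A] [NormedAddCommGroup B] [NormedSpace ℝ B]
    [NormedAddCommGroup C] [NormedSpace ℝ C] where
  Θ : OpenPartialHomeomorph ((A × B) × C) G
  UA : Set A
  UB : Set B
  UC : Set C
  openA : IsOpen UA
  openB : IsOpen UB
  zeroA : 0 ∈ UA
  zeroB : 0 ∈ UB
  zeroC : 0 ∈ UC
  source_eq : Θ.source = (UA ×ˢ UB) ×ˢ UC
  map_zero : Θ 0 = 1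
  contMDiffOn : ContMDiffOn 𝓘(ℝ, (A × B) × C) (𝓡 n) ∞ Θ Θ.source
  contMDiffOn_symm : ContMDiffOn (𝓡 n) 𝓘(ℝ, (A × B) × C) ∞ Θ.symm Θ.target
  mem_iff : ∀ p ∈ Θ.source, Θ p ∈ K ↔ p.2 = 0
  coset_iff : ∀ p ∈ Θ.source, ∀ q ∈ Θ.source, p.2 = 0 → q.2 = 0 →
    ((Θ p)⁻¹ * Θ q ∈ L ↔ p.1.1 = q.1.1)

variable {n : ℕ} {G : Type*} [TopologicalSpace G] [ChartedSpace (EuclideanSpace ℝ (Fin n)) G]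
  [Group G] [IsTopologicalGroup G] {K L : Subgroup G} {A B C : Type*}
  [NormedAddCommGroup A] [NormedSpace ℝ A] [NormedAddCommGroup B] [NormedSpace ℝ B]
  [NormedAddCommGroup C] [NormedSpace ℝ C]

namespace AdaptedChart

section Basic

variable (D : AdaptedChart n K L A B C)

theorem mem_source {a : A} {b : B} (ha : a ∈ D.UA) (hb : b ∈ D.UB) : ((a, b), (0 : C)) ∈ D.Θ.source := by
  rw [D.source_eq]; exact ⟨⟨ha, hb⟩, D.zeroC⟩

theorem mem_K {a : A} {b : B} (ha : a ∈ D.UA) (hb : b ∈ D.UB) : D.Θ ((a, b), 0) ∈ K :=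
  (D.mem_iff _ (D.mem_source ha hb)).2 rfl

theorem symm_mem {g : G} (hg : g ∈ D.Θ.target) :
    (D.Θ.symm g).1.1 ∈ D.UA ∧ (D.Θ.symm g).1.2 ∈ D.UB := by
  have := D.Θ.map_target hg
  rw [D.source_eq] at this
  exact this.1

theorem symm_snd {g : G} (hg : g ∈ D.Θ.target) (hK : g ∈ K) : (D.Θ.symm g).2 = 0 := by
  refine (D.mem_iff _ (D.Θ.map_target hg)).1 ?_
  rwa [D.Θ.right_inv hg]

theorem map_symm {g : G} (hg : g ∈ D.Θ.target) (hK : g ∈ K) : D.Θ ((D.Θ.symm g).1, 0) = g := by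
  rw [← D.symm_snd hg hK]
  exact D.Θ.right_inv hg

open Classical in
/-- The parametrization of the subgroup. -/
noncomputable def param (p : A × B) : K := if h : D.Θ (p, 0) ∈ K then ⟨D.Θ (p, 0), h⟩ else 1

theorem coe_param {p : A × B} (ha : p.1 ∈ D.UA) (hb : p.2 ∈ D.UB) :
    (D.param p : G) = D.Θ (p, 0) := by
  rw [param, dif_pos (D.mem_K ha hb)]

/-- The chart of the subgroup at the identity. -/
noncomputable def chartSubgroup : OpenPartialHomeomorph K (A × B) where
  toFun g := (D.Θ.symm g).1
  invFun := D.param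
  source := {g | (g : G) ∈ D.Θ.target}
  target := D.UA ×ˢ D.UB
  map_source' g hg := D.symm_mem hg
  map_target' p hp := by
    change (D.param p : G) ∈ D.Θ.target
    rw [D.coe_param hp.1 hp.2]
    exact D.Θ.map_source (D.mem_source hp.1 hp.2)
  left_inv' g hg := by
    apply Subtype.ext
    rw [D.coe_param (D.symm_mem hg).1 (D.symm_mem hg).2, D.map_symm hg g.2]
  right_inv' p hp := by
    rw [D.coe_param hp.1 hp.2, D.Θ.left_inv (D.mem_source hp.1 hp.2)]
  open_source := D.Θ.open_target.preimage continuous_subtype_val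
  open_target := D.openA.prod D.openB
  continuousOn_toFun := by
    refine continuous_fst.comp_continuousOn ?_
    exact D.Θ.continuousOn_symm.comp continuous_subtype_val.continuousOn fun g hg => hg
  continuousOn_invFun := by
    rw [IsInducing.subtypeVal.continuousOn_iff]
    refine (D.Θ.continuousOn.comp (f := fun p : A × B => (p, (0 : C))) (by fun_prop) ?_).congr ?_
    · exact fun p hp => D.mem_source hp.1 hp.2
    · exact fun p hp => D.coe_param hp.1 hp.2

theorem mem_chartSubgroup_source {g : K} : g ∈ D.chartSubgroup.source ↔ (g : G) ∈ D.Θ.target :=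
  Iff.rfl

theorem chartSubgroup_apply (g : K) : D.chartSubgroup g = (D.Θ.symm g).1 := rfl

theorem one_mem_target : (1 : G) ∈ D.Θ.target := by
  rw [← D.map_zero]
  exact D.Θ.map_source (D.mem_source D.zeroA D.zeroB)

theorem one_mem_chartSubgroup_source : (1 : K) ∈ D.chartSubgroup.source := D.one_mem_target

theorem mk_eq_iff {g g' : K} (hg : g ∈ D.chartSubgroup.source) (hg' : g' ∈ D.chartSubgroup.source) :
    (QuotientGroup.mk g : CosetSpace K L) = QuotientGroup.mk g' ↔
      (D.chartSubgroup g).1 = (D.chartSubgroup g').1 := by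
  rw [QuotientGroup.eq, Subgroup.mem_subgroupOf]
  have := D.coset_iff _ (D.Θ.map_target hg) _ (D.Θ.map_target hg') (D.symm_snd hg g.2)
    (D.symm_snd hg' g'.2)
  rw [D.Θ.right_inv hg, D.Θ.right_inv hg'] at this
  exact this

open Classical in
/-- The coordinate of a coset near the base point. -/
noncomputable def cosetCoord (y : CosetSpace K L) : A :=
  if h : ∃ g ∈ D.chartSubgroup.source, (QuotientGroup.mk g : CosetSpace K L) = y then
    (D.chartSubgroup h.choose).1 else 0

theorem cosetCoord_mk {g : K} (hg : g ∈ D.chartSubgroup.source) :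
    D.cosetCoord (QuotientGroup.mk g : CosetSpace K L) = (D.chartSubgroup g).1 := by
  have h : ∃ g' ∈ D.chartSubgroup.source,
      (QuotientGroup.mk g' : CosetSpace K L) = QuotientGroup.mk g := ⟨g, hg, rfl⟩
  rw [cosetCoord, dif_pos h]
  exact (D.mk_eq_iff h.choose_spec.1 hg).1 h.choose_spec.2

theorem param_mem_source {p : A × B} (ha : p.1 ∈ D.UA) (hb : p.2 ∈ D.UB) :
    D.param p ∈ D.chartSubgroup.source := D.chartSubgroup.map_target ⟨ha, hb⟩

theorem chartSubgroup_param {p : A × B} (ha : p.1 ∈ D.UA) (hb : p.2 ∈ D.UB) :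
    D.chartSubgroup (D.param p) = p := D.chartSubgroup.right_inv ⟨ha, hb⟩

/-- The chart of the coset space at the base point. -/
noncomputable def chartCoset : OpenPartialHomeomorph (CosetSpace K L) A where
  toFun := D.cosetCoord
  invFun a := QuotientGroup.mk (D.param (a, 0))
  source := QuotientGroup.mk '' D.chartSubgroup.source
  target := D.UA
  map_source' := by
    rintro _ ⟨g, hg, rfl⟩
    rw [D.cosetCoord_mk hg]
    exact (D.symm_mem hg).1
  map_target' a ha := ⟨_, D.param_mem_source (p := (a, 0)) ha D.zeroB, rfl⟩
  left_inv' := by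
    rintro _ ⟨g, hg, rfl⟩
    have ha := (D.symm_mem hg).1
    rw [D.cosetCoord_mk hg, D.mk_eq_iff
      (D.param_mem_source (p := ((D.chartSubgroup g).1, 0)) ha D.zeroB) hg]
    rw [D.chartSubgroup_param (p := ((D.chartSubgroup g).1, 0)) ha D.zeroB]
  right_inv' a ha := by
    rw [D.cosetCoord_mk (D.param_mem_source (p := (a, 0)) ha D.zeroB),
      D.chartSubgroup_param (p := (a, 0)) ha D.zeroB]
  open_source := QuotientGroup.isOpenMap_coe _ D.chartSubgroup.open_source
  open_target := D.openA
  continuousOn_toFun := by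
    rintro _ ⟨g, hg, rfl⟩
    refine ContinuousAt.continuousWithinAt ?_
    have h1 : Filter.Tendsto (fun g : K => D.cosetCoord (QuotientGroup.mk g)) (𝓝 g)
        (𝓝 (D.chartSubgroup g).1) := by
      refine Filter.Tendsto.congr' ?_
        (continuous_fst.continuousAt.tendsto.comp (D.chartSubgroup.continuousAt hg))
      filter_upwards [D.chartSubgroup.open_source.mem_nhds hg] with g' hg'
      rw [D.cosetCoord_mk hg']
      rfl
    rw [ContinuousAt, D.cosetCoord_mk hg,
      ← QuotientGroup.isOpenQuotientMap_mk.map_nhds_eq (x := g)]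
    exact Filter.tendsto_map'_iff.2 h1
  continuousOn_invFun := by
    refine QuotientGroup.continuous_mk.comp_continuousOn ?_
    exact D.chartSubgroup.continuousOn_symm.comp (f := fun a : A => (a, (0 : B)))
      (by fun_prop) fun a ha => ⟨ha, D.zeroB⟩

theorem chartCoset_mk {g : K} (hg : g ∈ D.chartSubgroup.source) :
    D.chartCoset (QuotientGroup.mk g) = (D.chartSubgroup g).1 := D.cosetCoord_mk hg

theorem mk_mem_chartCoset_source {g : K} (hg : g ∈ D.chartSubgroup.source) :
    (QuotientGroup.mk g : CosetSpace K L) ∈ D.chartCoset.source := ⟨g, hg, rfl⟩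

end Basic

section Smooth

variable (D : AdaptedChart n K L A B C) [LieGroup (𝓡 n) ∞ G]

theorem contDiffOn_chartSubgroup (k : K) :
    ContDiffOn ℝ ∞ (fun a => D.chartSubgroup (k • D.chartSubgroup.symm a))
      {a | a ∈ D.chartSubgroup.target ∧ k • D.chartSubgroup.symm a ∈ D.chartSubgroup.source} := by
  rintro p ⟨hp, hk⟩
  have e : ∀ p ∈ D.chartSubgroup.target, ((k • D.chartSubgroup.symm p : K) : G) =
      k * D.Θ (p, 0) := fun p hp => by
    rw [← D.coe_param hp.1 hp.2]; rfl
  have hk' : (k : G) * D.Θ (p, 0) ∈ D.Θ.target := by rw [← e p hp]; exact hk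
  have h1 : ContMDiffAt 𝓘(ℝ, A × B) (𝓡 n) ∞ (fun p : A × B => (k : G) * D.Θ (p, 0)) p := by
    refine contMDiffAt_const.mul ?_
    have h2 : ContMDiffAt 𝓘(ℝ, (A × B) × C) (𝓡 n) ∞ D.Θ (p, 0) :=
      D.contMDiffOn.contMDiffAt (D.Θ.open_source.mem_nhds (D.mem_source hp.1 hp.2))
    have h3 : ContMDiffAt 𝓘(ℝ, A × B) 𝓘(ℝ, (A × B) × C) ∞ (fun p : A × B => (p, (0 : C))) p :=
      (contDiff_id.prodMk contDiff_const).contMDiff.contMDiffAt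
    exact h2.comp p h3
  have h4 := (D.contMDiffOn_symm.contMDiffAt (D.Θ.open_target.mem_nhds hk')).comp p h1
  have h5 : ContDiffAt ℝ ∞ (fun p : A × B => (D.Θ.symm ((k : G) * D.Θ (p, 0))).1) p :=
    contDiffAt_fst.comp p h4.contDiffAt
  refine (h5.contDiffWithinAt).congr (fun q hq => ?_) ?_
  · rw [chartSubgroup_apply, e q hq.1]
  · rw [chartSubgroup_apply, e p hp]

/-- The coset of k Θ(a, 0) can lie in the chart while this representative does not. Right
multiplication by a fixed l in L moves it into the domain of the group chart without changing
cosets, also for nearby a. -/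
theorem contDiffOn_chartCoset (k : K) :
    ContDiffOn ℝ ∞ (fun a => D.chartCoset (k • D.chartCoset.symm a))
      {a | a ∈ D.chartCoset.target ∧ k • D.chartCoset.symm a ∈ D.chartCoset.source} := by
  rintro a ⟨ha, g, hg, hgk⟩
  have hgk' : (QuotientGroup.mk (k * D.param (a, 0)) : CosetSpace K L) = QuotientGroup.mk g :=
    hgk.symm
  rw [QuotientGroup.eq] at hgk'
  set l := (k * D.param (a, 0))⁻¹ * g with hl
  have e : ∀ a ∈ D.UA, ((k * D.param (a, 0) * l : K) : G) = k * D.Θ ((a, 0), 0) * l :=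
    fun a ha => by rw [← D.coe_param (p := (a, 0)) ha D.zeroB]; rfl
  have hg' : (k : G) * D.Θ ((a, 0), 0) * l = g := by
    rw [← e a ha, hl, mul_inv_cancel_left]
  have h1 : ContMDiffAt 𝓘(ℝ, A) (𝓡 n) ∞ (fun a : A => (k : G) * D.Θ ((a, 0), 0) * l) a := by
    refine (contMDiffAt_const.mul ?_).mul contMDiffAt_const
    have h2 : ContMDiffAt 𝓘(ℝ, (A × B) × C) (𝓡 n) ∞ D.Θ ((a, 0), 0) :=
      D.contMDiffOn.contMDiffAt (D.Θ.open_source.mem_nhds (D.mem_source ha D.zeroB))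
    have h3 : ContMDiffAt 𝓘(ℝ, A) 𝓘(ℝ, (A × B) × C) ∞ (fun a : A => ((a, (0 : B)), (0 : C))) a :=
      ((contDiff_id.prodMk contDiff_const).prodMk contDiff_const).contMDiff.contMDiffAt
    exact h2.comp a h3
  have hgt : (k : G) * D.Θ ((a, 0), 0) * l ∈ D.Θ.target := by rw [hg']; exact hg
  have h4 := (D.contMDiffOn_symm.contMDiffAt (D.Θ.open_target.mem_nhds hgt)).comp a h1
  have h5 : ContDiffAt ℝ ∞ (fun a : A => (D.Θ.symm ((k : G) * D.Θ ((a, 0), 0) * l)).1.1) a :=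
    contDiffAt_fst.comp a (contDiffAt_fst.comp a h4.contDiffAt)
  refine (h5.congr_of_eventuallyEq ?_).contDiffWithinAt
  filter_upwards [h1.continuousAt.eventually_mem (D.Θ.open_target.mem_nhds hgt),
    D.openA.mem_nhds ha] with a' h6 h7
  have h8 : k * D.param (a', 0) * l ∈ D.chartSubgroup.source := by
    rw [mem_chartSubgroup_source, e a' h7]; exact h6
  have h9 : (k • D.chartCoset.symm a' : CosetSpace K L) =
      QuotientGroup.mk (k * D.param (a', 0) * l) := by
    change (QuotientGroup.mk (k * D.param (a', 0)) : CosetSpace K L) = _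
    rw [QuotientGroup.eq, inv_mul_cancel_left]
    exact hgk'
  rw [h9, D.chartCoset_mk h8, chartSubgroup_apply, e a' h7]

variable {k d : ℕ}

/-- The chart of the subgroup with values in the Euclidean space. -/
noncomputable def chartSubgroupE (e : EuclideanSpace ℝ (Fin k) ≃L[ℝ] A × B) :
    OpenPartialHomeomorph K (EuclideanSpace ℝ (Fin k)) :=
  D.chartSubgroup.transHomeomorph e.symm.toHomeomorph

theorem chartSubgroupE_symm_apply (e : EuclideanSpace ℝ (Fin k) ≃L[ℝ] A × B)
    (v : EuclideanSpace ℝ (Fin k)) : (D.chartSubgroupE e).symm v = D.param (e v) := rfl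

theorem mem_chartSubgroupE_target {e : EuclideanSpace ℝ (Fin k) ≃L[ℝ] A × B}
    {v : EuclideanSpace ℝ (Fin k)} :
    v ∈ (D.chartSubgroupE e).target ↔ (e v).1 ∈ D.UA ∧ (e v).2 ∈ D.UB := Iff.rfl

theorem contDiffOn_chartSubgroupE (e : EuclideanSpace ℝ (Fin k) ≃L[ℝ] A × B) (x : K) :
    ContDiffOn ℝ ∞ (fun a => D.chartSubgroupE e (x • (D.chartSubgroupE e).symm a))
      {a | a ∈ (D.chartSubgroupE e).target ∧
        x • (D.chartSubgroupE e).symm a ∈ (D.chartSubgroupE e).source} :=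
  e.symm.contDiff.comp_contDiffOn ((D.contDiffOn_chartSubgroup x).comp e.contDiff.contDiffOn
    fun _ hv => hv)

/-- The smooth structure of a subgroup. -/
@[reducible] noncomputable def chartedSpaceSubgroup (e : EuclideanSpace ℝ (Fin k) ≃L[ℝ] A × B) :
    ChartedSpace (EuclideanSpace ℝ (Fin k)) K :=
  translateChartedSpace (Γ := K) (D.chartSubgroupE e) id fun y => by
    change y⁻¹ * y ∈ D.chartSubgroup.source
    rw [inv_mul_cancel]
    exact D.one_mem_chartSubgroup_source

variable (D' : AdaptedChart n K L (EuclideanSpace ℝ (Fin d)) B C)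

/-- The smooth structure of a coset space. -/
@[reducible] noncomputable def chartedSpaceCoset :
    ChartedSpace (EuclideanSpace ℝ (Fin d)) (CosetSpace K L) :=
  translateChartedSpace (Γ := K) D'.chartCoset Quotient.out fun y => by
    have : (Quotient.out y)⁻¹ • y = (QuotientGroup.mk 1 : CosetSpace K L) := by
      have h : (Quotient.out y)⁻¹ • (QuotientGroup.mk (Quotient.out y) : CosetSpace K L) =
          QuotientGroup.mk ((Quotient.out y)⁻¹ * Quotient.out y) := rfl
      rwa [QuotientGroup.out_eq', inv_mul_cancel] at h
    rw [this]
    exact D'.mk_mem_chartCoset_source D'.one_mem_chartSubgroup_source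

/-- In the left translate of Θ⁻¹ to x, the inclusion of the subgroup reads v ↦ (v, 0). -/
theorem isSmoothEmbedding_val (e : EuclideanSpace ℝ (Fin k) ≃L[ℝ] A × B)
    (T : ((A × B) × C) ≃L[ℝ] EuclideanSpace ℝ (Fin n)) :
    let _ := D.chartedSpaceSubgroup e
    IsSmoothEmbedding (𝓡 k) (𝓡 n) ∞ (Subtype.val : K → G) := by
  intro _
  have hi : IsImmersionOfComplement C (𝓡 k) (𝓡 n) ∞ (Subtype.val : K → G) := by
    intro x
    let c : OpenPartialHomeomorph G (EuclideanSpace ℝ (Fin n)) :=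
      ((Homeomorph.mulLeft (x : G)⁻¹).toOpenPartialHomeomorph.trans D.Θ.symm).transHomeomorph
        T.toHomeomorph
    have hcs : ∀ g, g ∈ c.source ↔ (x : G)⁻¹ * g ∈ D.Θ.target := fun g => by simp [c]
    have hct : ∀ v, v ∈ c.target ↔ T.symm v ∈ D.Θ.source := fun v => by simp [c]
    have hca : ∀ g, c g = T (D.Θ.symm ((x : G)⁻¹ * g)) := fun g => rfl
    have hcsy : ∀ v, c.symm v = x * D.Θ (T.symm v) := fun v => by
      have : c.symm v = (x : G)⁻¹⁻¹ * D.Θ (T.symm v) := rfl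
      rw [this, inv_inv]
    refine IsImmersionAtOfComplement.mk_of_continuousAt continuous_subtype_val.continuousAt
      ((e.prodCongr (ContinuousLinearEquiv.refl ℝ C)).trans T)
      (translateChart (D.chartSubgroupE e) x) c ?_ ?_
      (translateChart_mem_maximalAtlas (D.contDiffOn_chartSubgroupE e) x) ?_ ?_
    · rw [mem_translateChart_source]
      change ((x⁻¹ * x : K) : G) ∈ D.Θ.target
      simpa using D.one_mem_target
    · rw [hcs]; simpa using D.one_mem_target
    · refine c.mem_maximalAtlas_of_contMDiffOn ?_ ?_
      · have h1 : ContMDiffOn (𝓡 n) (𝓡 n) ∞ (fun g : G => (x : G)⁻¹ * g) c.source :=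
          (contMDiff_const.mul contMDiff_id).contMDiffOn
        exact T.contDiff.contMDiff.comp_contMDiffOn
          (D.contMDiffOn_symm.comp h1 fun g hg => (hcs g).1 hg)
      · have h1 : ContMDiffOn (𝓡 n) (𝓡 n) ∞ (fun v => (x : G) * D.Θ (T.symm v)) c.target :=
          contMDiffOn_const.mul (D.contMDiffOn.comp T.symm.contDiff.contMDiff.contMDiffOn
            fun v hv => (hct v).1 hv)
        exact h1.congr fun v _ => hcsy v
    · intro v hv
      have hv' : v ∈ (D.chartSubgroupE e).target := by simpa using hv
      obtain ⟨ha, hb⟩ := D.mem_chartSubgroupE_target.1 hv'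
      simp only [Function.comp_apply, OpenPartialHomeomorph.extend_coe,
        OpenPartialHomeomorph.extend_coe_symm, modelWithCornersSelf_coe,
        modelWithCornersSelf_coe_symm, id, translateChart_symm_apply, hca]
      have h2 : ((x • (D.chartSubgroupE e).symm v : K) : G) = x * D.Θ (e v, 0) := by
        rw [← D.coe_param ha hb]; rfl
      rw [h2, inv_mul_cancel_left, D.Θ.left_inv (D.mem_source ha hb)]
      rfl
  exact ⟨hi.isImmersion, IsEmbedding.subtypeVal⟩

/-- In the charts translated to x, the projection to the coset space reads (a, b) ↦ a. -/
theorem isSubmersion_mk (e : EuclideanSpace ℝ (Fin k) ≃L[ℝ] EuclideanSpace ℝ (Fin d) × B) :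
    let _ := D'.chartedSpaceSubgroup e
    let _ := D'.chartedSpaceCoset
    IsSubmersion (𝓡 k) (𝓡 d) ∞ (QuotientGroup.mk : K → CosetSpace K L) := by
  intro _ _
  have hi : IsSubmersionOfComplement B (𝓡 k) (𝓡 d) ∞
      (QuotientGroup.mk : K → CosetSpace K L) := by
    intro x
    have h1 : x⁻¹ • (QuotientGroup.mk x : CosetSpace K L) = QuotientGroup.mk 1 := by
      change (QuotientGroup.mk (x⁻¹ * x) : CosetSpace K L) = _
      rw [inv_mul_cancel]
    refine IsSubmersionAtOfComplement.mk_of_continuousAt QuotientGroup.continuous_mk.continuousAt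
      e (translateChart (D'.chartSubgroupE e) x) (translateChart D'.chartCoset x) ?_ ?_
      (translateChart_mem_maximalAtlas (D'.contDiffOn_chartSubgroupE e) x)
      (translateChart_mem_maximalAtlas D'.contDiffOn_chartCoset x) ?_
    · rw [mem_translateChart_source]
      change ((x⁻¹ * x : K) : G) ∈ D'.Θ.target
      simpa using D'.one_mem_target
    · rw [mem_translateChart_source, h1]
      exact D'.mk_mem_chartCoset_source D'.one_mem_chartSubgroup_source
    · intro v hv
      have hv' : v ∈ (D'.chartSubgroupE e).target := by simpa using hv
      obtain ⟨ha, hb⟩ := D'.mem_chartSubgroupE_target.1 hv'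
      simp only [Function.comp_apply, OpenPartialHomeomorph.extend_coe,
        OpenPartialHomeomorph.extend_coe_symm, modelWithCornersSelf_coe,
        modelWithCornersSelf_coe_symm, id, translateChart_symm_apply, translateChart_apply]
      have h2 : x⁻¹ • (QuotientGroup.mk (x • (D'.chartSubgroupE e).symm v) : CosetSpace K L) =
          QuotientGroup.mk (D'.param (e v)) := by
        change (QuotientGroup.mk (x⁻¹ * (x * D'.param (e v))) : CosetSpace K L) = _
        rw [inv_mul_cancel_left]
      rw [h2, D'.chartCoset_mk (D'.param_mem_source ha hb), D'.chartSubgroup_param ha hb]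
  exact hi.isSubmersion

theorem isStandardSmoothStructure
    (e : EuclideanSpace ℝ (Fin k) ≃L[ℝ] EuclideanSpace ℝ (Fin d) × B)
    (T : ((EuclideanSpace ℝ (Fin d) × B) × C) ≃L[ℝ] EuclideanSpace ℝ (Fin n)) :
    let _ := D'.chartedSpaceSubgroup e
    let _ := D'.chartedSpaceCoset
    IsStandardSmoothStructure (n := n) (k := k) (d := d) K L := by
  intro _ _
  have hK : IsManifold (𝓡 k) ∞ K :=
    isManifold_translateChartedSpace (D'.contDiffOn_chartSubgroupE e)
  have hv := D'.isSmoothEmbedding_val e T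
  refine ⟨?_, hv, isManifold_translateChartedSpace D'.contDiffOn_chartCoset,
    D'.isSubmersion_mk e⟩
  -- A continuous map into K is smooth once its composite with the immersion K → G is; this reduces
  -- the group operations of K to those of G.
  exact
    { contMDiff_mul := (ContMDiff.iff_comp_isImmersion hv.isImmersion).2 ⟨continuous_mul, by
        exact (hv.contMDiff.comp contMDiff_fst).mul (hv.contMDiff.comp contMDiff_snd)⟩
      contMDiff_inv := (ContMDiff.iff_comp_isImmersion hv.isImmersion).2 ⟨continuous_inv, by
        exact hv.contMDiff.inv⟩ }

end Smooth

end AdaptedChart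

end AdaptedChart

/-! ### Existence of adapted charts; transversality from a product decomposition -/

section ExistsAdaptedChart

open Filter Topology Set

variable {n : ℕ} {G : Type*} [TopologicalSpace G] [ChartedSpace (EuclideanSpace ℝ (Fin n)) G]
  [Group G] [LieGroup (𝓡 n) ∞ G] [CompactSpace G] [T2Space G]

theorem ContinuousLinearMap.injective_coprod_subtypeL {E P : Type*} [NormedAddCommGroup E]
    [NormedSpace ℝ E] [NormedAddCommGroup P] [NormedSpace ℝ P] {T : P →L[ℝ] E}
    (hT : Function.Injective T) {W : Submodule ℝ E} (h : Disjoint T.range W) :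
    Function.Injective (T.coprod W.subtypeL) := by
  rw [← ContinuousLinearMap.coe_coe, ContinuousLinearMap.coe_coprod]
  refine LinearMap.ker_eq_bot.1 ?_
  rw [LinearMap.ker_coprod_of_disjoint_range]
  · simp [LinearMap.ker_eq_bot.2 hT]
  · simpa using h

theorem ContinuousLinearMap.range_coprod_subtypeL {E P : Type*} [NormedAddCommGroup E]
    [NormedSpace ℝ E] [NormedAddCommGroup P] [NormedSpace ℝ P] (T : P →L[ℝ] E)
    (W : Submodule ℝ E) : (T.coprod W.subtypeL).range = T.range ⊔ W := by
  rw [ContinuousLinearMap.coe_coprod, LinearMap.range_coprod]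
  simp

/-- An injective map and the inclusion of a complement of its range form a linear equivalence. -/
theorem ContinuousLinearMap.exists_equiv_coprod_subtypeL {E P : Type*} [NormedAddCommGroup E]
    [NormedSpace ℝ E] [FiniteDimensional ℝ E] [NormedAddCommGroup P] [NormedSpace ℝ P]
    [FiniteDimensional ℝ P] {T : P →L[ℝ] E} (hT : Function.Injective T) {W : Submodule ℝ E}
    (h : IsCompl T.range W) :
    ∃ e : (P × W) ≃L[ℝ] E, (e : P × W →L[ℝ] E) = T.coprod W.subtypeL := by
  have hs : Function.Surjective (T.coprod W.subtypeL) := by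
    have := T.range_coprod_subtypeL W
    rw [h.sup_eq_top] at this
    exact LinearMap.range_eq_top.1 this
  refine ⟨(LinearEquiv.ofBijective (T.coprod W.subtypeL).toLinearMap
    ⟨ContinuousLinearMap.injective_coprod_subtypeL hT h.disjoint, hs⟩).toContinuousLinearEquiv, ?_⟩
  exact ContinuousLinearMap.ext fun v => rfl

/-- The coordinates are f(a) e_L(b) e_C(c) with c in a complement of the Lie algebra of K. Cartan's
theorem for K and for L, on small enough boxes, turns membership in K and equality of cosets into
equations on c and a. -/
theorem exists_adaptedChart {K L : Subgroup G} (hK : IsClosed (K : Set G))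
    (hL : IsClosed (L : Set G)) (hLK : L ≤ K) {A : Type*} [NormedAddCommGroup A] [NormedSpace ℝ A]
    [FiniteDimensional ℝ A] {f : A → G} (hf : ContMDiff 𝓘(ℝ, A) (𝓡 n) ∞ f) (hfK : ∀ a, f a ∈ K)
    (hf0 : f 0 = 1) {T : A →L[ℝ] EuclideanSpace ℝ (Fin n)}
    (hfT : HasFDerivAt (fun a => logChart n (f a)) T 0) (hT : Function.Injective T)
    (hd : Disjoint T.range (lieSubspace n L)) (hs : T.range ⊔ lieSubspace n L = lieSubspace n K)
    {C : Submodule ℝ (EuclideanSpace ℝ (Fin n))} (hC : IsCompl (lieSubspace n K) C) :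
    ∃ D : AdaptedChart n K L A (lieSubspace n L) C, ∀ a ∈ D.UA, D.Θ ((a, 0), 0) = f a := by
  have : ContinuousMul G := continuousMul_of_lieGroup n
  have : IsTopologicalGroup G := topologicalGroup_of_lieGroup (𝓡 n) ∞
  obtain ⟨eL, l1, l2, l3, l4⟩ := exists_contMDiff_of_range_le (S := L) (lieSubspace n L).subtypeL
    (by simp)
  obtain ⟨eC, c1, -, c3, c4⟩ := exists_contMDiff_of_range_le (S := (⊤ : Subgroup G)) C.subtypeL
    (by simp [lieSubspace_top])
  let fK : A × lieSubspace n L → G := fun p => f p.1 * eL p.2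
  have k1 : ContMDiff 𝓘(ℝ, A × lieSubspace n L) (𝓡 n) ∞ fK :=
    (hf.comp contDiff_fst.contMDiff).mul (l1.comp contDiff_snd.contMDiff)
  have k2 : ∀ p, fK p ∈ K := fun p => K.mul_mem (hfK _) (hLK (l2 _))
  have k3 : fK 0 = 1 := by simp [fK, hf0, l3]
  have k4 : HasFDerivAt (fun p => logChart n (fK p)) (T.coprod (lieSubspace n L).subtypeL) 0 :=
    HasFDerivAt.logChart_mul_prod hf0 l3 hf.continuous.continuousAt l1.continuous.continuousAt
      hfT l4
  have k5 := ContinuousLinearMap.injective_coprod_subtypeL hT hd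
  have k6 : (T.coprod (lieSubspace n L).subtypeL).range = lieSubspace n K := by
    rw [ContinuousLinearMap.range_coprod_subtypeL, hs]
  let Φ : (A × lieSubspace n L) × C → G := fun p => fK p.1 * eC p.2
  have p1 : ContMDiff 𝓘(ℝ, (A × lieSubspace n L) × C) (𝓡 n) ∞ Φ :=
    (k1.comp contDiff_fst.contMDiff).mul (c1.comp contDiff_snd.contMDiff)
  have p3 : Φ 0 = 1 := by
    change fK 0 * eC 0 = 1
    rw [k3, c3, one_mul]
  have p4 : HasFDerivAt (fun p => logChart n (Φ p))
      ((T.coprod (lieSubspace n L).subtypeL).coprod C.subtypeL) 0 :=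
    HasFDerivAt.logChart_mul_prod k3 c3 k1.continuous.continuousAt c1.continuous.continuousAt
      k4 c4
  obtain ⟨e, he⟩ := ContinuousLinearMap.exists_equiv_coprod_subtypeL k5 (W := C) (by rwa [k6])
  rw [← he] at p4
  obtain ⟨Θ, h1, h2, h3⟩ := exists_openPartialHomeomorph_of_hasFDerivAt p1 p3 e p4
  have hΘn := Θ.open_source.mem_nhds h2
  have hz : (0 : (A × lieSubspace n L) × C) = (((0, 0) : A × lieSubspace n L), (0 : C)) := rfl
  rw [hz] at hΘn
  obtain ⟨V, hV, UC₀, hUC₀, hsub⟩ := mem_nhds_prod_iff.1 hΘn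
  obtain ⟨UA₀, hUA₀, UB₀, hUB₀, hsub'⟩ := mem_nhds_prod_iff.1 hV
  have hsrc : ∀ a ∈ UA₀, ∀ b ∈ UB₀, ∀ c ∈ UC₀, ((a, b), c) ∈ Θ.source := fun a ha b hb c hc =>
    hsub ⟨hsub' ⟨ha, hb⟩, hc⟩
  have hVK := (c1.continuous.tendsto' 0 1 c3).eventually
    (eventually_mem_image_of_isClosed hK k1 k2 k3 k4 k5 k6 hV)
  have hVL := eventually_mem_image_of_isClosed hL l1 l2 l3 l4 (by exact Subtype.val_injective)
    (by simp) hUB₀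
  have hdiff : Tendsto (fun p : A × A => (f p.1)⁻¹ * f p.2) (𝓝 (0, 0)) (𝓝 1) := by
    have hc := hf.continuous
    exact Continuous.tendsto' (by fun_prop) _ _ (by simp [hf0])
  -- For a, a' small, (f a)⁻¹ f a' lies in L only if it is e_L(b'') with b'' in the coordinate box.
  have hdL := hdiff.eventually hVL
  obtain ⟨UA₂, hUA₂, UA₃, hUA₃, hUA₁'⟩ := mem_nhds_prod_iff.1 hdL
  obtain ⟨UA, hUA, hUAo, hUA0⟩ := mem_nhds_iff.1 (inter_mem hUA₀ (inter_mem hUA₂ hUA₃))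
  obtain ⟨UB, hUB, hUBo, hUB0⟩ := mem_nhds_iff.1 hUB₀
  obtain ⟨UC, hUC, hUCo, hUC0⟩ := mem_nhds_iff.1 (inter_mem hUC₀ hVK)
  have hso : IsOpen ((UA ×ˢ UB) ×ˢ UC) := (hUAo.prod hUBo).prod hUCo
  have hin : (UA ×ˢ UB) ×ˢ UC ⊆ Θ.source := fun p hp =>
    hsrc _ (hUA hp.1.1).1 _ (hUB hp.1.2) _ (hUC hp.2).1
  have hss : (Θ.restrOpen _ hso).source = (UA ×ˢ UB) ×ˢ UC := by
    rw [OpenPartialHomeomorph.restrOpen_source, inter_eq_right.2 hin]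
  have hval : ∀ p ∈ (UA ×ˢ UB) ×ˢ UC, Θ p = f p.1.1 * eL p.1.2 * eC p.2 := fun p hp =>
    h1 p (hin hp)
  have h00 : (0 : lieSubspace n L) ∈ UB₀ := hUB hUB0
  refine ⟨⟨Θ.restrOpen _ hso, UA, UB, UC, hUAo, hUBo, hUA0, hUB0, hUC0, hss, ?_, ?_, ?_, ?_, ?_⟩,
    ?_⟩
  · exact (h1 0 h2).trans p3
  · rw [hss]
    exact p1.contMDiffOn.congr fun p hp => h1 p (hin hp)
  · refine h3.mono ?_
    exact inter_subset_left
  · rintro p hp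
    rw [hss] at hp
    change Θ p ∈ K ↔ _
    rw [hval p hp, K.mul_mem_cancel_left (k2 p.1)]
    constructor
    · intro hc
      -- If e_C(c) lies in K, Cartan's theorem writes it as a point of the K-chart; the same group
      -- element then has coordinates (q, 0) and (0, c), so c = 0.
      obtain ⟨q, hq, hqc⟩ := (hUC hp.2).2 hc
      have hq' : (q, (0 : C)) ∈ Θ.source := hsub ⟨hq, (hUC hUC0).1⟩
      have hp' : ((0 : A × lieSubspace n L), p.2) ∈ Θ.source :=
        hsrc _ (hUA hUA0).1 _ (hUB hUB0) _ (hUC hp.2).1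
      have : Θ (q, 0) = Θ (0, p.2) := by
        rw [h1 _ hq', h1 _ hp']
        change fK q * eC 0 = fK 0 * eC p.2
        rw [c3, k3, mul_one, one_mul, hqc]
      exact (congrArg Prod.snd (Θ.injOn hq' hp' this)).symm
    · intro hc
      rw [hc, c3]
      exact K.one_mem
  · rintro ⟨⟨a, b⟩, c⟩ hp ⟨⟨a', b'⟩, c'⟩ hp' hc hc'
    rw [hss] at hp hp'
    simp only at hc hc'
    subst hc hc'
    change (Θ _)⁻¹ * Θ _ ∈ L ↔ a = a'
    rw [hval _ hp, hval _ hp']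
    simp only [c3, mul_one]
    have e1 : (f a * eL b)⁻¹ * (f a' * eL b') = (eL b)⁻¹ * ((f a)⁻¹ * f a') * eL b' := by group
    rw [e1, L.mul_mem_cancel_right (l2 b'), L.mul_mem_cancel_left (L.inv_mem (l2 b))]
    constructor
    · intro h
      -- Then f a' = f a · e_L(b''), and injectivity of the coordinates forces a = a'.
      obtain ⟨b'', hb'', hb⟩ := hUA₁' (mk_mem_prod (hUA hp.1.1).2.1 (hUA hp'.1.1).2.2) h
      have hq : ((a, b''), (0 : C)) ∈ Θ.source := hsrc _ (hUA hp.1.1).1 _ hb'' _ (hUC hUC0).1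
      have hq' : ((a', 0), (0 : C)) ∈ Θ.source := hsrc _ (hUA hp'.1.1).1 _ h00 _ (hUC hUC0).1
      have : Θ ((a, b''), 0) = Θ ((a', 0), 0) := by
        rw [h1 _ hq, h1 _ hq']
        change f a * eL b'' * eC 0 = f a' * eL 0 * eC 0
        rw [hb, l3, mul_one, mul_inv_cancel_left]
      exact congrArg (fun p => p.1.1) (Θ.injOn hq hq' this)
    · rintro rfl
      rw [inv_mul_cancel]
      exact L.one_mem
  · intro a ha
    refine (hval ((a, 0), 0) ⟨⟨ha, hUB0⟩, hUC0⟩).trans ?_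
    simp [l3, c3]

/-- If `K` and `K'` are closed subgroups whose product contains a neighbourhood of the identity,
the Lie algebra of `K'` is complementary to every complement of the Lie algebra of `K ∩ K'` in the
Lie algebra of `K`. -/
theorem isCompl_lieSubspace {K K' : Subgroup G} (hK : IsClosed (K : Set G))
    (hK' : IsClosed (K' : Set G))
    (hopen : ∀ U ∈ 𝓝 (1 : G), ∀ᶠ g in 𝓝 (1 : G), ∃ k ∈ K, k ∈ U ∧ k⁻¹ * g ∈ K')
    {W : Submodule ℝ (EuclideanSpace ℝ (Fin n))} (hd : Disjoint W (lieSubspace n (K ⊓ K')))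
    (hs : W ⊔ lieSubspace n (K ⊓ K') = lieSubspace n K) : IsCompl W (lieSubspace n K') := by
  have : ContinuousMul G := continuousMul_of_lieGroup n
  have : IsTopologicalGroup G := topologicalGroup_of_lieGroup (𝓡 n) ∞
  have hWK : W ≤ lieSubspace n K := hs ▸ le_sup_left
  have hdis : Disjoint W (lieSubspace n K') := Submodule.disjoint_def.2 fun x hx hx' =>
    Submodule.disjoint_def.1 hd x hx (lieSubspace_inf_le hK hK' ⟨hWK hx, hx'⟩)
  refine ⟨hdis, codisjoint_iff.2 ?_⟩
  obtain ⟨f, f1, f2, f3, f4⟩ := exists_contMDiff_of_range_le (S := K) W.subtypeL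
    (fun v => hWK v.2)
  obtain ⟨eH, a1, a2, a3, a4⟩ := exists_contMDiff_of_range_le (S := K ⊓ K')
    (lieSubspace n (K ⊓ K')).subtypeL (by simp)
  obtain ⟨e, e1, e2, e3, e4⟩ := exists_contMDiff_of_range_le (S := K') (lieSubspace n K').subtypeL
    (by simp)
  have k4 : HasFDerivAt (fun p : W × lieSubspace n (K ⊓ K') => logChart n (f p.1 * eH p.2))
      (W.subtypeL.coprod (lieSubspace n (K ⊓ K')).subtypeL) 0 :=
    HasFDerivAt.logChart_mul_prod f3 a3 f1.continuous.continuousAt a1.continuous.continuousAt f4 a4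
  have k' : HasFDerivAt (fun p : W × lieSubspace n K' => logChart n (f p.1 * e p.2))
      (W.subtypeL.coprod (lieSubspace n K').subtypeL) 0 :=
    HasFDerivAt.logChart_mul_prod f3 e3 f1.continuous.continuousAt e1.continuous.continuousAt f4 e4
  set T := W.subtypeL.coprod (lieSubspace n K').subtypeL with hTdef
  have hWi : Function.Injective W.subtypeL := Subtype.val_injective
  have hTinj : Function.Injective T :=
    ContinuousLinearMap.injective_coprod_subtypeL hWi (by simpa using hdis)
  have hTr : T.range = W ⊔ lieSubspace n K' := by
    rw [ContinuousLinearMap.range_coprod_subtypeL]; simp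
  -- Factor g = k k' with k small and write k = f(w) e_H(h). The factor e_H(h) lies in K' and is
  -- absorbed there, leaving g = f(w) e(c) with both parameters small.
  have hcover : ∀ N ∈ 𝓝 (0 : W × lieSubspace n K'),
      ∀ᶠ g in 𝓝 (1 : G), ∃ p ∈ N, f p.1 * e p.2 = g := by
    intro N hN
    obtain ⟨N₁, hN₁, N₂, hN₂, hsub⟩ := mem_nhds_prod_iff.1 hN
    have hK'c := eventually_mem_image_of_isClosed hK' e1 e2 e3 e4 Subtype.val_injective
      (by simp) hN₂
    have ht : Tendsto (fun p : W × G => (f p.1)⁻¹ * p.2) (𝓝 0 ×ˢ 𝓝 1) (𝓝 1) := by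
      have hc := f1.continuous
      rw [← nhds_prod_eq]
      exact Continuous.tendsto' (by fun_prop) _ _ (by simp [f3])
    obtain ⟨pW, hpW, pG, hpG, hpp⟩ := eventually_prod_iff.1 (ht.eventually hK'c)
    have hM : {q : W × lieSubspace n (K ⊓ K') | q.1 ∈ N₁ ∧ pW q.1} ∈ 𝓝 0 :=
      (continuous_fst.tendsto' (0 : W × lieSubspace n (K ⊓ K')) _ rfl).eventually
        ((eventually_mem_set.2 hN₁).and hpW)
    have hKc := eventually_mem_image_of_isClosed hK (Ψ := fun p : W × lieSubspace n (K ⊓ K') =>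
      f p.1 * eH p.2) ((f1.comp contDiff_fst.contMDiff).mul (a1.comp contDiff_snd.contMDiff))
      (fun p => K.mul_mem (f2 _) (a2 _).1) (by simp [f3, a3]) k4
      (ContinuousLinearMap.injective_coprod_subtypeL hWi (by simpa using hd))
      (by rw [ContinuousLinearMap.range_coprod_subtypeL]; simpa using hs) hM
    filter_upwards [hopen _ hKc, hpG] with g ⟨k, hk, hkM, hkg⟩ hg
    obtain ⟨⟨w, h⟩, ⟨hw1, hw2⟩, hwk⟩ := hkM hk
    simp only at hwk hw1 hw2
    have hmem : (f w)⁻¹ * g ∈ K' := by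
      have : (f w)⁻¹ * g = eH h * (k⁻¹ * g) := by rw [← hwk]; group
      rw [this]
      exact K'.mul_mem (a2 h).2 hkg
    obtain ⟨c, hc, hce⟩ := hpp hw2 hg hmem
    refine ⟨(w, c), hsub ⟨hw1, hc⟩, ?_⟩
    simp only [hce, mul_inv_cancel_left]
  rw [← hTr, Submodule.eq_top_iff']
  intro y
  -- If y were outside the range of T, then for small t the element with coordinate ty would be f(w)
  -- e(c), whose coordinate is T p + o(p) with p = O(t). So ty would be within o(t) of the range,
  -- although its distance is at least tδ.
  by_contra hy
  obtain ⟨κ, hκ, hanti⟩ := T.toLinearMap.exists_antilipschitzWith (LinearMap.ker_eq_bot.2 hTinj)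
  have hbound : ∀ v, ‖v‖ ≤ κ * ‖T v‖ := fun v => by
    simpa using hanti.le_mul_dist v 0
  have hclosed : IsClosed (T.range : Set (EuclideanSpace ℝ (Fin n))) :=
    Submodule.closed_of_finiteDimensional _
  set δ := Metric.infDist y (T.range : Set (EuclideanSpace ℝ (Fin n))) with hδ
  have hδpos : 0 < δ := (hclosed.notMem_iff_infDist_pos ⟨0, T.range.zero_mem⟩).1 hy
  have hκ' : (0 : ℝ) < κ := hκ
  -- The first bound lets κε‖p‖ be absorbed, giving ‖p‖ ≤ 2κt‖y‖; the second makes the resulting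
  -- error at most tδ/2.
  set ε : ℝ := min (1 / (2 * κ)) (δ / (4 * κ * (‖y‖ + 1))) with hε
  have hεpos : 0 < ε := lt_min (by positivity) (by positivity)
  have hlo := k'.isLittleO.def hεpos
  simp only [Prod.fst_zero, f3, Prod.snd_zero, e3, mul_one, logChart_one, sub_zero] at hlo
  have hexp : Tendsto (fun t : ℝ => expChart n G (t • y)) (𝓝[>] 0) (𝓝 1) :=
    (tendsto_expChart n (G := G)).comp
      ((Continuous.tendsto' (by fun_prop) _ _ (by simp)).mono_left nhdsWithin_le_nhds)
  have hlog : ∀ᶠ t : ℝ in 𝓝[>] 0, logChart n (expChart n G (t • y)) = t • y :=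
    ((Continuous.tendsto' (by fun_prop) (0 : ℝ) (0 : EuclideanSpace ℝ (Fin n)) (by simp) :
      Tendsto (fun t : ℝ => t • y) (𝓝 0) (𝓝 0)).mono_left
        nhdsWithin_le_nhds).eventually (eventually_logChart_expChart n)
  obtain ⟨t, ⟨⟨p, hp, hpg⟩, ht⟩, ht0⟩ :=
    (((hexp.eventually (hcover _ hlo)).and hlog).and self_mem_nhdsWithin).exists
  have ht0' : 0 < t := ht0
  rw [mem_ofPred_eq, hpg, ht] at hp
  have h1 : t * δ ≤ ‖t • y - T p‖ := by
    have : t • y - T p = t • (y - t⁻¹ • T p) := by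
      rw [smul_sub, smul_inv_smul₀ ht0'.ne']
    rw [this, norm_smul, Real.norm_of_nonneg ht0'.le]
    refine mul_le_mul_of_nonneg_left ?_ ht0'.le
    rw [← dist_eq_norm]
    exact Metric.infDist_le_dist_of_mem (T.range.smul_mem _ ⟨p, rfl⟩)
  have h2 : ‖T p‖ ≤ t * ‖y‖ + ε * ‖p‖ := by
    have h3 : ‖T p‖ ≤ ‖t • y‖ + ‖t • y - T p‖ := by
      have := norm_sub_le (t • y) (t • y - T p)
      simpa using this
    rw [norm_smul, Real.norm_of_nonneg ht0'.le] at h3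
    linarith
  have h4 : ‖p‖ ≤ 2 * κ * (t * ‖y‖) := by
    have h5 := hbound p
    have h6 : κ * ε ≤ 1 / 2 := by
      have := mul_le_mul_of_nonneg_left (min_le_left (1 / (2 * (κ : ℝ)))
        (δ / (4 * κ * (‖y‖ + 1)))) hκ'.le
      refine this.trans (le_of_eq ?_)
      field_simp
    have h7 : κ * ‖T p‖ ≤ κ * (t * ‖y‖ + ε * ‖p‖) := mul_le_mul_of_nonneg_left h2 hκ'.le
    have h8 : κ * ε * ‖p‖ ≤ 1 / 2 * ‖p‖ := mul_le_mul_of_nonneg_right h6 (norm_nonneg _)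
    nlinarith
  have h9 : ε * (2 * κ * (‖y‖ + 1)) ≤ δ / 2 := by
    have := mul_le_mul_of_nonneg_right (min_le_right (1 / (2 * (κ : ℝ)))
        (δ / (4 * κ * (‖y‖ + 1)))) (by positivity : 0 ≤ 2 * (κ : ℝ) * (‖y‖ + 1))
    refine this.trans (le_of_eq ?_)
    field_simp
    norm_num
  have h10 : t * δ ≤ ε * (2 * κ * (t * ‖y‖)) :=
    (h1.trans hp).trans (mul_le_mul_of_nonneg_left h4 hεpos.le)
  have h11 : ε * (2 * κ * (t * ‖y‖)) ≤ t * (ε * (2 * κ * (‖y‖ + 1))) := by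
    have : ε * (2 * κ * (t * ‖y‖)) + t * ε * 2 * κ = t * (ε * (2 * κ * (‖y‖ + 1))) := by ring
    have h12 : 0 ≤ t * ε * 2 * κ := by positivity
    linarith
  have h13 : t * (ε * (2 * κ * (‖y‖ + 1))) ≤ t * (δ / 2) := mul_le_mul_of_nonneg_left h9 ht0'.le
  have h14 : t * (δ / 2) < t * δ := mul_lt_mul_of_pos_left (by linarith) ht0'
  linarith

end ExistsAdaptedChart

/-! ## Invariant metrics on homogeneous manifolds -/

section InvariantMetric

open Filter Topology Set Bundle

/-- By compactness of the unit sphere, b(v, v) ≥ c‖v‖² with c > 0. -/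
theorem ContinuousLinearMap.isVonNBounded_of_pos {E : Type*} [NormedAddCommGroup E]
    [NormedSpace ℝ E] [FiniteDimensional ℝ E] (b : E →L[ℝ] E →L[ℝ] ℝ)
    (hpos : ∀ v, v ≠ 0 → 0 < b v v) : Bornology.IsVonNBounded ℝ {v : E | b v v < 1} := by
  have hc : ContinuousOn (fun v : E => b v v) (Metric.sphere 0 1) :=
    (b.continuous.clm_apply continuous_id).continuousOn
  have : ProperSpace E := FiniteDimensional.proper_real E
  obtain ⟨c, hc0, hc⟩ := (isCompact_sphere (0 : E) 1).exists_forall_le' hc (a := 0)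
    (fun v hv => hpos v (by rintro rfl; simp at hv))
  rw [NormedSpace.isVonNBounded_iff]
  refine (Metric.isBounded_closedBall (x := (0 : E)) (r := 1 / c + 1)).subset fun v hv => ?_
  rw [mem_ofPred_eq] at hv
  rw [mem_closedBall_zero_iff]
  rcases eq_or_ne v 0 with rfl | h0
  · simp only [norm_zero]; positivity
  have h1 := hc (‖v‖⁻¹ • v) (by simp [norm_smul, h0])
  have hn : 0 < ‖v‖ := norm_pos_iff.2 h0
  have h2 : b (‖v‖⁻¹ • v) (‖v‖⁻¹ • v) = (‖v‖⁻¹) ^ 2 * b v v := by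
    simp [pow_two, mul_assoc]
  rw [h2, inv_pow, inv_mul_eq_div, le_div_iff₀ (by positivity)] at h1
  have h3 : c * ‖v‖ ^ 2 < 1 := h1.trans_lt hv
  have h4 : ‖v‖ ^ 2 < 1 / c := by rw [lt_div_iff₀ hc0]; linarith
  nlinarith [sq_nonneg (‖v‖ - 1)]

theorem ContinuousLinearMap.contDiff_flip {U V : Type*} [NormedAddCommGroup U] [NormedSpace ℝ U]
    [NormedAddCommGroup V] [NormedSpace ℝ V] :
    ContDiff ℝ ∞ (fun B : U →L[ℝ] V →L[ℝ] ℝ => B.flip) :=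
  IsBoundedLinearMap.contDiff ⟨⟨fun _ _ => rfl, fun _ _ => rfl⟩, 1, one_pos, fun B => by
    rw [ContinuousLinearMap.opNorm_flip, one_mul]⟩

theorem ContinuousLinearMap.contDiff_bilinearComp_self {E F : Type*} [NormedAddCommGroup E]
    [NormedSpace ℝ E] [NormedAddCommGroup F] [NormedSpace ℝ F] (Q : E →L[ℝ] E →L[ℝ] ℝ) :
    ContDiff ℝ ∞ (fun A : F →L[ℝ] E => Q.bilinearComp A A) :=
  contDiff_flip.comp ((contDiff_flip.comp (contDiff_const.clm_comp contDiff_id)).clm_comp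
    contDiff_id)

variable {d : ℕ} {Γ M : Type*} [Group Γ] [TopologicalSpace M]
  [ChartedSpace (EuclideanSpace ℝ (Fin d)) M] [MulAction Γ M]

/-- The derivative of the translation by `k`, on the model space. -/
noncomputable def smulDeriv (d : ℕ) {Γ M : Type*} [Group Γ] [TopologicalSpace M]
    [ChartedSpace (EuclideanSpace ℝ (Fin d)) M] [MulAction Γ M] (k : Γ) (y : M) :
    EuclideanSpace ℝ (Fin d) →L[ℝ] EuclideanSpace ℝ (Fin d) :=
  mfderiv (𝓡 d) (𝓡 d) (fun z : M => k • z) y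

theorem smulDeriv_one (y : M) : smulDeriv d (1 : Γ) y = ContinuousLinearMap.id ℝ _ := by
  have : (fun z : M => (1 : Γ) • z) = id := by ext z; simp
  rw [smulDeriv, this]
  exact mfderiv_id

theorem hasMFDerivAt_smul (hτ : ∀ k : Γ, ContMDiff (𝓡 d) (𝓡 d) ∞ (fun y : M => k • y)) (k : Γ)
    (y : M) : HasMFDerivAt (𝓡 d) (𝓡 d) (fun z : M => k • z) y (smulDeriv d k y) :=
  ((hτ k).mdifferentiableAt (by simp)).hasMFDerivAt

theorem smulDeriv_mul (hτ : ∀ k : Γ, ContMDiff (𝓡 d) (𝓡 d) ∞ (fun y : M => k • y)) {k k' : Γ}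
    {y y' : M} (h : k' • y = y') :
    smulDeriv d (k * k') y = (smulDeriv d k y').comp (smulDeriv d k' y) := by
  have h1 := HasMFDerivAt.comp_of_apply_eq (hasMFDerivAt_smul hτ k y') (hasMFDerivAt_smul hτ k' y) h
  have h2 : (fun z : M => k • k' • z) = fun z => (k * k') • z := by ext z; rw [mul_smul]
  rw [h2] at h1
  exact h1.mfderiv

theorem smulDeriv_inv_comp (hτ : ∀ k : Γ, ContMDiff (𝓡 d) (𝓡 d) ∞ (fun y : M => k • y)) {k : Γ}
    {y y' : M} (h : k • y = y') :
    (smulDeriv d k⁻¹ y').comp (smulDeriv d k y) = ContinuousLinearMap.id ℝ _ := by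
  rw [← smulDeriv_mul hτ h, inv_mul_cancel, smulDeriv_one]

/-- Transport Q from o by any group element reaching y. Stabilizer invariance removes the dependence
on that element, and smoothness is checked with a local section σ. -/
theorem exists_invariant_riemMetric [IsManifold (𝓡 d) ∞ M]
    (hτ : ∀ k : Γ, ContMDiff (𝓡 d) (𝓡 d) ∞ (fun y : M => k • y)) (o : M)
    (hsec : ∀ y₀ : M, ∃ σ : M → Γ, (∀ᶠ y in 𝓝 y₀, σ y • o = y) ∧
      ContMDiffAt ((𝓡 d).prod (𝓡 d)) (𝓡 d) ∞ (fun p : M × M => (σ p.1)⁻¹ • p.2) (y₀, y₀))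
    (Q : EuclideanSpace ℝ (Fin d) →L[ℝ] EuclideanSpace ℝ (Fin d) →L[ℝ] ℝ)
    (hsymm : ∀ u v, Q u v = Q v u) (hpos : ∀ u, u ≠ 0 → 0 < Q u u)
    (hinv : ∀ k : Γ, k • o = o → ∀ u v, Q (smulDeriv d k o u) (smulDeriv d k o v) = Q u v) :
    ∃ g : RiemMetric d M, (∀ u v : EuclideanSpace ℝ (Fin d), g.inner o u v = Q u v) ∧
      ∀ k : Γ, PreservesMetric g fun y => k • y := by
  have htrans : ∀ y : M, ∃ k : Γ, k • o = y := fun y =>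
    (hsec y).imp' (fun σ => σ y) fun σ h => h.1.self_of_nhds
  choose s hs using htrans
  let b (y : M) : EuclideanSpace ℝ (Fin d) →L[ℝ] EuclideanSpace ℝ (Fin d) →L[ℝ] ℝ :=
    Q.bilinearComp (smulDeriv d (s y)⁻¹ y) (smulDeriv d (s y)⁻¹ y)
  have hb : ∀ (k : Γ) (y : M), k • o = y → ∀ u v,
      b y u v = Q (smulDeriv d k⁻¹ y u) (smulDeriv d k⁻¹ y v) := by
    intro k y hk u v
    have h1 : (s y)⁻¹ • y = o := by rw [inv_smul_eq_iff, hs]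
    have h2 : (k⁻¹ * s y) • o = o := by rw [mul_smul, hs, inv_smul_eq_iff, hk]
    have h3 : k⁻¹ = (k⁻¹ * s y) * (s y)⁻¹ := by group
    rw [h3, smulDeriv_mul hτ h1]
    exact (hinv _ h2 _ _).symm
  have hinj : ∀ (k : Γ) (y : M), Function.Injective (smulDeriv d k y) := fun k y =>
    Function.LeftInverse.injective (g := smulDeriv d k⁻¹ (k • y)) fun v =>
      DFunLike.congr_fun (smulDeriv_inv_comp hτ (k := k) (y := y) rfl) v
  have hbpos : ∀ y v, v ≠ 0 → 0 < b y v v := fun y v hv =>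
    hpos _ ((map_ne_zero_iff _ (hinj _ y)).2 hv)
  have hsmooth : ContMDiff (𝓡 d) ((𝓡 d).prod 𝓘(ℝ, EuclideanSpace ℝ (Fin d) →L[ℝ]
      EuclideanSpace ℝ (Fin d) →L[ℝ] ℝ)) ∞ (fun y => TotalSpace.mk'
        (EuclideanSpace ℝ (Fin d) →L[ℝ] EuclideanSpace ℝ (Fin d) →L[ℝ] ℝ)
        (E := fun y : M => TangentSpace (𝓡 d) y →L[ℝ] TangentSpace (𝓡 d) y →L[ℝ] ℝ) y (b y)) := by
    intro y₀
    obtain ⟨σ, hσ, hσs⟩ := hsec y₀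
    refine (contMDiffAt_hom_bundle _).2 ⟨contMDiffAt_id, ?_⟩
    let f : M → M → M := fun y z => (σ y)⁻¹ • z
    -- The derivative of z ↦ (σ y)⁻¹z at z = y depends smoothly on y in tangent coordinates, because
    -- (y, z) ↦ (σ y)⁻¹z is jointly smooth.
    have hA := ContMDiffAt.mfderiv (I := 𝓡 d) (I' := 𝓡 d) (x₀ := y₀) (m := ∞) f id hσs
      contMDiffAt_id (by simp)
    let A : M → EuclideanSpace ℝ (Fin d) →L[ℝ] EuclideanSpace ℝ (Fin d) :=
      inTangentCoordinates (𝓡 d) (𝓡 d) id (fun x => f x (id x))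
        (fun x => mfderiv (𝓡 d) (𝓡 d) (f x) (id x)) y₀
    have hA : ContMDiffAt (𝓡 d) 𝓘(ℝ, EuclideanSpace ℝ (Fin d) →L[ℝ] EuclideanSpace ℝ (Fin d)) ∞
      A y₀ := hA
    let t := trivializationAt (EuclideanSpace ℝ (Fin d)) (TangentSpace (𝓡 d)) (f y₀ y₀)
    -- All these derivatives end in the tangent space at o, because (σ y)⁻¹y = o, so one fixed map S
    -- undoes the trivialization on the target side.
    let S : EuclideanSpace ℝ (Fin d) →L[ℝ] EuclideanSpace ℝ (Fin d) := t.symmL ℝ (f y₀ y₀)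
    have hS : ∀ (z : M), z = f y₀ y₀ → ∀ v : EuclideanSpace ℝ (Fin d),
        S (t.continuousLinearMapAt ℝ z v) = v := by
      rintro _ rfl v
      exact t.symmL_continuousLinearMapAt (FiberBundle.mem_baseSet_trivializationAt' _) v
    refine ContMDiffAt.congr_of_eventuallyEq
      (((Q.bilinearComp S S).contDiff_bilinearComp_self).contMDiff.contMDiffAt.comp y₀ hA) ?_
    have hfo : ∀ y, σ y • o = y → f y y = o := fun y hy => inv_smul_eq_iff.2 hy.symm
    filter_upwards [hσ, (chartAt (EuclideanSpace ℝ (Fin d)) y₀).open_source.mem_nhds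
      (mem_chart_source _ y₀)] with y hy hyc
    have hS' := hS (f y y) (by rw [hfo y hy, hfo y₀ hσ.self_of_nhds])
    have hyc' : y ∈ (trivializationAt (EuclideanSpace ℝ (Fin d)) (TangentSpace (𝓡 d)) y₀).baseSet :=
      hyc
    ext1 v
    ext1 w
    refine (inCoordinates_apply_eq₂ hyc' hyc' (mem_univ _)).trans ?_
    have hlin : ∀ r : ℝ, (trivializationAt ℝ (fun _ : M => ℝ) y₀).linearMapAt ℝ y r = r := by
      simp
    refine ((hlin _).trans (hb (σ y) y hy _ _)).trans ?_
    have hAy (v : EuclideanSpace ℝ (Fin d)) : S (A y v) = smulDeriv d (σ y)⁻¹ y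
        ((trivializationAt (EuclideanSpace ℝ (Fin d)) (TangentSpace (𝓡 d)) y₀).symm y v) := by
      rw [← Trivialization.symmL_apply (R := ℝ) _ hyc']
      exact hS' _
    exact (congrArg₂ (fun a b => Q a b) (hAy v) (hAy w)).symm
  exact ⟨⟨b, fun y v w => hsymm _ _, hbpos, fun y => (b y).isVonNBounded_of_pos (hbpos y),
    hsmooth⟩, fun u v => by
      have := hb 1 o (one_smul Γ o) u v
      rw [inv_one, smulDeriv_one] at this
      exact this, fun k y v w => by
      have h1 : (k * s y) • o = k • y := by rw [mul_smul, hs]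
      refine (hb _ _ h1 _ _).trans ?_
      have h2 : smulDeriv d (k * s y)⁻¹ (k • y) =
          (smulDeriv d (s y)⁻¹ y).comp (smulDeriv d k⁻¹ (k • y)) := by
        rw [mul_inv_rev, smulDeriv_mul hτ (inv_smul_smul k y)]
      have h3 (v : EuclideanSpace ℝ (Fin d)) : smulDeriv d (k * s y)⁻¹ (k • y)
          (smulDeriv d k y v) = smulDeriv d (s y)⁻¹ y v := by
        rw [h2, ContinuousLinearMap.comp_apply]
        exact congrArg _ (DFunLike.congr_fun (smulDeriv_inv_comp hτ (k := k) (y := y) rfl) v)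
      exact congrArg₂ (fun a b => Q a b) (h3 v) (h3 w)⟩

end InvariantMetric

/-! ### Smooth sections and the action on the coset manifold -/

namespace AdaptedChart

open Topology Set Manifold Filter

variable {n : ℕ} {G : Type*} [TopologicalSpace G] [ChartedSpace (EuclideanSpace ℝ (Fin n)) G]
  [Group G] [IsTopologicalGroup G] [LieGroup (𝓡 n) ∞ G] {K L : Subgroup G} {B C : Type*}
  [NormedAddCommGroup B] [NormedSpace ℝ B] [NormedAddCommGroup C] [NormedSpace ℝ C] {k d : ℕ}
  (D : AdaptedChart n K L (EuclideanSpace ℝ (Fin d)) B C)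

theorem chartCoset_apply_one : D.chartCoset (QuotientGroup.mk 1) = 0 := by
  have h0 : 0 ∈ D.Θ.source := D.mem_source D.zeroA D.zeroB
  rw [D.chartCoset_mk D.one_mem_chartSubgroup_source, chartSubgroup_apply, Subgroup.coe_one,
    ← D.map_zero, D.Θ.left_inv h0]
  rfl

/-- Smooth local sections of the projection to the coset space. -/
theorem exists_smooth_section (e : EuclideanSpace ℝ (Fin k) ≃L[ℝ] EuclideanSpace ℝ (Fin d) × B)
    (T : ((EuclideanSpace ℝ (Fin d) × B) × C) ≃L[ℝ] EuclideanSpace ℝ (Fin n))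
    (y₀ : CosetSpace K L) :
    let _ := D.chartedSpaceCoset
    ∃ σ : CosetSpace K L → K, (∀ᶠ y in 𝓝 y₀, σ y • (QuotientGroup.mk 1 : CosetSpace K L) = y) ∧
      ContMDiffAt ((𝓡 d).prod (𝓡 d)) (𝓡 d) ∞
        (fun p : CosetSpace K L × CosetSpace K L => (σ p.1)⁻¹ • p.2) (y₀, y₀) := by
  intro _
  let _ := D.chartedSpaceSubgroup e
  have hstd := D.isStandardSmoothStructure e T
  have := hstd.lieGroup
  have := hstd.isManifold
  obtain ⟨k₀, rfl⟩ := QuotientGroup.mk_surjective y₀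
  let c := translateChart D.chartCoset k₀
  let c' := translateChart (D.chartSubgroupE e) k₀
  have hc : c ∈ IsManifold.maximalAtlas (𝓡 d) ∞ (CosetSpace K L) :=
    translateChart_mem_maximalAtlas D.contDiffOn_chartCoset k₀
  have hc' : c' ∈ IsManifold.maximalAtlas (𝓡 k) ∞ K :=
    translateChart_mem_maximalAtlas (D.contDiffOn_chartSubgroupE e) k₀
  have hk₀ : k₀⁻¹ • (QuotientGroup.mk k₀ : CosetSpace K L) = QuotientGroup.mk 1 := by
    change (QuotientGroup.mk (k₀⁻¹ * k₀) : CosetSpace K L) = _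
    rw [inv_mul_cancel]
  have hcs : (QuotientGroup.mk k₀ : CosetSpace K L) ∈ c.source := by
    rw [mem_translateChart_source, hk₀]
    exact D.mk_mem_chartCoset_source D.one_mem_chartSubgroup_source
  have hc0 : c (QuotientGroup.mk k₀) = 0 := by
    rw [translateChart_apply, hk₀, D.chartCoset_apply_one]
  let σ : CosetSpace K L → K := fun y => c'.symm (e.symm (c y, 0))
  have hσy : ∀ y, σ y = k₀ * D.param (c y, 0) := fun y => by
    simp only [σ, c', translateChart_symm_apply, chartSubgroupE_symm_apply,
      ContinuousLinearEquiv.apply_symm_apply]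
    rfl
  have hσ : ∀ᶠ y in 𝓝 (QuotientGroup.mk k₀ : CosetSpace K L),
      σ y • (QuotientGroup.mk 1 : CosetSpace K L) = y := by
    filter_upwards [c.open_source.mem_nhds hcs] with y hy
    have h1 : c.symm (c y) = k₀ • (QuotientGroup.mk (D.param (c y, 0)) : CosetSpace K L) :=
      translateChart_symm_apply _ _ _
    rw [c.left_inv hy] at h1
    refine Eq.trans ?_ h1.symm
    rw [hσy, mul_smul]
    exact congrArg (k₀ • ·) (congrArg QuotientGroup.mk (mul_one (D.param (c y, 0))))
  have hσs : ContMDiffAt (𝓡 d) (𝓡 k) ∞ σ (QuotientGroup.mk k₀) := by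
    have h1 : ContMDiffAt (𝓡 d) (𝓡 d) ∞ c (QuotientGroup.mk k₀) :=
      contMDiffAt_of_mem_maximalAtlas hc hcs
    have h2 : ContDiff ℝ ∞ (fun a : EuclideanSpace ℝ (Fin d) => e.symm (a, (0 : B))) :=
      e.symm.contDiff.comp (contDiff_id.prodMk contDiff_const)
    have h3 : ContMDiffAt (𝓡 k) (𝓡 k) ∞ c'.symm (e.symm (c (QuotientGroup.mk k₀), 0)) := by
      refine contMDiffAt_symm_of_mem_maximalAtlas hc' ?_
      rw [translateChart_target, mem_chartSubgroupE_target, hc0, e.apply_symm_apply]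
      exact ⟨D.zeroA, D.zeroB⟩
    exact ContMDiffAt.comp (f := fun y => e.symm (c y, (0 : B))) (QuotientGroup.mk k₀) h3
      (h2.contMDiff.contMDiffAt.comp (QuotientGroup.mk k₀) h1)
  refine ⟨σ, hσ, ?_⟩
  have hmk : ContMDiff (𝓡 k) (𝓡 d) ∞ (QuotientGroup.mk : K → CosetSpace K L) := fun x =>
    ((hstd.isSubmersion).isSubmersionAt x).contMDiffAt
  -- Near the base point p.2 is the coset of σ(p.2), so (σ p.1)⁻¹p.2 is the class of σ(p.1)⁻¹σ(p.2);
  -- smoothness of the group operations and the projection then suffices.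
  have h4 : ContMDiffAt ((𝓡 d).prod (𝓡 d)) (𝓡 k) ∞
      (fun p : CosetSpace K L × CosetSpace K L => (σ p.1)⁻¹ * σ p.2)
      (QuotientGroup.mk k₀, QuotientGroup.mk k₀) :=
    (ContMDiffAt.comp (g := σ) (f := Prod.fst)
      ((QuotientGroup.mk k₀ : CosetSpace K L), (QuotientGroup.mk k₀ : CosetSpace K L)) hσs
      contMDiffAt_fst).inv.mul
    (ContMDiffAt.comp (g := σ) (f := Prod.snd)
      ((QuotientGroup.mk k₀ : CosetSpace K L), (QuotientGroup.mk k₀ : CosetSpace K L)) hσs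
      contMDiffAt_snd)
  refine (hmk.contMDiffAt.comp _ h4).congr_of_eventuallyEq ?_
  have h5 : ∀ᶠ p : CosetSpace K L × CosetSpace K L in
      𝓝 (QuotientGroup.mk k₀, QuotientGroup.mk k₀),
      σ p.2 • (QuotientGroup.mk 1 : CosetSpace K L) = p.2 :=
    (continuous_snd.tendsto' (_, _) _ rfl).eventually hσ
  filter_upwards [h5] with p hp
  conv_lhs => rw [← hp]
  change (QuotientGroup.mk ((σ p.1)⁻¹ * (σ p.2 * 1)) : CosetSpace K L) = _
  rw [mul_one]
  rfl

theorem contMDiff_smul_coset :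
    let _ := D.chartedSpaceCoset
    ∀ x : K, ContMDiff (𝓡 d) (𝓡 d) ∞ (fun y : CosetSpace K L => x • y) := fun x =>
  contMDiff_smul_translateChartedSpace D.contDiffOn_chartCoset x

theorem contMDiffAt_chartCoset_symm :
    let _ := D.chartedSpaceCoset
    ContMDiffAt (𝓡 d) (𝓡 d) ∞ D.chartCoset.symm 0 ∧
      Function.Surjective (mfderiv (𝓡 d) (𝓡 d) D.chartCoset.symm 0) := by
  intro _
  have : IsManifold (𝓡 d) ∞ (CosetSpace K L) :=
    isManifold_translateChartedSpace D.contDiffOn_chartCoset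
  let c := translateChart D.chartCoset (1 : K)
  have hc : c ∈ IsManifold.maximalAtlas (𝓡 d) ∞ (CosetSpace K L) :=
    translateChart_mem_maximalAtlas D.contDiffOn_chartCoset 1
  have hsymm : (c.symm : EuclideanSpace ℝ (Fin d) → CosetSpace K L) = D.chartCoset.symm := by
    ext a; simp [c]
  have h0 : (0 : EuclideanSpace ℝ (Fin d)) ∈ c.target := by
    rw [translateChart_target]; exact D.zeroA
  have h1 : ContMDiffAt (𝓡 d) (𝓡 d) ∞ c.symm 0 := contMDiffAt_symm_of_mem_maximalAtlas hc h0
  have h2 : ContMDiffAt (𝓡 d) (𝓡 d) ∞ c (c.symm 0) :=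
    contMDiffAt_of_mem_maximalAtlas hc (c.map_target h0)
  rw [← hsymm]
  refine ⟨h1, ?_⟩
  have h3 := (h2.mdifferentiableAt (by simp)).hasMFDerivAt.comp (0 : EuclideanSpace ℝ (Fin d))
    (h1.mdifferentiableAt (by simp)).hasMFDerivAt
  have h4 : HasMFDerivAt (𝓡 d) (𝓡 d) (c ∘ c.symm) 0
      (ContinuousLinearMap.id ℝ (EuclideanSpace ℝ (Fin d))) :=
    (hasMFDerivAt_id (I := 𝓡 d) (0 : EuclideanSpace ℝ (Fin d))).congr_of_eventuallyEq (by
      filter_upwards [c.open_target.mem_nhds h0] with a ha using c.right_inv ha)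
  have h5 := hasMFDerivAt_unique h3 h4
  let A : EuclideanSpace ℝ (Fin d) →ₗ[ℝ] EuclideanSpace ℝ (Fin d) :=
    (mfderiv (𝓡 d) (𝓡 d) c (c.symm 0) :
      EuclideanSpace ℝ (Fin d) →L[ℝ] EuclideanSpace ℝ (Fin d)).toLinearMap
  let A' : EuclideanSpace ℝ (Fin d) →ₗ[ℝ] EuclideanSpace ℝ (Fin d) :=
    (mfderiv (𝓡 d) (𝓡 d) c.symm 0 :
      EuclideanSpace ℝ (Fin d) →L[ℝ] EuclideanSpace ℝ (Fin d)).toLinearMap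
  have h6 : Function.LeftInverse A A' := fun v => DFunLike.congr_fun h5 v
  exact (LinearMap.injective_iff_surjective (f := A')).1 h6.injective

end AdaptedChart

/-! ### Linear algebra of horizontal vectors -/

section HorizontalForm

variable {V U : Type*} [NormedAddCommGroup V] [NormedSpace ℝ V] [NormedAddCommGroup U]
  [NormedSpace ℝ U]

/-- `P` is isometric on the orthogonal complement of its kernel. -/
def IsometricOnHorizontal (b : V →L[ℝ] V →L[ℝ] ℝ) (Q : U →L[ℝ] U →L[ℝ] ℝ) (P : V →L[ℝ] U) :
    Prop :=
  ∀ v w, (∀ z, P z = 0 → b v z = 0) → (∀ z, P z = 0 → b w z = 0) → Q (P v) (P w) = b v w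

/-- P restricts to an isomorphism from the orthogonal complement of its kernel; Q is b transported
through the inverse s. -/
theorem exists_isometricOnHorizontal [FiniteDimensional ℝ V] [FiniteDimensional ℝ U]
    (b : V →L[ℝ] V →L[ℝ] ℝ) (hs : ∀ v w, b v w = b w v) (hpos : ∀ v, v ≠ 0 → 0 < b v v)
    (P : V →L[ℝ] U) (hP : Function.Surjective P) :
    ∃ Q : U →L[ℝ] U →L[ℝ] ℝ, (∀ u v, Q u v = Q v u) ∧ (∀ u, u ≠ 0 → 0 < Q u u) ∧
      (∀ u, ∃ v, P v = u ∧ ∀ z, P z = 0 → b v z = 0) ∧ IsometricOnHorizontal b Q P := by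
  let N := P.ker
  let bf : LinearMap.BilinForm ℝ V := LinearMap.mk₂ ℝ (fun v w => b v w) (by simp) (by simp)
    (by simp) (by simp)
  have hrefl : bf.IsRefl := fun v w h => (hs w v).trans h
  have hc : IsCompl N (bf.orthogonal N) := by
    refine LinearMap.BilinForm.isCompl_orthogonal_of_restrict_nondegenerate hrefl ?_
    exact nondegenerate_of_pos fun v hv => hpos v (by simpa using hv)
  have hperp : ∀ v, v ∈ bf.orthogonal N ↔ ∀ z, P z = 0 → b v z = 0 := fun v => by
    refine forall_congr' fun z => forall_congr' fun hz => ?_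
    exact Eq.congr_left (hs z v)
  have hbij : Function.Bijective (P.toLinearMap.domRestrict (bf.orthogonal N)) := by
    constructor
    · refine (injective_iff_map_eq_zero _).2 fun v hv => ?_
      exact Subtype.ext (Submodule.disjoint_def.1 hc.disjoint _ hv v.2)
    · intro u
      obtain ⟨v, rfl⟩ := hP u
      obtain ⟨x, hx, y, hy, rfl⟩ := Submodule.mem_sup.1
        (hc.sup_eq_top ▸ Submodule.mem_top : v ∈ N ⊔ bf.orthogonal N)
      refine ⟨⟨y, hy⟩, ?_⟩
      have : P x = 0 := hx
      simp [this]
  let s : U →L[ℝ] V := LinearMap.toContinuousLinearMap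
    ((bf.orthogonal N).subtype ∘ₗ (LinearEquiv.ofBijective _ hbij).symm.toLinearMap)
  have hsP : ∀ u, P (s u) = u := fun u =>
    (LinearEquiv.ofBijective _ hbij).apply_symm_apply u
  have hsh : ∀ u z, P z = 0 → b (s u) z = 0 := fun u =>
    (hperp _).1 ((LinearEquiv.ofBijective _ hbij).symm u).2
  have hsv : ∀ v, (∀ z, P z = 0 → b v z = 0) → s (P v) = v := fun v hv => by
    have h1 : P (s (P v) - v) = 0 := by rw [map_sub, hsP, sub_self]
    have h2 : b (s (P v) - v) (s (P v) - v) = 0 := by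
      rw [map_sub b, sub_apply, hsh _ _ h1, hv _ h1, sub_zero]
    by_contra h3
    exact (hpos _ (sub_ne_zero.2 h3)).ne' h2
  refine ⟨b.bilinearComp s s, fun u v => hs _ _, fun u hu => hpos _ fun h => hu ?_,
    fun u => ⟨s u, hsP u, hsh u⟩, fun v w hv hw => ?_⟩
  · rw [← hsP u]
    exact (congrArg P h).trans (map_zero P)
  · rw [ContinuousLinearMap.bilinearComp_apply, hsv v hv, hsv w hw]

/-- The map A' carries horizontal vectors of P' to horizontal vectors of P, where the isometry
property is known. -/
theorem IsometricOnHorizontal.transport {b b' : V →L[ℝ] V →L[ℝ] ℝ} {Q Q' : U →L[ℝ] U →L[ℝ] ℝ}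
    {P P' : V →L[ℝ] U} (h : IsometricOnHorizontal b Q P) {A A' : V →L[ℝ] V} {S : U →L[ℝ] U}
    (hA : ∀ v, A (A' v) = v) (hb : ∀ v w, b' (A v) (A w) = b v w)
    (hQ : ∀ u v, Q' (S u) (S v) = Q u v) (hP : ∀ v, P' (A v) = S (P v)) :
    IsometricOnHorizontal b' Q' P' := by
  intro v w hv hw
  have key : ∀ v, (∀ z, P' z = 0 → b' v z = 0) → ∀ z, P z = 0 → b (A' v) z = 0 := by
    intro v hv z hz
    rw [← hb, hA]
    exact hv _ (by rw [hP, hz, map_zero])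
  rw [← hA v, ← hA w, hP, hP, hQ, hb]
  exact h _ _ (key v hv) (key w hw)

/-- The form on the quotient is preserved by the maps induced by isometries. -/
theorem IsometricOnHorizontal.invariant {b : V →L[ℝ] V →L[ℝ] ℝ} {Q : U →L[ℝ] U →L[ℝ] ℝ}
    {P : V →L[ℝ] U} (h : IsometricOnHorizontal b Q P)
    (hh : ∀ u, ∃ v, P v = u ∧ ∀ z, P z = 0 → b v z = 0) {A A' : V →L[ℝ] V} {S S' : U →L[ℝ] U}
    (hA : ∀ v, A (A' v) = v) (hb : ∀ v w, b (A v) (A w) = b v w)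
    (hP : ∀ v, P (A v) = S (P v)) (hP' : ∀ v, P (A' v) = S' (P v)) (u w : U) :
    Q (S u) (S w) = Q u w := by
  obtain ⟨u, rfl, hu⟩ := hh u
  obtain ⟨w, rfl, hw⟩ := hh w
  have key : ∀ v, (∀ z, P z = 0 → b v z = 0) → ∀ z, P z = 0 → b (A v) z = 0 := by
    intro v hv z hz
    rw [← hA z, hb]
    exact hv _ (by rw [hP', hz, map_zero])
  rw [← hP, ← hP, h _ _ (key u hu) (key w hw), hb, h _ _ hu hw]

end HorizontalForm

/-! ### Two-sided translations as isometries -/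

section TranslationInvariance

open Filter Topology Set

variable {n : ℕ} {G : Type*} [TopologicalSpace G] [ChartedSpace (EuclideanSpace ℝ (Fin n)) G]
  [Group G] [LieGroup (𝓡 n) ∞ G]

/-- The value of a Riemannian metric at a point, as a bilinear form on the model space. -/
noncomputable def metricForm {d : ℕ} {M : Type*} [TopologicalSpace M]
    [ChartedSpace (EuclideanSpace ℝ (Fin d)) M] [IsManifold (𝓡 d) ∞ M] (g : RiemMetric d M)
    (x : M) : EuclideanSpace ℝ (Fin d) →L[ℝ] EuclideanSpace ℝ (Fin d) →L[ℝ] ℝ :=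
  g.inner x

theorem PreservesMetric.metricForm_eq {d : ℕ} {M : Type*} [TopologicalSpace M]
    [ChartedSpace (EuclideanSpace ℝ (Fin d)) M] [IsManifold (𝓡 d) ∞ M] {g : RiemMetric d M}
    {f : M → M} (hf : PreservesMetric g f) {x y : M} (hxy : f x = y)
    {f' : EuclideanSpace ℝ (Fin d) →L[ℝ] EuclideanSpace ℝ (Fin d)}
    (h : HasMFDerivAt (𝓡 d) (𝓡 d) f x f') (v w : EuclideanSpace ℝ (Fin d)) :
    metricForm g y (f' v) (f' w) = metricForm g x v w := by
  subst hxy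
  have h1 := hf x v w
  rw [h.mfderiv] at h1
  exact h1

theorem IsBiInvariant.exists_hasMFDerivAt {g : RiemMetric n G} (hg : IsBiInvariant g)
    {a b x y x' : G} (h : a * x * b = y) (hx' : x' = x) :
    ∃ A A' : EuclideanSpace ℝ (Fin n) →L[ℝ] EuclideanSpace ℝ (Fin n),
      HasMFDerivAt (𝓡 n) (𝓡 n) (fun z : G => a * z * b) x A ∧
      HasMFDerivAt (𝓡 n) (𝓡 n) (fun z : G => a⁻¹ * z * b⁻¹) y A' ∧ (∀ v, A (A' v) = v) ∧
      ∀ v w, metricForm g y (A v) (A w) = metricForm g x' v w := by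
  subst hx'
  have hl (a x : G) : HasMFDerivAt (𝓡 n) (𝓡 n) (fun z : G => a * z) x
      (mfderiv (𝓡 n) (𝓡 n) (fun z : G => a * z) x) :=
    (contMDiff_mul_left.mdifferentiableAt (n := ∞) (by simp)).hasMFDerivAt
  have hr (a x : G) : HasMFDerivAt (𝓡 n) (𝓡 n) (fun z : G => z * a) x
      (mfderiv (𝓡 n) (𝓡 n) (fun z : G => z * a) x) :=
    (contMDiff_mul_right.mdifferentiableAt (n := ∞) (by simp)).hasMFDerivAt
  have h1 := HasMFDerivAt.comp_of_apply_eq (hr b (a * x')) (hl a x') rfl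
  have h2 := HasMFDerivAt.comp_of_apply_eq (hr b⁻¹ (a⁻¹ * y)) (hl a⁻¹ y) rfl
  refine ⟨_, _, h1, h2, ?_, fun v w => ?_⟩
  · have h3 := HasMFDerivAt.comp_of_apply_eq h1 h2
      (by rw [← h]; group : a⁻¹ * y * b⁻¹ = x')
    have h4 : (fun z : G => a * (a⁻¹ * z * b⁻¹) * b) = id := by ext z; simp [mul_assoc]
    rw [h4] at h3
    intro v
    exact DFunLike.congr_fun (hasMFDerivAt_unique h3 (hasMFDerivAt_id y)) v
  · exact ((hg.2 b).metricForm_eq h (hr b (a * x')) _ _).trans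
      ((hg.1 a).metricForm_eq rfl (hl a x') _ _)

end TranslationInvariance

/-! ### The projection near the identity and its differential -/

section LocalProjection

open Filter Topology Set

variable {n d : ℕ} {G : Type*} [TopologicalSpace G] [ChartedSpace (EuclideanSpace ℝ (Fin n)) G]
  [Group G] [LieGroup (𝓡 n) ∞ G] {K K' L : Subgroup G}
  [ChartedSpace (EuclideanSpace ℝ (Fin d)) (CosetSpace K L)]

/-- A `K`-equivariant map from `G` to `K/L` that is invariant under a transverse subgroup is smooth
at the identity. -/
theorem contMDiffAt_of_transverse [CompactSpace G] [T2Space G] (hK : IsClosed (K : Set G))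
    (hK' : IsClosed (K' : Set G))
    (hopen : ∀ U ∈ 𝓝 (1 : G), ∀ᶠ g in 𝓝 (1 : G), ∃ k ∈ K, k ∈ U ∧ k⁻¹ * g ∈ K') (hLK : L ≤ K)
    {π : G → CosetSpace K L} (hπ : ∀ (k : K), ∀ k' ∈ K', π (k * k') = QuotientGroup.mk k)
    {A : Type*} [NormedAddCommGroup A] [NormedSpace ℝ A] [FiniteDimensional ℝ A] {f : A → G}
    (hf : ContMDiff 𝓘(ℝ, A) (𝓡 n) ∞ f) (hfK : ∀ a, f a ∈ K) (hf0 : f 0 = 1)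
    {T : A →L[ℝ] EuclideanSpace ℝ (Fin n)} (hfT : HasFDerivAt (fun a => logChart n (f a)) T 0)
    (hT : Function.Injective T) {m : Submodule ℝ (EuclideanSpace ℝ (Fin n))}
    (hm : m ≤ lieSubspace n L) (hTm : Disjoint T.range m)
    (hd : Disjoint (T.range ⊔ m) (lieSubspace n (K ⊓ K')))
    (hs : T.range ⊔ m ⊔ lieSubspace n (K ⊓ K') = lieSubspace n K) {β : A → CosetSpace K L}
    (hβ : ContMDiffAt 𝓘(ℝ, A) (𝓡 d) ∞ β 0)
    (hβf : ∀ᶠ a in 𝓝 0, β a = QuotientGroup.mk ⟨f a, hfK a⟩) :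
    ContMDiffAt (𝓡 n) (𝓡 d) ∞ π 1 := by
  have hcompl := isCompl_lieSubspace hK hK' hopen hd hs
  obtain ⟨fm, m1, m2, m3, m4⟩ := exists_contMDiff_of_range_le (S := L) m.subtypeL
    (fun v => hm v.2)
  obtain ⟨fc, c1, c2, c3, c4⟩ := exists_contMDiff_of_range_le (S := K')
    (lieSubspace n K').subtypeL (by simp)
  let fK : A × m → G := fun p => f p.1 * fm p.2
  have k1 : ContMDiff 𝓘(ℝ, A × m) (𝓡 n) ∞ fK :=
    (hf.comp contDiff_fst.contMDiff).mul (m1.comp contDiff_snd.contMDiff)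
  have k3 : fK 0 = 1 := by simp [fK, hf0, m3]
  have k4 : HasFDerivAt (fun p => logChart n (fK p)) (T.coprod m.subtypeL) 0 :=
    HasFDerivAt.logChart_mul_prod hf0 m3 hf.continuous.continuousAt m1.continuous.continuousAt
      hfT m4
  -- In the coordinates f(a) fm(b) fc(c), with fm in L and fc in K', right K'-invariance removes c
  -- and passing to cosets of L removes b, so π depends on a alone.
  let Φ : (A × m) × lieSubspace n K' → G := fun p => fK p.1 * fc p.2
  have p1 : ContMDiff 𝓘(ℝ, (A × m) × lieSubspace n K') (𝓡 n) ∞ Φ :=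
    (k1.comp contDiff_fst.contMDiff).mul (c1.comp contDiff_snd.contMDiff)
  have p3 : Φ 0 = 1 := by
    change fK 0 * fc 0 = 1
    rw [k3, c3, one_mul]
  have p4 : HasFDerivAt (fun p => logChart n (Φ p))
      ((T.coprod m.subtypeL).coprod (lieSubspace n K').subtypeL) 0 :=
    HasFDerivAt.logChart_mul_prod k3 c3 k1.continuous.continuousAt c1.continuous.continuousAt
      k4 c4
  obtain ⟨e, he⟩ := ContinuousLinearMap.exists_equiv_coprod_subtypeL
    (ContinuousLinearMap.injective_coprod_subtypeL hT hTm) (W := lieSubspace n K')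
    (by rwa [ContinuousLinearMap.range_coprod_subtypeL])
  rw [← he] at p4
  obtain ⟨Θ, h1, h2, h3⟩ := exists_openPartialHomeomorph_of_hasFDerivAt p1 p3 e p4
  have hΘ1 : Θ 0 = 1 := (h1 0 h2).trans p3
  have ht1 : (1 : G) ∈ Θ.target := hΘ1 ▸ Θ.map_source h2
  have hΘs : Θ.symm 1 = 0 := by rw [← hΘ1, Θ.left_inv h2]
  have hsm : ContMDiffAt (𝓡 n) 𝓘(ℝ, A) ∞ (fun g => (Θ.symm g).1.1) 1 :=
    (contDiff_fst.comp contDiff_fst).contMDiff.contMDiffAt.comp (1 : G)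
      (h3.contMDiffAt (Θ.open_target.mem_nhds ht1))
  have hsm0 : (Θ.symm 1).1.1 = 0 := by rw [hΘs]; rfl
  have hcomp : ContMDiffAt (𝓡 n) (𝓡 d) ∞ (fun g => β (Θ.symm g).1.1) 1 := by
    refine ContMDiffAt.comp (g := β) (1 : G) ?_ hsm
    rw [hsm0]; exact hβ
  refine hcomp.congr_of_eventuallyEq ?_
  have hev : ∀ᶠ g in 𝓝 (1 : G), β (Θ.symm g).1.1 = QuotientGroup.mk ⟨f (Θ.symm g).1.1, hfK _⟩ := by
    have ht := hsm.continuousAt.tendsto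
    rw [hsm0] at ht
    exact ht.eventually hβf
  filter_upwards [hev, Θ.open_target.mem_nhds ht1] with g hg hgt
  rw [hg]
  have h5 : g = f (Θ.symm g).1.1 * fm (Θ.symm g).1.2 * fc (Θ.symm g).2 := by
    conv_lhs => rw [← Θ.right_inv hgt, h1 _ (Θ.map_target hgt)]
  have h6 := hπ ⟨f (Θ.symm g).1.1 * fm (Θ.symm g).1.2, K.mul_mem (hfK _) (hLK (m2 _))⟩ _
    (c2 (Θ.symm g).2)
  rw [← h5] at h6
  rw [h6]
  refine Eq.symm (QuotientGroup.eq.2 ?_)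
  rw [Subgroup.mem_subgroupOf]
  change (f (Θ.symm g).1.1)⁻¹ * (f (Θ.symm g).1.1 * fm (Θ.symm g).1.2) ∈ L
  rw [inv_mul_cancel_left]
  exact m2 _

/-- This will be applied to the inverse chart β of the coset space: if π ∘ f agrees with it near 0,
then P is onto already on the range of T. -/
theorem surjective_comp_of_eventually_eq {A : Type*} [NormedAddCommGroup A] [NormedSpace ℝ A]
    {M : Type*} [TopologicalSpace M] [ChartedSpace (EuclideanSpace ℝ (Fin d)) M] {π : G → M}
    {P : EuclideanSpace ℝ (Fin n) →L[ℝ] EuclideanSpace ℝ (Fin d)}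
    (hP : HasMFDerivAt (𝓡 n) (𝓡 d) π 1 P) {f : A → G} (hf : ContMDiff 𝓘(ℝ, A) (𝓡 n) ∞ f)
    (hf0 : f 0 = 1) {T : A →L[ℝ] EuclideanSpace ℝ (Fin n)}
    (hfT : HasFDerivAt (fun a => logChart n (f a)) T 0) {β : A → M}
    (hβ : Function.Surjective (mfderiv 𝓘(ℝ, A) (𝓡 d) β 0)) (h : ∀ᶠ a in 𝓝 0, β a = π (f a)) :
    Function.Surjective (P.comp T) := by
  have h1 := HasMFDerivAt.comp_of_apply_eq hP
    (hasMFDerivAt_of_logChart n hf0 hf.continuous.continuousAt hfT) hf0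
  have h2 := (h1.congr_of_eventuallyEq h).mfderiv
  intro y
  obtain ⟨x, hx⟩ := hβ y
  exact ⟨x, (DFunLike.congr_fun h2 x).symm.trans hx⟩

variable {π : G → CosetSpace K L} {P : EuclideanSpace ℝ (Fin n) →L[ℝ] EuclideanSpace ℝ (Fin d)}

/-- The derivative at the identity of the adjoint action. -/
theorem hasMFDerivAt_conj (h : G) : HasMFDerivAt (𝓡 n) (𝓡 n) (fun g : G => h * g * h⁻¹) 1
    (adMap h : EuclideanSpace ℝ (Fin n) →L[ℝ] EuclideanSpace ℝ (Fin n)) :=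
  ((contMDiff_conjMap h).mdifferentiableAt (by simp)).hasMFDerivAt

/-- Differentiate π(h g h⁻¹) = h π(g): the factor h⁻¹ on the right lies in K', and h on the left
acts by equivariance. -/
theorem apply_adMap_of_mem_inf (hP : HasMFDerivAt (𝓡 n) (𝓡 d) π 1 P)
    (hτ : ∀ k : K, ContMDiff (𝓡 d) (𝓡 d) ∞ (fun y : CosetSpace K L => k • y))
    (hπ1 : π 1 = QuotientGroup.mk 1)
    (hπK : ∀ (k : K) (g : G), π (k * g) = k • π g) (hπK' : ∀ g, ∀ k' ∈ K', π (g * k') = π g)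
    (h : K) (hh : (h : G) ∈ K') (X : EuclideanSpace ℝ (Fin n)) :
    P ((adMap (h : G) : EuclideanSpace ℝ (Fin n) →L[ℝ] EuclideanSpace ℝ (Fin n)) X) =
      smulDeriv d h (QuotientGroup.mk 1 : CosetSpace K L) (P X) := by
  have h1 := HasMFDerivAt.comp_of_apply_eq hP (hasMFDerivAt_conj (h : G)) (by simp)
  have h2 := HasMFDerivAt.comp_of_apply_eq
    (hasMFDerivAt_smul hτ h (QuotientGroup.mk 1 : CosetSpace K L)) hP hπ1
  have h3 : (fun g => π (h * g * (h : G)⁻¹)) = fun g => h • π g := by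
    ext g
    rw [hπK' _ _ (K'.inv_mem hh), hπK]
  rw [h3] at h1
  exact DFunLike.congr_fun (hasMFDerivAt_unique h1 h2) X

/-- An element l of L need not lie in K', so π(l g l⁻¹) = l π(g) is available only for g in K, where
π is the coset map. Testing along curves in K therefore restricts X to the Lie algebra of K. -/
theorem apply_adMap_of_mem (hP : HasMFDerivAt (𝓡 n) (𝓡 d) π 1 P)
    (hτ : ∀ k : K, ContMDiff (𝓡 d) (𝓡 d) ∞ (fun y : CosetSpace K L => k • y))
    (hπ : ∀ k : K, π k = QuotientGroup.mk k)
    (l : K) (hl : (l : G) ∈ L) {X : EuclideanSpace ℝ (Fin n)} (hX : X ∈ lieSubspace n K) :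
    P ((adMap (l : G) : EuclideanSpace ℝ (Fin n) →L[ℝ] EuclideanSpace ℝ (Fin n)) X) =
      smulDeriv d l (QuotientGroup.mk 1 : CosetSpace K L) (P X) := by
  obtain ⟨γ, g1, g2, g3, g4⟩ := mem_lieSubspace.1 hX
  have hγ : HasMFDerivAt 𝓘(ℝ, ℝ) (𝓡 n) γ 0 (ContinuousLinearMap.toSpanSingleton ℝ X) :=
    hasMFDerivAt_of_logChart n g3 g1.continuous.continuousAt g4.hasFDerivAt
  have h1 := HasMFDerivAt.comp_of_apply_eq hP
    (HasMFDerivAt.comp_of_apply_eq (hasMFDerivAt_conj (l : G)) hγ g3) (by rw [g3]; simp)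
  have hπ1 : π 1 = QuotientGroup.mk 1 := hπ 1
  have h2 := HasMFDerivAt.comp_of_apply_eq
    (hasMFDerivAt_smul hτ l (QuotientGroup.mk 1 : CosetSpace K L))
    (HasMFDerivAt.comp_of_apply_eq hP hγ g3) (by rw [g3, hπ1])
  have h3 : (fun t => π (l * γ t * (l : G)⁻¹)) = fun t => l • π (γ t) := by
    ext t
    have e1 := hπ (l * ⟨γ t, g2 t⟩ * l⁻¹)
    have e2 := hπ ⟨γ t, g2 t⟩
    simp only [Subgroup.coe_mul, Subgroup.coe_inv] at e1 e2
    rw [e1, e2]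
    refine QuotientGroup.eq.2 ?_
    rw [Subgroup.mem_subgroupOf]
    simpa [mul_assoc] using hl
  rw [h3] at h1
  have h4 := DFunLike.congr_fun (hasMFDerivAt_unique h1 h2) (1 : ℝ)
  have e : (ContinuousLinearMap.toSpanSingleton ℝ X) (1 : ℝ) = X := one_smul ℝ X
  exact (congrArg (fun Y => P ((adMap (l : G) :
    EuclideanSpace ℝ (Fin n) →L[ℝ] EuclideanSpace ℝ (Fin n)) Y)) e.symm).trans (h4.trans
    (congrArg (fun Y => smulDeriv d l (QuotientGroup.mk 1 : CosetSpace K L) (P Y)) e))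

end LocalProjection

/-! ### Topology of coset spaces and connected fibres -/

section CosetTopology

open Topology Set Filter

variable {G : Type*} [Group G] [TopologicalSpace G] [IsTopologicalGroup G]

theorem QuotientGroup.t2Space_of_isClosed {K : Subgroup G} (hK : IsClosed (K : Set G)) :
    T2Space (G ⧸ K) := by
  have h : IsOpenQuotientMap (QuotientGroup.mk : G → G ⧸ K) :=
    ⟨QuotientGroup.mk_surjective, QuotientGroup.continuous_mk, QuotientGroup.isOpenMap_coe⟩
  rw [t2Space_iff_of_isOpenQuotientMap h]
  have : {p : G × G | (QuotientGroup.mk p.1 : G ⧸ K) = QuotientGroup.mk p.2} =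
      (fun p : G × G => p.1⁻¹ * p.2) ⁻¹' K := by
    ext p
    exact QuotientGroup.eq
  rw [this]
  exact hK.preimage (by fun_prop)

/-- If `G = K K'` for a compact group `G`, the factor in `K` can be chosen small near `1`. -/
theorem eventually_exists_mem_inv_mul_mem [CompactSpace G] {K K' : Subgroup G}
    (hK : IsClosed (K : Set G)) (hK' : IsClosed (K' : Set G))
    (hKK' : ∀ g : G, ∃ k ∈ K, k⁻¹ * g ∈ K') {U : Set G} (hU : U ∈ 𝓝 1) :
    ∀ᶠ g in 𝓝 (1 : G), ∃ k ∈ K, k ∈ U ∧ k⁻¹ * g ∈ K' := by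
  have : T2Space (G ⧸ K') := QuotientGroup.t2Space_of_isClosed hK'
  have : CompactSpace K := isCompact_iff_compactSpace.1 hK.isCompact
  have : ContinuousSMul K (G ⧸ K') :=
    ⟨(continuous_smul (M := G) (X := G ⧸ K')).comp
      ((continuous_subtype_val.comp continuous_fst).prodMk continuous_snd)⟩
  have hbase : ∀ y : G ⧸ K', ∃ k : K, k • (QuotientGroup.mk 1 : G ⧸ K') = y := by
    intro y
    obtain ⟨g, rfl⟩ := QuotientGroup.mk_surjective y
    obtain ⟨k, hk, hg⟩ := hKK' g
    refine ⟨⟨k, hk⟩, ?_⟩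
    change (QuotientGroup.mk (k * 1) : G ⧸ K') = _
    rw [mul_one]
    exact QuotientGroup.eq.2 hg
  have : MulAction.IsPretransitive K (G ⧸ K') := ⟨fun x y => by
    obtain ⟨k, rfl⟩ := hbase x
    obtain ⟨k', rfl⟩ := hbase y
    exact ⟨k' * k⁻¹, by rw [mul_smul, inv_smul_smul]⟩⟩
  -- A Baire category argument: the compact group K acts transitively on the compact Hausdorff space
  -- G/K', so orbit maps are open.
  have ho := isOpenMap_smul_of_sigmaCompact (G := K) (QuotientGroup.mk 1 : G ⧸ K')
  have h1 : (Subtype.val : K → G) ⁻¹' U ∈ 𝓝 (1 : K) :=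
    continuous_subtype_val.continuousAt.preimage_mem_nhds hU
  have h2 := ho.image_mem_nhds h1
  have h3 : Tendsto (QuotientGroup.mk : G → G ⧸ K') (𝓝 1)
      (𝓝 ((1 : K) • (QuotientGroup.mk 1 : G ⧸ K'))) := by
    rw [one_smul]
    exact QuotientGroup.continuous_mk.continuousAt
  filter_upwards [h3 h2] with g hg
  obtain ⟨k, hkU, hk⟩ := hg
  refine ⟨k, k.2, hkU, QuotientGroup.eq.1 ?_⟩
  change (QuotientGroup.mk ((k : G) * 1) : G ⧸ K') = _ at hk
  rwa [mul_one] at hk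

/-- The fibres of `G → G/K₁ = K₂/H → K₂/L` are connected if `K₁` and `L/H` are. -/
theorem HomogeneousIdentification.isConnected_preimage [CompactSpace G] {K₁ K₂ H L : Subgroup G}
    (hK₁ : IsClosed (K₁ : Set G)) (hL : IsClosed (L : Set G)) (hHL : H ≤ L) (hLK₂ : L ≤ K₂)
    (F : HomogeneousIdentification K₁ K₂ H) (h₁ : ConnectedSpace K₁)
    (h₂ : ConnectedSpace (CosetSpace L H)) (b : CosetSpace K₂ L) :
    IsConnected ((fun x : G => cosetProj K₂ hHL (F.toEquiv.symm (QuotientGroup.mk x))) ⁻¹' {b}) := by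
  have : T2Space (G ⧸ K₁) := QuotientGroup.t2Space_of_isClosed hK₁
  have : CompactSpace L := isCompact_iff_compactSpace.1 hL.isCompact
  obtain ⟨k₀, rfl⟩ := QuotientGroup.mk_surjective b
  let ι₀ : CosetSpace L H → CosetSpace K₂ H :=
    Quotient.map' (Subgroup.inclusion hLK₂) fun x y h => by
      rw [QuotientGroup.leftRel_apply, Subgroup.mem_subgroupOf] at h ⊢
      exact h
  -- ι parametrizes by L/H the fibre of K₂/H → K₂/L over k₀L.
  let ι : CosetSpace L H → CosetSpace K₂ H := fun x => k₀ • ι₀ x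
  have hι : ∀ l : L, ι (QuotientGroup.mk l) = QuotientGroup.mk (k₀ * Subgroup.inclusion hLK₂ l) :=
    fun _ => rfl
  obtain ⟨a, ha⟩ := QuotientGroup.mk_surjective (F.toEquiv (QuotientGroup.mk 1))
  have hF : ∀ k : K₂, F.toEquiv (QuotientGroup.mk k) = QuotientGroup.mk ((k : G) * a) := by
    intro k
    have h := F.map_smul k (QuotientGroup.mk 1)
    rw [← ha] at h
    change F.toEquiv (QuotientGroup.mk (k * 1)) = _ at h
    rwa [mul_one] at h
  -- F itself is not assumed continuous; continuity comes from the formula F(kH) = k a K₁.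
  have hcont : Continuous fun x => F.toEquiv (ι x) := by
    refine (QuotientGroup.isQuotientMap_mk (H.subgroupOf L)).continuous_iff.2 ?_
    have h : (fun x => F.toEquiv (ι x)) ∘ (QuotientGroup.mk : L → CosetSpace L H) =
        fun l : L => (QuotientGroup.mk ((k₀ : G) * l * a) : G ⧸ K₁) := by
      ext l
      rw [Function.comp_apply, hι, hF]
      rfl
    rw [h]
    exact QuotientGroup.continuous_mk.comp (by fun_prop)
  have hZ : IsConnected (range fun x => F.toEquiv (ι x)) := isConnected_range hcont
  have hZc : IsClosed (range fun x => F.toEquiv (ι x)) := (isCompact_range hcont).isClosed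
  have hq : IsOpenQuotientMap (QuotientGroup.mk : G → G ⧸ K₁) :=
    ⟨QuotientGroup.mk_surjective, QuotientGroup.continuous_mk, QuotientGroup.isOpenMap_coe⟩
  have hfib : ∀ y : G ⧸ K₁, IsConnected ((QuotientGroup.mk : G → G ⧸ K₁) ⁻¹' {y}) := by
    intro y
    obtain ⟨g, rfl⟩ := QuotientGroup.mk_surjective y
    have : (QuotientGroup.mk : G → G ⧸ K₁) ⁻¹' {QuotientGroup.mk g} =
        range fun k : K₁ => g * k := by
      ext x
      rw [mem_preimage, mem_singleton_iff, eq_comm, QuotientGroup.eq]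
      exact ⟨fun h => ⟨⟨_, h⟩, by simp⟩, by rintro ⟨k, rfl⟩; simp⟩
    rw [this]
    exact isConnected_range (by fun_prop)
  -- The preimage of a closed connected set under a quotient map with connected fibres is connected;
  -- closedness comes from compactness of L/H.
  have key := hq.isQuotientMap.isCoinducing.isConnected_preimage_of_isClosed hfib hZc hZ
  convert key using 1
  ext x
  rw [mem_preimage, mem_preimage, mem_singleton_iff]
  obtain ⟨k, hk⟩ := QuotientGroup.mk_surjective (F.toEquiv.symm (QuotientGroup.mk x))
  have hx : (QuotientGroup.mk x : G ⧸ K₁) = F.toEquiv (QuotientGroup.mk k) := by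
    rw [hk, Equiv.apply_symm_apply]
  rw [hx, Equiv.symm_apply_apply]
  change (QuotientGroup.mk k : CosetSpace K₂ L) = QuotientGroup.mk k₀ ↔ _
  rw [eq_comm, QuotientGroup.eq, Subgroup.mem_subgroupOf]
  constructor
  · intro h
    refine ⟨QuotientGroup.mk ⟨_, h⟩, congrArg F.toEquiv ?_⟩
    rw [hι]
    congr 1
    ext
    simp
  · rintro ⟨z, hz⟩
    obtain ⟨l, rfl⟩ := QuotientGroup.mk_surjective z
    have h := F.toEquiv.injective hz
    rw [hι, QuotientGroup.eq, Subgroup.mem_subgroupOf] at h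
    have h' := L.mul_mem l.2 (hHL h)
    simpa [mul_assoc] using h'

end CosetTopology

/-! ### From one point to a Riemannian submersion -/

section Submersion

open Topology Set Filter

variable {n d : ℕ} {G : Type*} [TopologicalSpace G] [ChartedSpace (EuclideanSpace ℝ (Fin n)) G]
  [Group G] [LieGroup (𝓡 n) ∞ G] {K K' L : Subgroup G}
  [ChartedSpace (EuclideanSpace ℝ (Fin d)) (CosetSpace K L)]

/-- An equivariant projection of `G = K K'` onto `K/L` is a Riemannian submersion as soon as its
differential is an isometry on the horizontal vectors at one point. -/
theorem isRiemannianSubmersion_of_equivariant [IsManifold (𝓡 d) ∞ (CosetSpace K L)]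
    {g₀ : RiemMetric n G} (hg₀ : IsBiInvariant g₀) {g : RiemMetric d (CosetSpace K L)}
    (hg : ∀ k : K, PreservesMetric g fun y => k • y)
    (hτ : ∀ k : K, ContMDiff (𝓡 d) (𝓡 d) ∞ (fun y : CosetSpace K L => k • y)) {a : G}
    (hKK' : ∀ x : G, ∃ k : K, ∃ k' ∈ K', x = k * k' * a) {π : G → CosetSpace K L}
    (hπ : ∀ k : K, ∀ k' ∈ K', π (k * k' * a) = QuotientGroup.mk k)
    (hsm : ContMDiffAt (𝓡 n) (𝓡 d) ∞ (fun x => π (x * a)) 1)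
    {P : EuclideanSpace ℝ (Fin n) →L[ℝ] EuclideanSpace ℝ (Fin d)}
    (hP : HasMFDerivAt (𝓡 n) (𝓡 d) (fun x => π (x * a)) 1 P) (hPs : Function.Surjective P)
    (hiso : IsometricOnHorizontal (metricForm g₀ 1) (metricForm g (QuotientGroup.mk 1)) P) :
    IsRiemannianSubmersion g₀ g π := by
  have hequiv : ∀ (k : K), ∀ k' ∈ K', ∀ z, π (k * z * (k' * a)) = k • π (z * a) := by
    intro k k' hk' z
    obtain ⟨k₁, k₁', hk₁', hz⟩ := hKK' (z * a)
    have hz' : z = k₁ * k₁' := mul_right_cancel hz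
    rw [hz, hπ _ _ hk₁', hz']
    refine Eq.trans ?_ (hπ (k * k₁) _ (K'.mul_mem hk₁' hk'))
    simp [mul_assoc]
  have hπ1 : π (1 * a) = QuotientGroup.mk 1 := by
    simpa using hπ 1 1 K'.one_mem
  -- Each x is the image of 1 under z ↦ k z (k'a), an isometry of G that relates z ↦ π(za) near 1 to
  -- π near x through the action of k.
  have hlocal : ∀ x : G, ∃ A : EuclideanSpace ℝ (Fin n) →L[ℝ] EuclideanSpace ℝ (Fin n),
      ∃ A' : EuclideanSpace ℝ (Fin n) →L[ℝ] EuclideanSpace ℝ (Fin n), ∃ k : K,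
      (∀ v, A (A' v) = v) ∧ (∀ v w, metricForm g₀ x (A v) (A w) = metricForm g₀ 1 v w) ∧
      k • (QuotientGroup.mk 1 : CosetSpace K L) = π x ∧ ContMDiffAt (𝓡 n) (𝓡 d) ∞ π x ∧
      ∀ P' : EuclideanSpace ℝ (Fin n) →L[ℝ] EuclideanSpace ℝ (Fin d),
        HasMFDerivAt (𝓡 n) (𝓡 d) π x P' →
        ∀ v, P' (A v) = smulDeriv d k (QuotientGroup.mk 1 : CosetSpace K L) (P v) := by
    intro x
    obtain ⟨k, k', hk', hx⟩ := hKK' x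
    have hx1 : (k : G) * 1 * (k' * a) = x := by rw [hx]; group
    obtain ⟨A, A', hA, -, hAA', hiso'⟩ := hg₀.exists_hasMFDerivAt hx1 (rfl : (1 : G) = 1)
    have hkx : k • (QuotientGroup.mk 1 : CosetSpace K L) = π x := by
      rw [← hx1, hequiv k k' hk', hπ1]
    refine ⟨A, A', k, hAA', hiso', hkx, ?_, fun P' hP' v => ?_⟩
    · have h1 : π = fun z => k • π ((k : G)⁻¹ * z * (k' * a)⁻¹ * a) := by
        ext z
        rw [← hequiv k k' hk']
        congr 1
        group
      have h2 : (k : G)⁻¹ * x * (k' * a)⁻¹ = 1 := by rw [hx]; group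
      have h3 : ContMDiff (𝓡 n) (𝓡 n) ∞ (fun z : G => (k : G)⁻¹ * z * (k' * a)⁻¹) :=
        (contMDiff_const.mul contMDiff_id).mul contMDiff_const
      rw [h1]
      refine (hτ k).contMDiffAt.comp x ?_
      refine ContMDiffAt.comp (g := fun z => π (z * a))
        (f := fun z : G => (k : G)⁻¹ * z * (k' * a)⁻¹) x ?_ h3.contMDiffAt
      rw [h2]
      exact hsm
    · have h1 := HasMFDerivAt.comp_of_apply_eq hP' hA hx1
      have h2 := HasMFDerivAt.comp_of_apply_eq
        (hasMFDerivAt_smul hτ k (QuotientGroup.mk 1 : CosetSpace K L)) hP hπ1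
      have h3 : (fun z => π (k * z * (k' * a))) = fun z => k • π (z * a) := by
        ext z
        exact hequiv k k' hk' z
      rw [h3] at h1
      exact DFunLike.congr_fun (hasMFDerivAt_unique h1 h2) v
  have hsmooth : ContMDiff (𝓡 n) (𝓡 d) ∞ π := fun x => by
    obtain ⟨A, A', k, -, -, -, h, -⟩ := hlocal x
    exact h
  have hd : ∀ x, HasMFDerivAt (𝓡 n) (𝓡 d) π x (mfderiv (𝓡 n) (𝓡 d) π x) := fun x =>
    (hsmooth.mdifferentiableAt (by simp)).hasMFDerivAt
  refine ⟨hsmooth, fun y => ?_, fun x => ?_, fun x v w hv hw => ?_⟩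
  · obtain ⟨k, rfl⟩ := QuotientGroup.mk_surjective y
    exact ⟨_, hπ k 1 K'.one_mem⟩
  · obtain ⟨A, A', k, -, -, hk, -, h⟩ := hlocal x
    intro u
    have hS := smulDeriv_mul hτ (k := k) (k' := k⁻¹) (y := π x)
      (y' := (QuotientGroup.mk 1 : CosetSpace K L)) (by rw [← hk, inv_smul_smul])
    rw [mul_inv_cancel, smulDeriv_one] at hS
    obtain ⟨v, hv⟩ := hPs (smulDeriv d k⁻¹ (π x) u)
    refine ⟨A v, (h _ (hd x) v).trans ?_⟩
    rw [hv]
    exact (DFunLike.congr_fun hS u).symm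
  · obtain ⟨A, A', k, h1, h2, hk, -, h⟩ := hlocal x
    exact hiso.transport (b' := metricForm g₀ x) (Q' := metricForm g (π x)) (A' := A') h1 h2
      (fun u v => (hg k).metricForm_eq hk (hasMFDerivAt_smul hτ k _) u v) (h _ (hd x)) v w hv hw

end Submersion

/-! ### Invariance of the horizontal form under the isotropy group -/

section Invariance

open Topology Set Filter

variable {n d : ℕ} {G : Type*} [TopologicalSpace G] [ChartedSpace (EuclideanSpace ℝ (Fin n)) G]
  [Group G] [LieGroup (𝓡 n) ∞ G] {K K' H L : Subgroup G}
  [ChartedSpace (EuclideanSpace ℝ (Fin d)) (CosetSpace K L)]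

theorem IsBiInvariant.metricForm_adMap {g : RiemMetric n G} (hg : IsBiInvariant g) (a : G)
    (v w : EuclideanSpace ℝ (Fin n)) :
    metricForm g 1 ((adMap a : EuclideanSpace ℝ (Fin n) →L[ℝ] EuclideanSpace ℝ (Fin n)) v)
      ((adMap a : EuclideanSpace ℝ (Fin n) →L[ℝ] EuclideanSpace ℝ (Fin n)) w) =
      metricForm g 1 v w := by
  obtain ⟨A, A', hA, -, -, h⟩ := hg.exists_hasMFDerivAt (a := a) (b := a⁻¹) (x := 1) (y := 1)
    (by simp) (rfl : (1 : G) = 1)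
  have e : A = adMap a := hasMFDerivAt_unique hA (hasMFDerivAt_conj a)
  exact (congrArg (fun C : EuclideanSpace ℝ (Fin n) →L[ℝ] EuclideanSpace ℝ (Fin n) =>
    metricForm g 1 (C v) (C w)) e).symm.trans (h v w)

theorem adMap_apply_adMap_inv (a : G) (v : EuclideanSpace ℝ (Fin n)) :
    (adMap a : EuclideanSpace ℝ (Fin n) →L[ℝ] EuclideanSpace ℝ (Fin n))
      ((adMap a⁻¹ : EuclideanSpace ℝ (Fin n) →L[ℝ] EuclideanSpace ℝ (Fin n)) v) = v := by
  have h := adMap_mul (n := n) a a⁻¹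
  rw [mul_inv_cancel, adMap_one] at h
  exact (DFunLike.congr_fun h v).symm

/-- The form that the horizontal space at the identity induces on the tangent space of `K/L` at the
base point is invariant under the isotropy group `L`. -/
theorem IsometricOnHorizontal.smulDeriv_eq {g₀ : RiemMetric n G} (hg₀ : IsBiInvariant g₀)
    (hτ : ∀ k : K, ContMDiff (𝓡 d) (𝓡 d) ∞ (fun y : CosetSpace K L => k • y))
    (hHL : H ≤ L) (hLK : L ≤ K) (hHK' : H ≤ K') {π : G → CosetSpace K L}
    {P : EuclideanSpace ℝ (Fin n) →L[ℝ] EuclideanSpace ℝ (Fin d)}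
    (hP : HasMFDerivAt (𝓡 n) (𝓡 d) π 1 P) (hπ : ∀ k : K, π k = QuotientGroup.mk k)
    (hπK : ∀ (k : K) (g : G), π (k * g) = k • π g) (hπK' : ∀ g, ∀ k' ∈ K', π (g * k') = π g)
    {Q : EuclideanSpace ℝ (Fin d) →L[ℝ] EuclideanSpace ℝ (Fin d) →L[ℝ] ℝ}
    (hQs : ∀ u v, Q u v = Q v u)
    (hQh : ∀ u, ∃ v, P v = u ∧ ∀ z, P z = 0 → metricForm g₀ 1 v z = 0)
    (hiso : IsometricOnHorizontal (metricForm g₀ 1) Q P)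
    {m : Submodule ℝ (EuclideanSpace ℝ (Fin n))} (hm : m ≤ lieSubspace n K)
    (hPm : ∀ u, ∃ v ∈ m, P v = u) {ι : Type*} (q : ι → Subrepresentation (adRepOn n L))
    (hqm : ⨆ i, (q i).toSubmodule = m)
    (hq : ∀ i, ((q i).restrictTo hHL).toRepresentation.IsIrreducible)
    (hqq : ∀ i j, i ≠ j →
      Nonempty (((q i).restrictTo hHL).toRepresentation.Equiv
        ((q j).restrictTo hHL).toRepresentation) →
      Nonempty ((q i).toRepresentation.Equiv (q j).toRepresentation) ∧
      ∃ t : RealRepType,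
        ((q j).restrictTo hHL).toRepresentation.HasRealType t ∧
        (q j).toRepresentation.HasRealType t)
    (l : K) (hl : (l : G) ∈ L) (u w : EuclideanSpace ℝ (Fin d)) :
    Q (smulDeriv d l (QuotientGroup.mk 1 : CosetSpace K L) u)
      (smulDeriv d l (QuotientGroup.mk 1 : CosetSpace K L) w) = Q u w := by
  -- For h in H both Ad(h) and Ad(h⁻¹) descend through P, and Ad(h) is an isometry, so Q is
  -- preserved.
  have hQH : ∀ h : K, (h : G) ∈ H → ∀ u w,
      Q (smulDeriv d h (QuotientGroup.mk 1 : CosetSpace K L) u)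
        (smulDeriv d h (QuotientGroup.mk 1 : CosetSpace K L) w) = Q u w := fun h hh =>
    hiso.invariant hQh (adMap_apply_adMap_inv (h : G)) (hg₀.metricForm_adMap (h : G))
      (apply_adMap_of_mem_inf hP hτ (hπ 1) hπK hπK' h (hHK' hh))
      (apply_adMap_of_mem_inf hP hτ (hπ 1) hπK hπK' h⁻¹ (K'.inv_mem (hHK' hh)))
  let B : LinearMap.BilinForm ℝ (EuclideanSpace ℝ (Fin n)) :=
    LinearMap.mk₂ ℝ (fun v w => metricForm g₀ 1 v w) (by simp) (by simp) (by simp) (by simp)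
  -- The pullback of Q by P, compared on the sum of the `q i` with the Ad-invariant form B of the
  -- bi-invariant metric.
  let b : LinearMap.BilinForm ℝ (EuclideanSpace ℝ (Fin n)) :=
    LinearMap.mk₂ ℝ (fun v w => Q (P v) (P w)) (by simp) (by simp) (by simp) (by simp)
  have had : ∀ l : K, (l : G) ∈ L → ∀ X ∈ m, P ((adMap (l : G) :
      EuclideanSpace ℝ (Fin n) →L[ℝ] EuclideanSpace ℝ (Fin n)) X) =
      smulDeriv d l (QuotientGroup.mk 1 : CosetSpace K L) (P X) := fun l hl X hX =>
    apply_adMap_of_mem hP hτ hπ l hl (hm hX)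
  have hqm' : ∀ i, (q i).toSubmodule ≤ m := fun i => hqm ▸ le_iSup (fun i => (q i).toSubmodule) i
  have key : ∀ X ∈ m, ∀ Y ∈ m, Q (P ((adMap (l : G) :
      EuclideanSpace ℝ (Fin n) →L[ℝ] EuclideanSpace ℝ (Fin n)) X)) (P ((adMap (l : G) :
      EuclideanSpace ℝ (Fin n) →L[ℝ] EuclideanSpace ℝ (Fin n)) Y)) = Q (P X) (P Y) := by
    intro X hX Y hY
    have : FiniteDimensional ℝ (GroupLieAlgebra (𝓡 n) G) :=
      inferInstanceAs (FiniteDimensional ℝ (EuclideanSpace ℝ (Fin n)))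
    refine invariant_of_invariant_subgroup (V := GroupLieAlgebra (𝓡 n) G) (ρ := adRep n G) hHL q hq
      hqq (B := B) (b := b) (fun v w => g₀.symm 1 v w) (fun v hv => g₀.pos 1 v hv)
      (fun l _ v w => hg₀.metricForm_adMap l v w) (fun v w => hQs _ _) ?_ hl
      (hqm.symm ▸ hX) (hqm.symm ▸ hY)
    intro h hh i j v hv w hw
    have e1 := had ⟨h, hLK (hHL hh)⟩ (hHL hh) v (hqm' i hv)
    have e2 := had ⟨h, hLK (hHL hh)⟩ (hHL hh) w (hqm' j hw)
    exact (congrArg₂ (fun u w => Q u w) e1 e2).trans (hQH ⟨h, hLK (hHL hh)⟩ hh _ _)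
  obtain ⟨X, hX, rfl⟩ := hPm u
  obtain ⟨Y, hY, rfl⟩ := hPm w
  rw [← had l hl X hX, ← had l hl Y hY]
  exact key X hX Y hY

end Invariance

/-! ### The submersion for a transverse pair of subgroups -/

section Existence

open Topology Set Filter

/-- For a compact group `G = K K'`, an equivariant projection of `G` onto `K/L` is a Riemannian
submersion for a suitable invariant metric on `K/L`, provided that every form on a complement of the
Lie algebra of `L` that is invariant under `K ∩ K'` is invariant under `L`. -/
theorem exists_isRiemannianSubmersion_of_transverse {n : ℕ} {G : Type*} [TopologicalSpace G]
    [ChartedSpace (EuclideanSpace ℝ (Fin n)) G] [Group G] [LieGroup (𝓡 n) ∞ G]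
    [CompactSpace G] [T2Space G] {g₀ : RiemMetric n G} (hg₀ : IsBiInvariant g₀)
    {K K' H L : Subgroup G} (hK : IsClosed (K : Set G)) (hK' : IsClosed (K' : Set G))
    (hL : IsClosed (L : Set G)) (hHL : H ≤ L) (hLK : L ≤ K) (hH : H = K ⊓ K')
    {m₁ m₂ : Submodule ℝ (EuclideanSpace ℝ (Fin n))}
    (hm₁ : Disjoint (lieSubspace n H) m₁) (hm₁' : lieSubspace n H ⊔ m₁ = lieSubspace n L)
    (hm₂ : Disjoint (lieSubspace n L) m₂) (hm₂' : lieSubspace n L ⊔ m₂ = lieSubspace n K)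
    {ι : Type*} (q : ι → Subrepresentation (adRepOn n L)) (hqm : ⨆ i, (q i).toSubmodule = m₂)
    (hq : ∀ i, ((q i).restrictTo hHL).toRepresentation.IsIrreducible)
    (hqq : ∀ i j, i ≠ j →
      Nonempty (((q i).restrictTo hHL).toRepresentation.Equiv
        ((q j).restrictTo hHL).toRepresentation) →
      Nonempty ((q i).toRepresentation.Equiv (q j).toRepresentation) ∧
      ∃ t : RealRepType,
        ((q j).restrictTo hHL).toRepresentation.HasRealType t ∧
        (q j).toRepresentation.HasRealType t)
    {a : G} (hKK' : ∀ x : G, ∃ k : K, ∃ k' ∈ K', x = k * k' * a) {π : G → CosetSpace K L}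
    (hπ : ∀ k : K, ∀ k' ∈ K', π (k * k' * a) = QuotientGroup.mk k) :
    ∃ (k d : ℕ) (_ : ChartedSpace (EuclideanSpace ℝ (Fin k)) K)
      (_ : ChartedSpace (EuclideanSpace ℝ (Fin d)) (CosetSpace K L))
      (hstd : IsStandardSmoothStructure (n := n) (k := k) (d := d) K L),
      haveI : IsManifold (𝓡 d) ∞ (CosetSpace K L) := hstd.isManifold
      ∃ g : RiemMetric d (CosetSpace K L),
        (∀ a : K, PreservesMetric g fun b => a • b) ∧ IsRiemannianSubmersion g₀ g π := by
  have : ContinuousMul G := continuousMul_of_lieGroup n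
  have : IsTopologicalGroup G := topologicalGroup_of_lieGroup (𝓡 n) ∞
  let d := Module.finrank ℝ m₂
  let iA : EuclideanSpace ℝ (Fin d) ≃L[ℝ] m₂ := ContinuousLinearEquiv.ofFinrankEq (by simp [d])
  let T : EuclideanSpace ℝ (Fin d) →L[ℝ] EuclideanSpace ℝ (Fin n) :=
    m₂.subtypeL.comp (iA : EuclideanSpace ℝ (Fin d) →L[ℝ] m₂)
  have hTi : Function.Injective T := Subtype.val_injective.comp iA.injective
  have hTr : T.range = m₂ := by
    ext x
    constructor
    · rintro ⟨y, rfl⟩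
      exact (iA y).2
    · intro hx
      exact ⟨iA.symm ⟨x, hx⟩, congrArg Subtype.val (iA.apply_symm_apply ⟨x, hx⟩)⟩
  have hm₂K : m₂ ≤ lieSubspace n K := hm₂' ▸ le_sup_right
  obtain ⟨f, hf, hfK, hf0, hfT⟩ := exists_contMDiff_of_range_le (S := K) T
    (fun v => hm₂K (iA v).2)
  obtain ⟨C, hC⟩ := Submodule.exists_isCompl (lieSubspace n K)
  have hd1 : Disjoint T.range (lieSubspace n L) := hTr.symm ▸ hm₂.symm
  have hs1 : T.range ⊔ lieSubspace n L = lieSubspace n K := by rw [hTr, sup_comm, hm₂']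
  obtain ⟨D, hD⟩ := exists_adaptedChart hK hL hLK hf hfK hf0 hfT hTi hd1 hs1 hC
  let k := Module.finrank ℝ (EuclideanSpace ℝ (Fin d) × lieSubspace n L)
  let e : EuclideanSpace ℝ (Fin k) ≃L[ℝ] EuclideanSpace ℝ (Fin d) × lieSubspace n L :=
    ContinuousLinearEquiv.ofFinrankEq (by simp [k])
  obtain ⟨eT, -⟩ := ContinuousLinearMap.exists_equiv_coprod_subtypeL
    (ContinuousLinearMap.injective_coprod_subtypeL hTi hd1) (W := C)
    (by rwa [ContinuousLinearMap.range_coprod_subtypeL, hs1])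
  let _ := D.chartedSpaceSubgroup e
  let _ := D.chartedSpaceCoset
  have hstd := D.isStandardSmoothStructure e eT
  have := hstd.isManifold
  have hτ := D.contMDiff_smul_coset
  obtain ⟨hβ, hβ'⟩ := D.contMDiffAt_chartCoset_symm
  have hβf : ∀ᶠ v in 𝓝 0, D.chartCoset.symm v = QuotientGroup.mk ⟨f v, hfK v⟩ := by
    filter_upwards [D.openA.mem_nhds D.zeroA] with v hv
    refine congrArg (QuotientGroup.mk : K → CosetSpace K L) (Subtype.ext ?_)
    exact (D.coe_param (p := (v, 0)) hv D.zeroB).trans (hD v hv)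
  have hopen : ∀ U ∈ 𝓝 (1 : G), ∀ᶠ g in 𝓝 (1 : G), ∃ k ∈ K, k ∈ U ∧ k⁻¹ * g ∈ K' := fun U hU =>
    eventually_exists_mem_inv_mul_mem hK hK' (fun g => by
      obtain ⟨x, x', hx', h⟩ := hKK' (g * a)
      exact ⟨x, x.2, by rwa [mul_right_cancel h, inv_mul_cancel_left]⟩) hU
  let ψ : G → CosetSpace K L := fun x => π (x * a)
  have hm₁L : m₁ ≤ lieSubspace n L := hm₁' ▸ le_sup_right
  have hdis : Disjoint (m₂ ⊔ m₁) (lieSubspace n H) := by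
    refine Disjoint.disjoint_sup_left_of_disjoint_sup_right hm₁.symm ?_
    rw [sup_comm, hm₁']
    exact hm₂.symm
  have hsm : ContMDiffAt (𝓡 n) (𝓡 d) ∞ ψ 1 :=
    contMDiffAt_of_transverse hK hK' hopen hLK hπ hf hfK hf0 hfT hTi hm₁L
      (hTr.symm ▸ hm₂.symm.mono_right hm₁L) (by rwa [hTr, ← hH])
      (by rw [hTr, ← hH, sup_assoc, sup_comm m₁, hm₁', sup_comm, hm₂']) hβ hβf
  obtain ⟨P, hP⟩ : ∃ P : EuclideanSpace ℝ (Fin n) →L[ℝ] EuclideanSpace ℝ (Fin d),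
      HasMFDerivAt (𝓡 n) (𝓡 d) ψ 1 P := ⟨_, (hsm.mdifferentiableAt (by simp)).hasMFDerivAt⟩
  have hψ : ∀ x : K, ψ x = QuotientGroup.mk x := fun x => by
    have := hπ x 1 K'.one_mem
    rwa [mul_one] at this
  have hψK : ∀ (x : K) (g : G), ψ (x * g) = x • ψ g := fun x g => by
    obtain ⟨y, y', hy', h⟩ := hKK' (g * a)
    have h1 := hπ (x * y) y' hy'
    have h2 : ψ g = QuotientGroup.mk y := by rw [← hπ y y' hy', ← h]
    rw [h2]
    refine Eq.trans ?_ h1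
    simp only [ψ, mul_assoc, Subgroup.coe_mul] at h ⊢
    rw [h]
  have hψK' : ∀ g, ∀ x' ∈ K', ψ (g * x') = ψ g := fun g x' hx' => by
    obtain ⟨y, y', hy', h⟩ := hKK' (g * a)
    have h2 : ψ g = QuotientGroup.mk y := by rw [← hπ y y' hy', ← h]
    rw [h2, ← hπ y _ (K'.mul_mem hy' hx'), mul_right_cancel h]
    simp only [ψ, mul_assoc]
  -- Along f, the map ψ is the inverse of the coset chart at the base point, so P is onto already on
  -- m₂.
  have hPT : Function.Surjective (P.comp T) :=
    surjective_comp_of_eventually_eq hP hf hf0 hfT hβ'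
      (hβf.mono fun v hv => hv.trans (hψ ⟨f v, hfK v⟩).symm)
  have hPs : Function.Surjective P := fun u => (hPT u).imp' T fun v hv => hv
  obtain ⟨Q, hQs, hQp, hQh, hiso⟩ := exists_isometricOnHorizontal (metricForm g₀ 1)
    (fun v w => g₀.symm 1 v w) (fun v hv => g₀.pos 1 v hv) P hPs
  have hQL := hiso.smulDeriv_eq hg₀ hτ hHL hLK (hH.trans_le inf_le_right) hP hψ hψK hψK' hQs hQh
    hm₂K (fun u => (hPT u).imp' T fun v hv => ⟨(iA v).2, hv⟩) q hqm hq hqq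
  -- The stabilizer of the base coset is L, so the L-invariance of Q is exactly what the extension
  -- requires.
  obtain ⟨g, hgQ, hg⟩ := exists_invariant_riemMetric hτ (QuotientGroup.mk 1)
    (D.exists_smooth_section e eT) Q hQs hQp (fun x hx => hQL x (by
      have h1 : (QuotientGroup.mk (x * 1) : CosetSpace K L) = QuotientGroup.mk 1 := hx
      rw [mul_one, eq_comm, QuotientGroup.eq, Subgroup.mem_subgroupOf] at h1
      simpa using h1))
  refine ⟨k, d, _, _, hstd, g, hg, isRiemannianSubmersion_of_equivariant hg₀ hg hτ hKK' hπ hsm hP hPs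
    fun v w hv hw => (hgQ _ _).trans (hiso v w hv hw)⟩

end Existence

/-! ### Reduction of the theorem to a transverse pair of subgroups -/

theorem mainTheorem7 {n : ℕ} {G : Type*} [TopologicalSpace G]
    [ChartedSpace (EuclideanSpace ℝ (Fin n)) G] [Group G] [LieGroup (𝓡 n) ∞ G]
    [CompactSpace G] [T2Space G] (hG : IsSemisimpleLieGroup n G)
    (g₀ : RiemMetric n G) (hg₀ : IsBiInvariant g₀)
    (K₁ K₂ H L : Subgroup G)
    (hK₁ : IsClosed (K₁ : Set G)) (hK₂ : IsClosed (K₂ : Set G))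
    (hH : IsClosed (H : Set G)) (hL : IsClosed (L : Set G))
    (hHL : H ≤ L) (hLK₂ : L ≤ K₂)
    (F : HomogeneousIdentification K₁ K₂ H)
    -- `𝔩 = 𝔥 ⊕ 𝔪₁` and `𝔨₂ = 𝔩 ⊕ 𝔪₂`
    (m₁ : Subrepresentation (adRepOn n H)) (m₂ : Subrepresentation (adRepOn n L))
    (hm₁ : Disjoint (lieAlgebraOf n H) m₁.toSubmodule)
    (hm₁' : lieAlgebraOf n H ⊔ m₁.toSubmodule = lieAlgebraOf n L)
    (hm₂ : Disjoint (lieAlgebraOf n L) m₂.toSubmodule)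
    (hm₂' : lieAlgebraOf n L ⊔ m₂.toSubmodule = lieAlgebraOf n K₂)
    -- the `Ad(H)`-irreducible decomposition of `𝔪₁`
    {r s : ℕ} (p : Fin r → Subrepresentation (adRepOn n H))
    (hp : IsIrreducibleDecomposition m₁.toSubmodule p)
    -- (i) a decomposition of `𝔪₂` that is irreducible both for `Ad(L)` and for `Ad(H)`
    (q : Fin s → Subrepresentation (adRepOn n L))
    (hqL : IsIrreducibleDecomposition m₂.toSubmodule q)
    (hqH : IsIrreducibleDecomposition m₂.toSubmodule fun j => (q j).restrictTo hHL)
    -- (ii) fibre and base summands are inequivalent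
    (hpq : ∀ i j, IsEmpty
      ((p i).toRepresentation.Equiv ((q j).restrictTo hHL).toRepresentation))
    -- (iii) distinct equivalent base summands are equivalent, and of one and the same type,
    -- with respect to both groups
    (hqq : ∀ i j, i ≠ j →
      Nonempty (((q i).restrictTo hHL).toRepresentation.Equiv
        ((q j).restrictTo hHL).toRepresentation) →
      Nonempty ((q i).toRepresentation.Equiv (q j).toRepresentation) ∧
      ∃ t : RealRepType,
        ((q i).restrictTo hHL).toRepresentation.HasRealType t ∧
        ((q j).restrictTo hHL).toRepresentation.HasRealType t ∧
        (q i).toRepresentation.HasRealType t ∧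
        (q j).toRepresentation.HasRealType t) :
    ∃ (k d : ℕ) (_ : ChartedSpace (EuclideanSpace ℝ (Fin k)) K₂)
      (_ : ChartedSpace (EuclideanSpace ℝ (Fin d)) (CosetSpace K₂ L))
      (hstd : IsStandardSmoothStructure (n := n) (k := k) (d := d) K₂ L),
      haveI : IsManifold (𝓡 d) ∞ (CosetSpace K₂ L) := hstd.isManifold
      ∃ (g : RiemMetric d (CosetSpace K₂ L)) (π : G → CosetSpace K₂ L),
        (∀ x : G, π x = cosetProj K₂ hHL (F.toEquiv.symm (QuotientGroup.mk x))) ∧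
        (∀ a : K₂, PreservesMetric g fun b => a • b) ∧
        IsRiemannianSubmersion g₀ g π ∧
        (ConnectedSpace K₁ → ConnectedSpace (CosetSpace L H) →
          ∀ b : CosetSpace K₂ L, IsConnected (π ⁻¹' {b})) := by
  have : ContinuousMul G := continuousMul_of_lieGroup n
  have : IsTopologicalGroup G := topologicalGroup_of_lieGroup (𝓡 n) ∞
  obtain ⟨a, ha⟩ := QuotientGroup.mk_surjective (F.toEquiv (QuotientGroup.mk 1))
  have hF : ∀ k : K₂, F.toEquiv (QuotientGroup.mk k) = QuotientGroup.mk ((k : G) * a) := by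
    intro k
    have h := F.map_smul k (QuotientGroup.mk 1)
    rw [← ha] at h
    change F.toEquiv (QuotientGroup.mk (k * 1)) = _ at h
    rwa [mul_one] at h
  -- K' = aK₁a⁻¹ is the stabilizer in G of the point F(eH) = aK₁, which need not be the base point
  -- of G/K₁.
  let K' : Subgroup G := K₁.comap (MulAut.conj a⁻¹).toMonoidHom
  have hmem : ∀ x, x ∈ K' ↔ a⁻¹ * x * a ∈ K₁ := fun x => by
    simp [K', Subgroup.mem_comap]
  have hK' : IsClosed (K' : Set G) := by
    have : (K' : Set G) = (fun x : G => a⁻¹ * x * a) ⁻¹' K₁ := Set.ext hmem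
    rw [this]
    exact hK₁.preimage (by fun_prop)
  -- By injectivity and equivariance of F, an element of K₂ fixes eH exactly when it fixes aK₁.
  have hH' : H = K₂ ⊓ K' := by
    ext x
    have key : ∀ hx : x ∈ K₂, x ∈ H ↔ a⁻¹ * x * a ∈ K₁ := fun hx => by
      have h1 : x ∈ H ↔ (QuotientGroup.mk 1 : CosetSpace K₂ H) = QuotientGroup.mk ⟨x, hx⟩ := by
        rw [QuotientGroup.eq, Subgroup.mem_subgroupOf]
        simp
      rw [h1, ← F.toEquiv.apply_eq_iff_eq, hF, hF, QuotientGroup.eq]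
      simp [mul_assoc]
    rw [Subgroup.mem_inf, hmem]
    exact ⟨fun hx => ⟨hLK₂ (hHL hx), (key (hLK₂ (hHL hx))).1 hx⟩, fun hx => (key hx.1).2 hx.2⟩
  let π : G → CosetSpace K₂ L := fun x =>
    cosetProj K₂ hHL (F.toEquiv.symm (QuotientGroup.mk x))
  -- Every coset xK₁ equals F(kH) = k a K₁ for some k in K₂; the remaining factor k⁻¹x a⁻¹ lies in
  -- K'.
  have hKK' : ∀ x : G, ∃ k : K₂, ∃ k' ∈ K', x = k * k' * a := fun x => by
    obtain ⟨k, hk⟩ := QuotientGroup.mk_surjective (F.toEquiv.symm (QuotientGroup.mk x))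
    have h := congrArg F.toEquiv hk
    rw [F.toEquiv.apply_symm_apply, hF, QuotientGroup.eq] at h
    refine ⟨k, (k : G)⁻¹ * x * a⁻¹, (hmem _).2 ?_, by group⟩
    simpa [mul_assoc] using h
  have hπ : ∀ k : K₂, ∀ k' ∈ K', π (k * k' * a) = QuotientGroup.mk k := fun k k' hk' => by
    have h : (QuotientGroup.mk ((k : G) * k' * a) : G ⧸ K₁) = F.toEquiv (QuotientGroup.mk k) := by
      rw [hF, eq_comm, QuotientGroup.eq]
      simpa [mul_assoc] using (hmem _).1 hk'
    simp only [π]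
    rw [h, Equiv.symm_apply_apply]
    rfl
  obtain ⟨k, d, i₁, i₂, hstd, g, hg, hsub⟩ := exists_isRiemannianSubmersion_of_transverse hg₀ hK₂ hK'
    hL hHL hLK₂ hH' hm₁ hm₁' hm₂ hm₂' q hqL.iSup_eq hqH.irreducible
    (fun i j hij h => ⟨(hqq i j hij h).1, (hqq i j hij h).2.imp fun t ht => ⟨ht.2.1, ht.2.2.2⟩⟩)
    hKK' hπ
  exact ⟨k, d, i₁, i₂, hstd, g, π, fun _ => rfl, hg, hsub,
    F.isConnected_preimage hK₁ hL hHL hLK₂⟩
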